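/- Let $d\ge 3$. For $n$ with $dn$ even, let $G_n$ be the random $d$-regular multigraph on vertices $v_1,\dots,v_n$ obtained by attaching $d$ half-edges to each vertex and choosing a uniform perfect matching of the $dn$ half-edges (self-loops and multiple edges are allowed). Let $k_{i,j}$ be the number of edges between $v_i$ and $v_j$. For $\beta\ge 0$, $B\in\mathbb R$ put $$Z_n(\beta,B)=\sum_{\sigma\in\{\pm1\}^n}\exp\Big(\beta\sum_{i\le j}k_{i,j}\sigma_i\sigma_j+B\sum_i\sigma_i\Big),\qquad \psi_n(\beta,B)=\frac1n\log\mathbb E\,Z_n(\beta,B),$$ where $\mathbb E$ is the expectation over $G_n$, and $M_n=\partial_B\psi_n$, $\chi_n=\partial_B^2\psi_n$. Then, with all limits $n\to\infty$ taken through the $n$ for which $dn$ is even: 1. For all $\beta\ge0$ and $B>0$ the limits $\psi=\lim_n\psi_n$, $\mathcal M=\lim_n M_n$ and $\chi=\lim_n\chi_n$ exist at $(\beta,B)$. For $\beta,B>0$ the function $\psi$ is twice differentiable in $\beta$; put $\mathcal C=\partial_\beta^2\psi$. 2. For $\beta\ge 0$ the limit $\mathcal M(\beta,0^+)=\lim_{B\searrow0}\mathcal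 M(\beta,B)$ exists. The set $\{\beta>0:\mathcal M(\beta,0^+)>0\}$ is nonempty and its infimum $\beta_c$ is positive. For $\beta>0$, $\beta\ne\beta_c$, the limits $\chi(\beta,0^+)=\lim_{B\searrow0}\chi(\beta,B)$ and $\mathcal C(\beta,0^+)=\lim_{B\searrow0}\mathcal C(\beta,B)$ exist and are finite. 3. Write $f\asymp g$ if the ratio $f/g$ is bounded between two positive constants near the indicated limit. The annealed critical exponents, that is, the real numbers $\boldsymbol\beta,\boldsymbol\delta,\boldsymbol\gamma,\boldsymbol\gamma',\boldsymbol\alpha,\boldsymbol\alpha'$ such that $$\mathcal M(\beta,0^+)\asymp(\beta-\beta_c)^{\boldsymbol\beta}\ (\beta\searrow\beta_c),\qquad \mathcal M(\beta_c,B)\asymp B^{1/\boldsymbol\delta}\ (B\searrow0),$$ $$\chi(\beta,0^+)\asymp(\beta_c-\beta)^{-\boldsymbol\gamma}\ (\beta\nearrow\beta_c),\qquad \chi(\beta,0^+)\asymp(\beta-\beta_c)^{-\boldsymbol\gamma'}\ (\beta\searrow\beta_c),$$ $$\mathcal C(\beta,0^+)\asymp(\beta_c-\beta)^{-\boldsymbol\alpha}\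 (\beta\nearrow\beta_c),\qquad \mathcal C(\beta,0^+)\asymp(\beta-\beta_c)^{-\boldsymbol\alpha'}\ (\beta\searrow\beta_c),$$ exist, are unique, and are given by $$\boldsymbol\beta=\tfrac12,\qquad \boldsymbol\delta=3,\qquad \boldsymbol\gamma=\boldsymbol\gamma'=1,\qquad \boldsymbol\alpha=\boldsymbol\alpha'=0.$$ -/

import Mathlib

open Filter Topology

namespace AnnealedIsing

noncomputable section

/-- The half-edges of the model: each of the `n` vertices carries `d` half-edges. -/
abbrev HalfEdge (n d : ℕ) : Type := Fin n × Fin d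

/-- The perfect matchings of the set of half-edges, as fixed-point-free involutions: `π h` is the
half-edge matched with `h`. The random `d`-regular multigraph is obtained from a uniformly chosen
element of this set. The set is nonempty exactly when `d * n` is even. -/
def matchings (n d : ℕ) : Finset (Equiv.Perm (HalfEdge n d)) :=
  Finset.univ.filter fun π => ∀ h, π (π h) = h ∧ π h ≠ h

/-- Expectation with respect to the random `d`-regular multigraph on `n` vertices. -/
def expectation (n d : ℕ) (X : Equiv.Perm (HalfEdge n d) → ℝ) : ℝ :=
  (∑ π ∈ matchings n d, X π) / ((matchings n d).card : ℝ)

/-- The edges of the multigraph: the unordered pairs of matched half-edges. -/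
def edges {n d : ℕ} (π : Equiv.Perm (HalfEdge n d)) : Finset (Sym2 (HalfEdge n d)) :=
  Finset.univ.image fun h => s(h, π h)

/-- The number `k i j` of edges between the vertices `i` and `j` (a self-loop is one edge). -/
def edgeCount {n d : ℕ} (π : Equiv.Perm (HalfEdge n d)) (i j : Fin n) : ℕ :=
  ((edges π).filter fun e => e.map Prod.fst = s(i, j)).card

/-- The value `+1` or `-1` of the spin at `i`, as a real number. -/
def spin {n : ℕ} (σ : Fin n → ℤˣ) (i : Fin n) : ℝ := ((σ i : ℤ) : ℝ)

/-- The Hamiltonian `H(σ) = -β ∑_{i ≤ j} k i j σ_i σ_j - B ∑_i σ_i`. -/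
def hamiltonian {n d : ℕ} (π : Equiv.Perm (HalfEdge n d)) (β B : ℝ) (σ : Fin n → ℤˣ) : ℝ :=
  -β * (∑ i, ∑ j ∈ Finset.Ici i, (edgeCount π i j : ℝ) * spin σ i * spin σ j)
    - B * ∑ i, spin σ i

/-- The partition function of the Ising model on the multigraph. -/
def partitionFunction {n d : ℕ} (π : Equiv.Perm (HalfEdge n d)) (β B : ℝ) : ℝ :=
  ∑ σ : Fin n → ℤˣ, Real.exp (-hamiltonian π β B σ)

/-- The annealed pressure `ψ_n(β, B) = (1 / n) log 𝔼 Z_n(β, B)`. -/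
def pressureN (d n : ℕ) (β B : ℝ) : ℝ :=
  1 / (n : ℝ) * Real.log (expectation n d fun π => partitionFunction π β B)

/-- The annealed magnetization `M_n = ∂_B ψ_n`. -/
def magnetizationN (d n : ℕ) (β B : ℝ) : ℝ :=
  deriv (fun B' => pressureN d n β B') B

/-- The annealed susceptibility `χ_n = ∂_B M_n`. -/
def susceptibilityN (d n : ℕ) (β B : ℝ) : ℝ :=
  deriv (fun B' => magnetizationN d n β B') B

/-- The mode of convergence `n → ∞`, through the sizes `n` for which a `d`-regular multigraph on
`n` vertices exists, i.e. `d * n` is even. -/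
def sizes (d : ℕ) : Filter ℕ := atTop ⊓ 𝓟 {n | Even (d * n)}

/-- The limiting pressure `ψ`. -/
def pressure (d : ℕ) (β B : ℝ) : ℝ :=
  limUnder (sizes d) fun n => pressureN d n β B

/-- The limiting magnetization `M`. -/
def magnetization (d : ℕ) (β B : ℝ) : ℝ :=
  limUnder (sizes d) fun n => magnetizationN d n β B

/-- The limiting susceptibility `χ`. -/
def susceptibility (d : ℕ) (β B : ℝ) : ℝ :=
  limUnder (sizes d) fun n => susceptibilityN d n β B

/-- The limiting specific heat `C = ∂²_β ψ`, the second derivative of the limiting pressure. -/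
def specificHeat (d : ℕ) (β B : ℝ) : ℝ :=
  deriv (deriv fun b => pressure d b B) β

/-- The spontaneous magnetization `M(β, 0⁺)`. -/
def spontMagnetization (d : ℕ) (β : ℝ) : ℝ :=
  limUnder (𝓝[>] (0 : ℝ)) fun B => magnetization d β B

/-- The zero-field limit `χ(β, 0⁺)`. -/
def zeroFieldSusceptibility (d : ℕ) (β : ℝ) : ℝ :=
  limUnder (𝓝[>] (0 : ℝ)) fun B => susceptibility d β B

/-- The zero-field limit `C(β, 0⁺)`. -/
def zeroFieldSpecificHeat (d : ℕ) (β : ℝ) : ℝ :=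
  limUnder (𝓝[>] (0 : ℝ)) fun B => specificHeat d β B

/-- The inverse temperatures with positive spontaneous magnetization. -/
def orderedPhase (d : ℕ) : Set ℝ := {β | 0 < β ∧ 0 < spontMagnetization d β}

/-- The critical inverse temperature `β_c = inf {β > 0 : M(β, 0⁺) > 0}`. -/
def criticalBeta (d : ℕ) : ℝ := sInf (orderedPhase d)

/-- `f ≍ g` along `l`: the ratio `f / g` is bounded away from `0` and from infinity. -/
def Asymp (l : Filter ℝ) (f g : ℝ → ℝ) : Prop :=
  ∃ c C : ℝ, 0 < c ∧ ∀ᶠ x in l, c ≤ f x / g x ∧ f x / g x ≤ C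

/-- The defining relations of the annealed critical exponents `β, δ, γ, γ', α, α'`
(the exponent `β` is called `b` here). -/
structure AreCriticalExponents (d : ℕ) (b δ γ γ' α α' : ℝ) : Prop where
  magnetization_temperature :
    Asymp (𝓝[>] criticalBeta d) (spontMagnetization d) fun β => (β - criticalBeta d) ^ b
  magnetization_field :
    Asymp (𝓝[>] 0) (magnetization d (criticalBeta d)) fun B => B ^ (1 / δ)
  susceptibility_below :
    Asymp (𝓝[<] criticalBeta d) (zeroFieldSusceptibility d)
      fun β => (criticalBeta d - β) ^ (-γ)
  susceptibility_above :
    Asymp (𝓝[>] criticalBeta d) (zeroFieldSusceptibility d)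
      fun β => (β - criticalBeta d) ^ (-γ')
  specificHeat_below :
    Asymp (𝓝[<] criticalBeta d) (zeroFieldSpecificHeat d)
      fun β => (criticalBeta d - β) ^ (-α)
  specificHeat_above :
    Asymp (𝓝[>] criticalBeta d) (zeroFieldSpecificHeat d)
      fun β => (β - criticalBeta d) ^ (-α')

end

end AnnealedIsing

/-!
# Annealed critical exponents of the Ising model on the random regular multigraph

**The annealed partition function is a one-dimensional integral.** A sum over perfect matchings of a
product of edge weights `⟨x_h, x_h'⟩`, with `x_h` vectors of the plane, satisfies Wick's recursion,
and so does the integral of `∏ h, ⟨x_h, (cos θ, sin θ)⟩` over a half circle, by integration by parts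
(`sum_pairings_eq_integral`). For `β ≥ 0` the Ising weights `e ^ (β σ σ')` are such inner products,
with `x = (√cosh β, σ √sinh β)`. Summing over the spins gives
`𝔼 Z_n = ∫ F ^ n / ∫ cos ^ (d n)` with
`F = e ^ B (√cosh β cos + √sinh β sin) ^ d + e ^ (-B) (√cosh β cos - √sinh β sin) ^ d`
(`expectation_partitionFunction`).

**Laplace's method.** For `β, B > 0` the maximum of `|F|` is attained on a single line, where
`t = tan θ * √tanh β` is the positive solution of `t = T tanh (B + (d - 1) artanh t)`, `T = tanh β`
(`max_powerPair_eq_root`). Concentration at the peak gives the limits of the pressure and of the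
magnetization. The susceptibility is a variance multiplied by `n`; its limit follows from
concentration of the weights `|F| ^ n` and `|F| ^ n sin ^ 2` together with the identity
`∫ (g F ^ n)' = 0`, which trades a factor `n` for the derivative of `F`, so that no Gaussian
rescaling is needed (`HasPeak.tendsto_fluctuation`).

**The limiting functions.** The limits are explicit in `t` (`tendsto_of_pos`), and `t` is a
differentiable function of `T`, whose derivative has the denominator
`stiffness = T - r T² + (r - T) t²`, `r = d - 1`. The pressure is stationary in `t`, which gives its
first and second derivatives in `β`.

**Criticality.** The field at which `t` solves the equation is the integral of
`stiffness r T s / ((T² - s²) (1 - s²))` over `0 ≤ s ≤ t`. In zero field a positive solution exists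
exactly for `r T > 1`, so `tanh β_c = 1 / r`. Comparing the integrand with quadratic polynomials
gives `t² ~ 3 T (r T - 1) / (r - T)` just above the critical point, and `B` proportional to `t³` on
the critical isotherm. Each ratio defining an exponent then has a positive limit, which determines
the exponent (`asymp_rpow_iff`).
-/

namespace AnnealedIsing

/-! ### Matchings and Wick's formula on the circle -/

open Finset in
/-- The perfect matchings of a finite set `s`, as involutions of the ambient type whose set of
moved points is exactly `s`. -/
def pairings {α : Type*} [Fintype α] [DecidableEq α] (s : Finset α) : Finset (Equiv.Perm α) :=
  Finset.univ.filter fun π => (∀ h, π (π h) = h) ∧ ∀ h, π h ≠ h ↔ h ∈ s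

section Pairings

open Finset

variable {α : Type*} [Fintype α] [DecidableEq α]

lemma mem_pairings {s : Finset α} {π : Equiv.Perm α} :
    π ∈ pairings s ↔ (∀ h, π (π h) = h) ∧ ∀ h, π h ≠ h ↔ h ∈ s := by
  simp [pairings]

lemma pairings_empty : pairings (∅ : Finset α) = {1} := by
  ext π
  simp only [mem_pairings, mem_singleton, notMem_empty, iff_false, not_not]
  constructor
  · intro h
    ext x
    simp [h.2 x]
  · rintro rfl
    simp

/-- Removing the pair `{a, b}` from a matching, by composition with the transposition. -/
lemma swap_mul_mem_pairings {s : Finset α} {a b : α} (ha : a ∈ s) {π : Equiv.Perm α}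
    (hπ : π ∈ pairings s) (hab : π a = b) :
    Equiv.swap a b * π ∈ pairings ((s.erase a).erase b) := by
  rw [mem_pairings] at hπ ⊢
  obtain ⟨h1, h2⟩ := hπ
  have hne : b ≠ a := by rw [← hab]; exact (h2 a).2 ha
  have hba : π b = a := by rw [← hab]; exact h1 a
  have key : ∀ h, h ≠ a → h ≠ b → π h ≠ a ∧ π h ≠ b := by
    intro h hha hhb
    constructor
    · intro e
      exact hhb (by rw [← hab, ← e, h1])
    · intro e
      exact hha (by rw [← hba, ← e, h1])
  have val : ∀ h, (Equiv.swap a b * π) h = if h = a ∨ h = b then h else π h := by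
    intro h
    rw [Equiv.Perm.mul_apply]
    by_cases hha : h = a
    · subst hha
      simp [hab]
    · by_cases hhb : h = b
      · subst hhb
        simp [hba]
      · rw [Equiv.swap_apply_of_ne_of_ne (key h hha hhb).1 (key h hha hhb).2]
        simp [hha, hhb]
  constructor
  · intro h
    by_cases hh : h = a ∨ h = b
    · rw [val h, if_pos hh, val h, if_pos hh]
    · rw [val h, if_neg hh]
      push Not at hh
      have := key h hh.1 hh.2
      rw [val, if_neg (by tauto), h1]
  · intro h
    rw [val]
    by_cases hh : h = a ∨ h = b
    · simp only [if_pos hh, mem_erase]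
      tauto
    · rw [if_neg hh, h2]
      simp only [mem_erase]
      tauto

/-- Adding the pair `{a, b}` to a matching, by composition with the transposition. -/
lemma swap_mul_mem_pairings_of_erase {s : Finset α} {a b : α} (ha : a ∈ s) (hb : b ∈ s)
    (hne : b ≠ a) {π : Equiv.Perm α} (hπ : π ∈ pairings ((s.erase a).erase b)) :
    Equiv.swap a b * π ∈ pairings s ∧ (Equiv.swap a b * π) a = b := by
  rw [mem_pairings] at hπ
  obtain ⟨h1, h2⟩ := hπ
  have hπa : π a = a := by
    by_contra h
    have := (h2 a).1 h
    simp at this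
  have hπb : π b = b := by
    by_contra h
    have := (h2 b).1 h
    simp at this
  have key : ∀ h, h ≠ a → h ≠ b → π h ≠ a ∧ π h ≠ b := by
    intro h hha hhb
    constructor
    · intro e
      exact hha (by rw [← hπa, ← e, h1])
    · intro e
      exact hhb (by rw [← hπb, ← e, h1])
  have va : (Equiv.swap a b * π) a = b := by simp [hπa]
  have vb : (Equiv.swap a b * π) b = a := by simp [hπb]
  have val : ∀ h, h ≠ a → h ≠ b → (Equiv.swap a b * π) h = π h := by
    intro h hha hhb
    rw [Equiv.Perm.mul_apply,
      Equiv.swap_apply_of_ne_of_ne (key h hha hhb).1 (key h hha hhb).2]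
  refine ⟨mem_pairings.2 ⟨?_, ?_⟩, va⟩
  · intro h
    by_cases hha : h = a
    · rw [hha, va, vb]
    by_cases hhb : h = b
    · rw [hhb, vb, va]
    rw [val h hha hhb, val _ (key h hha hhb).1 (key h hha hhb).2, h1]
  · intro h
    by_cases hha : h = a
    · rw [hha, va]; tauto
    by_cases hhb : h = b
    · rw [hhb, vb]; tauto
    rw [val h hha hhb, h2]
    simp only [mem_erase]
    tauto

/-- Expansion of a weighted sum over matchings along the partner of a fixed point `a`. -/
lemma sum_pairings_eq_sum_erase (w : α → α → ℝ) {s : Finset α} {a : α} (ha : a ∈ s) :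
    ∑ π ∈ pairings s, ∏ h ∈ s, w h (π h) =
      ∑ b ∈ s.erase a, w a b * w b a *
        ∑ π ∈ pairings ((s.erase a).erase b), ∏ h ∈ (s.erase a).erase b, w h (π h) := by
  rw [← Finset.sum_fiberwise_of_maps_to (s := pairings s) (t := s.erase a) (g := fun π => π a)]
  · refine Finset.sum_congr rfl fun b hb => ?_
    obtain ⟨hne, hbs⟩ := Finset.mem_erase.1 hb
    rw [Finset.mul_sum]
    refine Finset.sum_bij' (fun π _ => Equiv.swap a b * π) (fun π _ => Equiv.swap a b * π)
      ?_ ?_ ?_ ?_ ?_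
    · intro π hπ
      rw [mem_filter] at hπ
      exact swap_mul_mem_pairings ha hπ.1 hπ.2
    · intro π hπ
      rw [mem_filter]
      exact swap_mul_mem_pairings_of_erase ha hbs hne hπ
    · intro π _
      simp [← mul_assoc]
    · intro π _
      simp [← mul_assoc]
    · intro π hπ
      rw [mem_filter] at hπ
      have h1 := (mem_pairings.1 hπ.1).1
      have hab : π a = b := hπ.2
      have hba : π b = a := by rw [← hab]; exact h1 a
      rw [← Finset.mul_prod_erase s _ ha, ← Finset.mul_prod_erase (s.erase a) _ hb, hab, hba,
        ← mul_assoc]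
      congr 1
      refine Finset.prod_congr rfl fun h hh => ?_
      simp only [mem_erase] at hh
      rw [Equiv.Perm.mul_apply, Equiv.swap_apply_of_ne_of_ne]
      · intro e
        exact hh.1 (by rw [← hab, ← e, h1])
      · intro e
        exact hh.2.1 (by rw [← hba, ← e, h1])
  · intro π hπ
    have h := mem_pairings.1 hπ
    refine Finset.mem_erase.2 ⟨(h.2 a).2 ha, (h.2 _).1 ?_⟩
    rw [h.1]
    exact ((h.2 a).2 ha).symm

/-- A linear form on the plane, restricted to the unit circle. -/
noncomputable def circleForm (u v θ : ℝ) : ℝ := u * Real.cos θ + v * Real.sin θ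

lemma hasDerivAt_circleForm (u v θ : ℝ) :
    HasDerivAt (circleForm u v) (circleForm v (-u) θ) θ := by
  have h := ((Real.hasDerivAt_cos θ).const_mul u).add ((Real.hasDerivAt_sin θ).const_mul v)
  refine h.congr_deriv ?_
  simp only [circleForm]
  ring

lemma continuous_circleForm (u v : ℝ) : Continuous (circleForm u v) := by
  unfold circleForm
  fun_prop

lemma circleForm_add_pi (u v θ : ℝ) : circleForm u v (θ + Real.pi) = -circleForm u v θ := by
  simp only [circleForm, Real.cos_add_pi, Real.sin_add_pi]
  ring

omit [Fintype α] in
/-- Integration by parts on the circle for a product of an even number of linear forms: the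
analogue of Wick's recursion for Gaussian moments. -/
lemma card_mul_integral_prod_circleForm (u v : α → ℝ) (τ : ℝ) {s : Finset α} (hs : Even s.card)
    {a : α} (ha : a ∈ s) :
    (s.card : ℝ) * ∫ θ in τ..τ + Real.pi, ∏ h ∈ s, circleForm (u h) (v h) θ =
      ∑ b ∈ s.erase a, (u a * u b + v a * v b) *
        ∫ θ in τ..τ + Real.pi, ∏ h ∈ (s.erase a).erase b, circleForm (u h) (v h) θ := by
  set t := s.erase a with ht
  have hcard : (s.card : ℝ) = t.card + 1 := by
    rw [← Finset.card_erase_add_one ha]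
    push_cast
    rfl
  have hc : ∀ r : Finset α, Continuous fun θ => ∏ h ∈ r, circleForm (u h) (v h) θ := fun r =>
    continuous_finsetProd _ fun h _ => continuous_circleForm _ _
  have hd : ∀ θ, HasDerivAt
      (fun θ => circleForm (v a) (-u a) θ * ∏ h ∈ t, circleForm (u h) (v h) θ)
      (∑ b ∈ t, (u a * u b + v a * v b) * ∏ h ∈ t.erase b, circleForm (u h) (v h) θ
        - s.card * ∏ h ∈ s, circleForm (u h) (v h) θ) θ := by
    intro θ
    have h1 := hasDerivAt_circleForm (v a) (-u a) θ
    have h2 := HasDerivAt.fun_finsetProd (u := t) (x := θ)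
      (f := fun h θ => circleForm (u h) (v h) θ) (f' := fun h => circleForm (v h) (-u h) θ)
      (fun h _ => hasDerivAt_circleForm (u h) (v h) θ)
    refine (h1.mul h2).congr_deriv ?_
    have h3 : ∀ b ∈ t, circleForm (v a) (-u a) θ *
        ((∏ h ∈ t.erase b, circleForm (u h) (v h) θ) • circleForm (v b) (-u b) θ) =
        (u a * u b + v a * v b) * ∏ h ∈ t.erase b, circleForm (u h) (v h) θ -
          ∏ h ∈ s, circleForm (u h) (v h) θ := by
      intro b hb
      rw [← Finset.mul_prod_erase s _ ha, ← ht, ← Finset.mul_prod_erase t _ hb, smul_eq_mul]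
      have h4 : circleForm (v a) (-u a) θ * circleForm (v b) (-u b) θ =
          (u a * u b + v a * v b) - circleForm (u a) (v a) θ * circleForm (u b) (v b) θ := by
        simp only [circleForm]
        linear_combination (u a * u b + v a * v b) * Real.sin_sq_add_cos_sq θ
      linear_combination (∏ h ∈ t.erase b, circleForm (u h) (v h) θ) * h4
    rw [Finset.mul_sum, Finset.sum_congr rfl h3, Finset.sum_sub_distrib, Finset.sum_const,
      nsmul_eq_mul, hcard, ← Finset.mul_prod_erase s _ ha, ← ht]
    simp only [circleForm]
    ring
  have h5 := intervalIntegral.integral_eq_sub_of_hasDerivAt (a := τ) (b := τ + Real.pi)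
    (fun θ _ => hd θ) (Continuous.intervalIntegrable (by
      refine Continuous.sub (continuous_finsetSum _ fun b _ => ?_) ?_
      · exact continuous_const.mul (hc _)
      · exact continuous_const.mul (hc _)) _ _)
  have h6 : circleForm (v a) (-u a) (τ + Real.pi) *
      ∏ h ∈ t, circleForm (u h) (v h) (τ + Real.pi) -
      circleForm (v a) (-u a) τ * ∏ h ∈ t, circleForm (u h) (v h) τ = 0 := by
    have hodd : Odd t.card := by
      rw [← Finset.card_erase_add_one ha] at hs
      exact Nat.not_even_iff_odd.1 (fun h => (Nat.not_even_iff_odd.2 h.add_one) hs)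
    simp only [circleForm_add_pi]
    rw [Finset.prod_neg, hodd.neg_one_pow]
    ring
  rw [h6, intervalIntegral.integral_sub, intervalIntegral.integral_finsetSum,
    intervalIntegral.integral_const_mul, sub_eq_zero] at h5
  · rw [← h5]
    exact Finset.sum_congr rfl fun b _ => intervalIntegral.integral_const_mul _ _
  · exact fun b _ => (continuous_const.mul (hc _)).intervalIntegrable _ _
  · exact (continuous_finsetSum _ fun b _ => continuous_const.mul (hc _)).intervalIntegrable _ _
  · exact (continuous_const.mul (hc _)).intervalIntegrable _ _

/-- The half-circle integral of a product of `2 * k` linear forms, per matching: `π / (2 * k)‼`. -/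
noncomputable def wickConst : ℕ → ℝ
  | 0 => Real.pi
  | k + 1 => wickConst k / (2 * (k + 1))

lemma wickConst_pos : ∀ k, 0 < wickConst k
  | 0 => Real.pi_pos
  | k + 1 => div_pos (wickConst_pos k) (by positivity)

/-- Wick's formula on the circle: a weighted sum over matchings whose edge weights are inner
products of plane vectors is an integral of the product of the corresponding linear forms. -/
theorem sum_pairings_eq_integral (w : α → α → ℝ) (u v : α → ℝ)
    (hw : ∀ a b, w a b * w b a = u a * u b + v a * v b) (τ : ℝ) (k : ℕ) (s : Finset α)
    (hs : s.card = 2 * k) :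
    wickConst k * ∑ π ∈ pairings s, ∏ h ∈ s, w h (π h) =
      ∫ θ in τ..τ + Real.pi, ∏ h ∈ s, circleForm (u h) (v h) θ := by
  induction k generalizing s with
  | zero =>
    have : s = ∅ := by simpa using hs
    subst this
    simp [pairings_empty, wickConst]
  | succ k ih =>
    have hne : s.Nonempty := by
      rw [← Finset.card_pos, hs]
      omega
    obtain ⟨a, ha⟩ := hne
    have h1 := card_mul_integral_prod_circleForm u v τ (hs ▸ even_two_mul _) ha
    rw [sum_pairings_eq_sum_erase w ha]
    have h2 : ∀ b ∈ s.erase a, (u a * u b + v a * v b) *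
        ∫ θ in τ..τ + Real.pi, ∏ h ∈ (s.erase a).erase b, circleForm (u h) (v h) θ =
        wickConst k * (w a b * w b a *
          ∑ π ∈ pairings ((s.erase a).erase b), ∏ h ∈ (s.erase a).erase b, w h (π h)) := by
      intro b hb
      rw [← ih, hw]
      · ring
      · rw [Finset.card_erase_of_mem hb, Finset.card_erase_of_mem ha, hs]
        omega
    rw [Finset.sum_congr rfl h2, ← Finset.mul_sum, hs] at h1
    rw [wickConst]
    have h3 : (2 * ((k : ℝ) + 1)) ≠ 0 := by positivity
    push_cast at h1
    field_simp
    linarith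

end Pairings

/-! ### The circle representation of the annealed partition function -/

section Partition

variable {n d : ℕ}

lemma matchings_eq_pairings (n d : ℕ) :
    matchings n d = pairings (Finset.univ : Finset (HalfEdge n d)) := by
  ext π
  simp only [matchings, mem_pairings, Finset.mem_filter, Finset.mem_univ, true_and, iff_true]
  exact forall_and

/-- Each edge carries two half-edges. -/
lemma two_mul_sum_edges {π : Equiv.Perm (HalfEdge n d)} (hπ : π ∈ matchings n d)
    (g : Sym2 (HalfEdge n d) → ℝ) :
    2 * ∑ e ∈ edges π, g e = ∑ h, g s(h, π h) := by
  have hπ' : ∀ h, π (π h) = h ∧ π h ≠ h := by simpa [matchings] using hπ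
  rw [edges, Finset.sum_comp g (fun h => s(h, π h)), Finset.mul_sum]
  refine Finset.sum_congr rfl fun e he => ?_
  obtain ⟨h, -, rfl⟩ := Finset.mem_image.1 he
  have : Finset.univ.filter (fun h' => s(h', π h') = s(h, π h)) = {h, π h} := by
    ext h'
    simp only [Finset.mem_filter, Finset.mem_univ, true_and, Finset.mem_insert,
      Finset.mem_singleton, Sym2.eq_iff]
    constructor
    · tauto
    · rintro (rfl | rfl)
      · simp
      · simp [(hπ' h).1]
  rw [this, Finset.card_pair (hπ' h).2.symm]
  simp

/-- The edge sum of the Hamiltonian, as a sum over half-edges. -/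
lemma two_mul_sum_edgeCount {π : Equiv.Perm (HalfEdge n d)} (hπ : π ∈ matchings n d)
    (x : Fin n → ℝ) :
    2 * ∑ i, ∑ j ∈ Finset.Ici i, (edgeCount π i j : ℝ) * x i * x j =
      ∑ h : HalfEdge n d, x h.1 * x (π h).1 := by
  let m : Sym2 (Fin n) → ℝ :=
    Sym2.lift ⟨fun i j => x i * x j, fun i j => mul_comm _ _⟩
  have h1 : ∑ i, ∑ j ∈ Finset.Ici i, (edgeCount π i j : ℝ) * x i * x j =
      ∑ e ∈ edges π, m (e.map Prod.fst) := by
    have h2 : ∀ i j, (edgeCount π i j : ℝ) * x i * x j =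
        ∑ e ∈ edges π, if e.map Prod.fst = s(i, j) then x i * x j else 0 := by
      intro i j
      rw [edgeCount, ← Finset.sum_filter, Finset.sum_const, nsmul_eq_mul, mul_assoc]
    simp only [h2]
    rw [Finset.sum_congr rfl fun i _ => Finset.sum_comm, Finset.sum_comm]
    refine Finset.sum_congr rfl fun e _ => ?_
    generalize e.map Prod.fst = e'
    induction e' with
    | h p q =>
      wlog hpq : p ≤ q generalizing p q
      · have := this q p (le_of_not_ge hpq)
        rw [Sym2.eq_swap]
        exact this
      rw [Finset.sum_eq_single p, Finset.sum_eq_single q]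
      · simp [m]
      · intro j hj hjq
        rw [if_neg]
        rw [Sym2.eq_iff]
        rintro (h | h)
        · exact hjq h.2.symm
        · exact hjq (by rw [h.2, ← h.1])
      · intro h
        exact absurd (Finset.mem_Ici.2 hpq) h
      · intro i _ hip
        refine Finset.sum_eq_zero fun j hj => ?_
        rw [if_neg]
        rw [Sym2.eq_iff]
        rintro (h | h)
        · exact hip h.1.symm
        · have hj' := Finset.mem_Ici.1 hj
          rw [← h.1, ← h.2] at hj'
          exact hip (by rw [← h.2]; exact le_antisymm hj' hpq)
      · simp
  rw [h1, two_mul_sum_edges hπ]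
  rfl

/-- The function on the circle whose `n`-th power integrates, up to normalisation, to the annealed
partition function on `n` vertices. The two linear forms are `√cosh β cos θ ± √sinh β sin θ`: the
inner products of their coefficient vectors are the edge weights `e ^ (± β)`. -/
noncomputable def circleF (d : ℕ) (β B θ : ℝ) : ℝ :=
  Real.exp B * circleForm √(Real.cosh β) √(Real.sinh β) θ ^ d +
    Real.exp (-B) * circleForm √(Real.cosh β) (-√(Real.sinh β)) θ ^ d

lemma card_matchings (hn : Even (d * n)) (τ : ℝ) :
    wickConst (d * n / 2) * (matchings n d).card =
      ∫ θ in τ..τ + Real.pi, Real.cos θ ^ (d * n) := by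
  have h := sum_pairings_eq_integral (α := HalfEdge n d) (fun _ _ => 1) (fun _ => 1) (fun _ => 0)
    (by simp) τ (d * n / 2) Finset.univ (by
      rw [Nat.two_mul_div_two_of_even hn]
      simp [mul_comm])
  rw [matchings_eq_pairings]
  simpa [circleForm, mul_comm n d] using h

lemma integral_cos_pow_eq (hn : Even (d * n)) (τ : ℝ) :
    ∫ θ in τ..τ + Real.pi, Real.cos θ ^ (d * n) =
      ∫ θ in (-(Real.pi / 2))..(Real.pi / 2), Real.cos θ ^ (d * n) := by
  have h := card_matchings (n := n) (d := d) hn (-(Real.pi / 2))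
  rw [show -(Real.pi / 2) + Real.pi = Real.pi / 2 by ring] at h
  rw [← card_matchings hn τ, h]

lemma integral_cos_pow_pos (hn : Even (d * n)) :
    0 < ∫ θ in (-(Real.pi / 2))..(Real.pi / 2), Real.cos θ ^ (d * n) := by
  refine intervalIntegral.integral_pos (by linarith [Real.pi_pos]) (by fun_prop) ?_ ?_
  · exact fun x _ => hn.pow_nonneg _
  · exact ⟨0, ⟨by linarith [Real.pi_pos], by linarith [Real.pi_pos]⟩, by simp⟩

lemma spin_eq_one_or (σ : Fin n → ℤˣ) (i : Fin n) : spin σ i = 1 ∨ spin σ i = -1 := by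
  rcases Int.units_eq_one_or (σ i) with h | h <;> simp [spin, h]

/-- The circle representation of the annealed partition function. -/
theorem expectation_partitionFunction {β : ℝ} (hβ : 0 ≤ β) (B : ℝ) (hn : Even (d * n)) (τ : ℝ) :
    expectation n d (fun π => partitionFunction π β B) =
      (∫ θ in τ..τ + Real.pi, circleF d β B θ ^ n) /
        ∫ θ in (-(Real.pi / 2))..(Real.pi / 2), Real.cos θ ^ (d * n) := by
  have hsinh : 0 ≤ Real.sinh β := Real.sinh_nonneg_iff.2 hβ
  have hcosh : 0 ≤ Real.cosh β := (Real.cosh_pos β).le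
  have hterm : ∀ σ : Fin n → ℤˣ,
      wickConst (d * n / 2) * ∑ π ∈ matchings n d, Real.exp (-hamiltonian π β B σ) =
      ∫ θ in τ..τ + Real.pi, ∏ i, (Real.exp (B * spin σ i) *
        circleForm √(Real.cosh β) (√(Real.sinh β) * spin σ i) θ ^ d) := by
    intro σ
    have h := sum_pairings_eq_integral (α := HalfEdge n d)
      (fun h h' => Real.exp (β / 2 * (spin σ h.1 * spin σ h'.1)))
      (fun _ => √(Real.cosh β)) (fun h => √(Real.sinh β) * spin σ h.1)
      (by
        intro h h'
        rw [← Real.exp_add]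
        have e1 : √(Real.cosh β) * √(Real.cosh β) = Real.cosh β := Real.mul_self_sqrt hcosh
        have e2 : √(Real.sinh β) * √(Real.sinh β) = Real.sinh β := Real.mul_self_sqrt hsinh
        have e3 := Real.cosh_add_sinh β
        have e4 := Real.cosh_sub_sinh β
        rcases spin_eq_one_or σ h.1 with h1 | h1 <;> rcases spin_eq_one_or σ h'.1 with h2 | h2 <;>
          rw [h1, h2] <;> ring_nf <;> rw [Real.sq_sqrt hcosh, Real.sq_sqrt hsinh] <;> linarith)
      τ (d * n / 2) Finset.univ (by
        rw [Nat.two_mul_div_two_of_even hn]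
        simp [mul_comm])
    rw [← matchings_eq_pairings] at h
    have hsum : ∑ π ∈ matchings n d, Real.exp (-hamiltonian π β B σ) =
        (∏ i, Real.exp (B * spin σ i)) * ∑ π ∈ matchings n d, ∏ h : HalfEdge n d,
          Real.exp (β / 2 * (spin σ h.1 * spin σ (π h).1)) := by
      rw [Finset.mul_sum]
      refine Finset.sum_congr rfl fun π hπ => ?_
      rw [← Real.exp_sum, ← Real.exp_sum, ← Real.exp_add, ← Finset.mul_sum, ← Finset.mul_sum,
        hamiltonian]
      congr 1
      have := two_mul_sum_edgeCount hπ (spin σ)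
      linear_combination (β / 2) * this
    rw [hsum, mul_left_comm, h, ← intervalIntegral.integral_const_mul]
    refine intervalIntegral.integral_congr fun θ _ => ?_
    rw [Finset.prod_mul_distrib, Fintype.prod_prod_type]
    simp
  have hZ : wickConst (d * n / 2) * ∑ π ∈ matchings n d, partitionFunction π β B =
      ∫ θ in τ..τ + Real.pi, circleF d β B θ ^ n := by
    simp only [partitionFunction]
    rw [Finset.sum_comm, Finset.mul_sum, Finset.sum_congr rfl fun σ _ => hterm σ,
      ← intervalIntegral.integral_finsetSum]
    · refine intervalIntegral.integral_congr fun θ _ => ?_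
      have h := Finset.prod_univ_sum (fun _ : Fin n => (Finset.univ : Finset ℤˣ))
        (fun _ s => Real.exp (B * ((s : ℤ) : ℝ)) *
          circleForm √(Real.cosh β) (√(Real.sinh β) * ((s : ℤ) : ℝ)) θ ^ d)
      rw [Fintype.piFinset_univ] at h
      simp only [spin]
      rw [← h, Finset.prod_const, Finset.card_univ, Fintype.card_fin]
      congr 1
      rw [show (Finset.univ : Finset ℤˣ) = {1, -1} from rfl, Finset.sum_pair (by decide)]
      simp [circleF]
    · intro σ _
      refine Continuous.intervalIntegrable (continuous_finsetProd _ fun i _ => ?_) _ _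
      exact continuous_const.mul ((continuous_circleForm _ _).pow d)
  have hw := wickConst_pos (d * n / 2)
  rw [expectation, ← hZ, ← integral_cos_pow_eq hn τ, ← card_matchings hn τ,
    mul_div_mul_left _ _ hw.ne']

end Partition

/-! ### The Laplace method on the half circle -/

section Laplace

open MeasureTheory Set Real

/-- The half circle `[-π/2, π/2]`, as a fundamental domain for functions of period `π`. -/
def halfCircle : Set ℝ := Icc (-(π / 2)) (π / 2)

lemma zero_mem_halfCircle : (0 : ℝ) ∈ halfCircle :=
  ⟨by linarith [pi_pos], by linarith [pi_pos]⟩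

lemma halfCircle_mem_nhds : halfCircle ∈ 𝓝 (0 : ℝ) :=
  Icc_mem_nhds (by linarith [pi_pos]) (by linarith [pi_pos])

/-- The integral of `h` over the half circle against the weight `|f| ^ n`. -/
noncomputable def weighted (f : ℝ → ℝ) (n : ℕ) (h : ℝ → ℝ) : ℝ :=
  ∫ x in halfCircle, |f x| ^ n * h x

variable {f : ℝ → ℝ}

/-- The function `f` is continuous, and `|f|` has a strict maximum over the half circle at `0`,
where `f` is positive. -/
structure HasPeak (f : ℝ → ℝ) : Prop where
  continuous : Continuous f
  pos : 0 < f 0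
  lt : ∀ x ∈ halfCircle, x ≠ 0 → |f x| < f 0

lemma integrableOn_weighted (hf : Continuous f) (n : ℕ) {h : ℝ → ℝ}
    (hh : ContinuousOn h halfCircle) :
    IntegrableOn (fun x => |f x| ^ n * h x) halfCircle :=
  ContinuousOn.integrableOn_compact isCompact_Icc ((hf.abs.pow n).continuousOn.mul hh)

lemma weighted_add (hf : Continuous f) (n : ℕ) {g h : ℝ → ℝ} (hg : ContinuousOn g halfCircle)
    (hh : ContinuousOn h halfCircle) :
    weighted f n (fun x => g x + h x) = weighted f n g + weighted f n h := by
  rw [weighted, weighted, weighted, ← integral_add (integrableOn_weighted hf n hg)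
    (integrableOn_weighted hf n hh)]
  simp only [mul_add]

lemma weighted_const_mul (n : ℕ) (c : ℝ) (h : ℝ → ℝ) :
    weighted f n (fun x => c * h x) = c * weighted f n h := by
  rw [weighted, weighted, ← integral_const_mul]
  simp only [mul_left_comm]

lemma weighted_congr (n : ℕ) {g h : ℝ → ℝ} (hgh : ∀ x ∈ halfCircle, g x = h x) :
    weighted f n g = weighted f n h := by
  refine setIntegral_congr_fun measurableSet_Icc fun x hx => ?_
  simp only [hgh x hx]

lemma weighted_nonneg (n : ℕ) {h : ℝ → ℝ} (hh : ∀ x, 0 ≤ h x) : 0 ≤ weighted f n h :=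
  setIntegral_nonneg measurableSet_Icc fun x _ => mul_nonneg (by positivity) (hh x)

lemma weighted_eq_intervalIntegral (n : ℕ) (h : ℝ → ℝ) :
    weighted f n h = ∫ x in (-(π / 2))..(π / 2), |f x| ^ n * h x := by
  rw [weighted, halfCircle, integral_Icc_eq_integral_Ioc,
    intervalIntegral.integral_of_le (by linarith [pi_pos])]

lemma weighted_one_pos (hf : HasPeak f) (n : ℕ) : 0 < weighted f n fun _ => 1 := by
  have := hf.continuous
  rw [weighted_eq_intervalIntegral]
  refine intervalIntegral.integral_pos (by linarith [pi_pos]) (by fun_prop) ?_ ?_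
  · exact fun x _ => by positivity
  · exact ⟨0, zero_mem_halfCircle, by have := hf.pos; positivity⟩

/-- The Cauchy–Schwarz inequality for the weight `|f| ^ n`. -/
lemma sq_weighted_mul_le (hf : Continuous f) (n : ℕ) {g h : ℝ → ℝ}
    (hg : ContinuousOn g halfCircle) (hh : ContinuousOn h halfCircle) :
    weighted f n (fun x => g x * h x) ^ 2 ≤
      weighted f n (fun x => g x ^ 2) * weighted f n (fun x => h x ^ 2) := by
  have h1 : ∀ t : ℝ, 0 ≤ weighted f n (fun x => g x ^ 2) * (t * t) +
      2 * weighted f n (fun x => g x * h x) * t + weighted f n (fun x => h x ^ 2) := by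
    intro t
    have h2 : weighted f n (fun x => (t * g x + h x) ^ 2) =
        weighted f n (fun x => g x ^ 2) * (t * t) +
        2 * weighted f n (fun x => g x * h x) * t + weighted f n (fun x => h x ^ 2) := by
      have h3 : weighted f n (fun x => (t * g x + h x) ^ 2) =
          weighted f n (fun x => ((t * t) * g x ^ 2 + (2 * t) * (g x * h x)) + h x ^ 2) :=
        weighted_congr n fun x _ => by ring
      rw [h3, weighted_add hf n (by fun_prop) (by fun_prop),
        weighted_add hf n (by fun_prop) (by fun_prop), weighted_const_mul, weighted_const_mul]
      ring
    rw [← h2]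
    exact weighted_nonneg n fun x => sq_nonneg _
  have h4 := discrim_le_zero h1
  rw [discrim] at h4
  nlinarith

/-- Concentration of the weights `|f| ^ n` at the peak of `f`. -/
lemma HasPeak.tendsto_weighted (hf : HasPeak f) {h : ℝ → ℝ} (hh : ContinuousOn h halfCircle) :
    Tendsto (fun n => weighted f n h / weighted f n fun _ => 1) atTop (𝓝 (h 0)) := by
  have h1 := tendsto_setIntegral_pow_smul_of_unique_maximum_of_isCompact_of_continuousOn
    (μ := volume) (x₀ := (0 : ℝ)) (s := halfCircle) (c := fun x => |f x|) (g := h) isCompact_Icc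
    hf.continuous.abs.continuousOn
    (fun y hy hy0 => by rw [abs_of_pos hf.pos]; exact hf.lt y hy hy0)
    (fun x _ => abs_nonneg _) (by rw [abs_of_pos hf.pos]; exact hf.pos)
    (subset_closure (mem_interior_iff_mem_nhds.2 halfCircle_mem_nhds)) hh
  refine h1.congr fun n => ?_
  simp only [smul_eq_mul, weighted, mul_one]
  rw [inv_mul_eq_div]

/-- Concentration of the weights `|f| ^ n * sin ^ 2` at the peak of `f`. -/
lemma HasPeak.tendsto_weighted_sin_sq (hf : HasPeak f) {h : ℝ → ℝ}
    (hh : ContinuousOn h halfCircle) :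
    Tendsto (fun n => weighted f n (fun x => sin x ^ 2 * h x) / weighted f n fun x => sin x ^ 2)
      atTop (𝓝 (h 0)) := by
  let ρ : ℝ → NNReal := fun x => ⟨sin x ^ 2, sq_nonneg _⟩
  have hρ : Continuous ρ := by
    refine Continuous.subtype_mk (by fun_prop) _
  have hloc : IsLocallyFiniteMeasure ((volume : Measure ℝ).withDensity fun x => (ρ x : ENNReal)) :=
    IsLocallyFiniteMeasure.withDensity_coe hρ
  have hpos : ∀ u, IsOpen u → (0 : ℝ) ∈ u →
      0 < ((volume : Measure ℝ).withDensity fun x => (ρ x : ENNReal)) (u ∩ halfCircle) := by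
    intro u hu h0
    rw [pos_iff_ne_zero, Ne, withDensity_apply_eq_zero (by fun_prop)]
    have h1 : u ∩ halfCircle ∈ 𝓝 (0 : ℝ) := inter_mem (hu.mem_nhds h0) halfCircle_mem_nhds
    obtain ⟨ε, hε, hball⟩ := Metric.mem_nhds_iff.1 h1
    have h2 : Ioo 0 (min ε 1) ⊆
        {x | ((ρ x : NNReal) : ENNReal) ≠ 0} ∩ (u ∩ halfCircle) := by
      intro x hx
      refine ⟨?_, hball ?_⟩
      · have : 0 < sin x := sin_pos_of_pos_of_le_one hx.1 (hx.2.le.trans (min_le_right _ _))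
        simp only [mem_ofPred_eq, ne_eq, ENNReal.coe_eq_zero]
        intro h
        have h3 : sin x ^ 2 = 0 := congrArg NNReal.toReal h
        exact this.ne' (by simpa using h3)
      · rw [Metric.mem_ball, dist_zero_right, norm_eq_abs, abs_of_pos hx.1]
        exact hx.2.trans_le (min_le_left _ _)
    intro h
    have h3 := measure_mono_null h2 h
    rw [Real.volume_Ioo] at h3
    simp only [sub_zero, ENNReal.ofReal_eq_zero, not_le.2 (lt_min hε one_pos)] at h3
  have h1 := tendsto_setIntegral_pow_smul_of_unique_maximum_of_isCompact_of_measure_nhdsWithin_pos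
    (μ := (volume : Measure ℝ).withDensity fun x => (ρ x : ENNReal))
    (x₀ := (0 : ℝ)) (s := halfCircle) (c := fun x => |f x|) (g := h) isCompact_Icc hpos
    hf.continuous.abs.continuousOn
    (fun y hy hy0 => by rw [abs_of_pos hf.pos]; exact hf.lt y hy hy0)
    (fun x _ => abs_nonneg _) (by rw [abs_of_pos hf.pos]; exact hf.pos)
    zero_mem_halfCircle (hh.integrableOn_compact isCompact_Icc) (hh 0 zero_mem_halfCircle)
  refine h1.congr fun n => ?_
  have hmeas : MeasurableSet halfCircle := measurableSet_Icc
  rw [setIntegral_withDensity_eq_setIntegral_smul hρ.measurable _ hmeas,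
    setIntegral_withDensity_eq_setIntegral_smul hρ.measurable _ hmeas]
  have e : ∀ (x y : ℝ), ρ x • y = sin x ^ 2 * y := fun _ _ => rfl
  simp only [smul_eq_mul, weighted, e]
  rw [inv_mul_eq_div]
  congr 1
  · exact integral_congr_ae (.of_forall fun x => by ring)
  · exact integral_congr_ae (.of_forall fun x => by ring)

/-- A function vanishing at `0` is, over the half circle, `sin` times a continuous function. -/
lemma exists_eq_sin_mul {D : ℝ → ℝ} (hD : Continuous D) (h0 : D 0 = 0) {D' : ℝ}
    (hD' : HasDerivAt D D' 0) :
    ∃ R : ℝ → ℝ, ContinuousOn R halfCircle ∧ R 0 = D' ∧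
      ∀ x ∈ halfCircle, D x = sin x * R x := by
  have hsin : ∀ x ∈ halfCircle, x ≠ 0 → sin x ≠ 0 := by
    intro x hx hx0 h
    rw [sin_eq_zero_iff_of_lt_of_lt (by linarith [hx.1, pi_pos]) (by linarith [hx.2, pi_pos])] at h
    exact hx0 h
  have hne : ∀ x ∈ halfCircle, dslope sin 0 x ≠ 0 := by
    intro x hx
    by_cases hx0 : x = 0
    · rw [hx0, dslope_same, (Real.hasDerivAt_sin 0).deriv]
      simp
    · rw [dslope_of_ne _ hx0, slope_def_field, sin_zero]
      simpa [hx0] using hsin x hx hx0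
  refine ⟨fun x => dslope D 0 x / dslope sin 0 x, ContinuousOn.div ?_ ?_ hne, ?_, ?_⟩
  · exact (continuousOn_dslope halfCircle_mem_nhds).2 ⟨hD.continuousOn, hD'.differentiableAt⟩
  · exact (continuousOn_dslope halfCircle_mem_nhds).2
      ⟨continuous_sin.continuousOn, differentiableAt_sin⟩
  · simp [dslope_same, hD'.deriv, (Real.hasDerivAt_sin 0).deriv]
  · intro x hx
    by_cases hx0 : x = 0
    · simp [hx0, h0]
    · have := hsin x hx hx0
      simp only [dslope_of_ne _ hx0, slope_def_field, sin_zero, h0, sub_zero]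
      field_simp

variable {f' : ℝ → ℝ}

/-- Integration by parts against `|f| ^ n` with a function vanishing at the ends of the
half circle; `n` is such that `f ^ n = |f| ^ n`. -/
lemma succ_mul_weighted_deriv (hf : ∀ x, HasDerivAt f (f' x) x) (hf' : Continuous f')
    {g g' : ℝ → ℝ} (hg : ∀ x, HasDerivAt g (g' x) x) (hg' : Continuous g')
    (hend : g (π / 2) = 0) (hend' : g (-(π / 2)) = 0) {n : ℕ} (hn : ∀ x, f x ^ n = |f x| ^ n) :
    ((n : ℝ) + 1) * weighted f n (fun x => g x * f' x) =
      -weighted f n (fun x => g' x * f x) := by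
  have hfc : Continuous f := continuous_iff_continuousAt.2 fun x => (hf x).continuousAt
  have hgc : Continuous g := continuous_iff_continuousAt.2 fun x => (hg x).continuousAt
  have h1 : ∀ x, HasDerivAt (fun x => g x * f x ^ (n + 1))
      (|f x| ^ n * (g' x * f x + ((n : ℝ) + 1) * (g x * f' x))) x := by
    intro x
    refine ((hg x).mul ((hf x).pow (n + 1))).congr_deriv ?_
    simp only [Pi.pow_apply, Nat.add_sub_cancel]
    rw [← hn x]
    push_cast
    ring
  have h2 := intervalIntegral.integral_eq_sub_of_hasDerivAt (a := -(π / 2)) (b := π / 2)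
    (fun x _ => h1 x) (Continuous.intervalIntegrable (by fun_prop) _ _)
  rw [hend, hend', ← weighted_eq_intervalIntegral, weighted_add hfc n (by fun_prop) (by fun_prop),
    weighted_const_mul] at h2
  linarith

section SecondOrder

variable {l : Filter ℕ}

/-- The variance scale: `n ⟨sin ^ 2 h⟩` converges under the weights `|f| ^ n`. -/
lemma HasPeak.tendsto_succ_mul_weighted_sin_sq (hp : HasPeak f)
    (hf : ∀ x, HasDerivAt f (f' x) x) (hf' : Continuous f') (h0 : f' 0 = 0) {f'' : ℝ}
    (hf'' : HasDerivAt f' f'' 0) (hne : f'' ≠ 0) (hl : l ≤ atTop)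
    (hn : ∀ᶠ n in l, ∀ x, f x ^ n = |f x| ^ n) {h : ℝ → ℝ} (hh : ContinuousOn h halfCircle) :
    Tendsto (fun n : ℕ => ((n : ℝ) + 1) * weighted f n (fun x => sin x ^ 2 * h x) /
      weighted f n fun _ => 1) l (𝓝 (-(h 0 * f 0 / f''))) := by
  obtain ⟨Q, hQ, hQ0, hQe⟩ := exists_eq_sin_mul hf' h0 hf''
  have hfc := hp.continuous
  have hu : Tendsto (fun n : ℕ => ((n : ℝ) + 1) *
      weighted f n (fun x => sin x ^ 2 * (cos x * Q x)) / weighted f n fun _ => 1) l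
      (𝓝 (-f 0)) := by
    have h1 := (hp.tendsto_weighted (h := fun x => -((cos x ^ 2 - sin x ^ 2) * f x))
      (by fun_prop)).mono_left hl
    simp only [cos_zero, sin_zero] at h1
    norm_num at h1
    refine h1.congr' ?_
    filter_upwards [hn] with n hn
    have h2 := succ_mul_weighted_deriv hf hf' (g := fun x => sin x * cos x)
      (g' := fun x => cos x ^ 2 - sin x ^ 2)
      (fun x => ((hasDerivAt_sin x).mul (hasDerivAt_cos x)).congr_deriv (by ring))
      (by fun_prop) (by simp) (by simp) hn
    have h3 : weighted f n (fun x => sin x ^ 2 * (cos x * Q x)) =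
        weighted f n (fun x => sin x * cos x * f' x) :=
      weighted_congr n fun x hx => by rw [hQe x hx]; ring
    have h4 : weighted f n (fun x => -((cos x ^ 2 - sin x ^ 2) * f x)) =
        -weighted f n (fun x => (cos x ^ 2 - sin x ^ 2) * f x) := by
      rw [← neg_one_mul, ← weighted_const_mul]
      exact weighted_congr n fun x _ => by ring
    rw [h3, h2, h4]
  have hv : Tendsto (fun n => weighted f n (fun x => sin x ^ 2 * (cos x * Q x)) /
      weighted f n fun x => sin x ^ 2) l (𝓝 f'') := by
    have h1 := (hp.tendsto_weighted_sin_sq (h := fun x => cos x * Q x) (by fun_prop)).mono_left hl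
    simpa [hQ0] using h1
  have hw := (hp.tendsto_weighted_sin_sq hh).mono_left hl
  have key := (hu.div hv hne).mul hw
  have e : -f 0 / f'' * h 0 = -(h 0 * f 0 / f'') := by ring
  rw [e] at key
  refine key.congr' ?_
  filter_upwards [hv.eventually_ne hne] with n hn0
  have h5 : weighted f n (fun x => sin x ^ 2) ≠ 0 := by
    intro h
    rw [h, div_zero] at hn0
    exact hn0 rfl
  have h6 : weighted f n (fun x => sin x ^ 2 * (cos x * Q x)) ≠ 0 := by
    intro h
    rw [h, zero_div] at hn0
    exact hn0 rfl
  simp only [Pi.div_apply]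
  generalize weighted f n (fun x => sin x ^ 2 * (cos x * Q x)) = X at h6 ⊢
  field_simp

/-- The mean of a function vanishing at the peak is `o(1 / √n)`. -/
lemma HasPeak.tendsto_succ_mul_sq_weighted (hp : HasPeak f)
    (hf : ∀ x, HasDerivAt f (f' x) x) (hf' : Continuous f') (h0 : f' 0 = 0) {f'' : ℝ}
    (hf'' : HasDerivAt f' f'' 0) (hne : f'' ≠ 0) (hl : l ≤ atTop)
    (hn : ∀ᶠ n in l, ∀ x, f x ^ n = |f x| ^ n) {R : ℝ → ℝ} (hR : ContinuousOn R halfCircle) :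
    Tendsto (fun n : ℕ => ((n : ℝ) + 1) * (weighted f n (fun x => f x * (sin x * R x)) /
      weighted f n fun _ => 1) ^ 2) l (𝓝 0) := by
  obtain ⟨Q, hQ, hQ0, hQe⟩ := exists_eq_sin_mul hf' h0 hf''
  have hfc := hp.continuous
  set r : ℝ := R 0 / f'' with hr
  -- `sin * R` is a multiple of `cos * f'`, whose mean is `O(1 / n)`, up to a remainder that
  -- vanishes at the peak to higher order.
  set W : ℝ → ℝ := fun x => R x - r * (cos x * Q x) with hW
  have hWc : ContinuousOn W halfCircle := by fun_prop
  have hW0 : W 0 = 0 := by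
    simp only [hW, cos_zero, one_mul, hQ0, hr]
    field_simp
    ring
  have hA := (hp.tendsto_succ_mul_weighted_sin_sq hf hf' h0 hf'' hne hl hn
    (h := fun _ => 1) continuousOn_const)
  have hB := (hp.tendsto_weighted (h := fun x => (f x * W x) ^ 2) (by fun_prop)).mono_left hl
  have hC := (hp.tendsto_weighted (h := fun x => sin x * f x ^ 2) (by fun_prop)).mono_left hl
  have hinv : Tendsto (fun n : ℕ => 1 / ((n : ℝ) + 1)) l (𝓝 0) :=
    tendsto_one_div_add_atTop_nhds_zero_nat.mono_left hl
  have hbound := ((hA.mul hB).const_mul 2).add (((hC.pow 2).mul hinv).const_mul (2 * r ^ 2))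
  simp only [hW0, mul_zero, ne_eq, OfNat.ofNat_ne_zero, not_false_eq_true, zero_pow, add_zero]
    at hbound
  refine squeeze_zero' (.of_forall fun n => by positivity) ?_ hbound
  filter_upwards [hn] with n hn
  have h1 := weighted_one_pos hp n
  set Z := weighted f n fun _ => 1 with hZ
  have hsplit : weighted f n (fun x => f x * (sin x * R x)) =
      r * weighted f n (fun x => (cos x * f x) * f' x) +
        weighted f n (fun x => sin x * (f x * W x)) := by
    have hWc' : ContinuousOn (fun x => sin x * (f x * W x)) halfCircle := by fun_prop
    rw [← weighted_const_mul, ← weighted_add hfc n (by fun_prop) hWc']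
    refine weighted_congr n fun x hx => ?_
    rw [hQe x hx]
    simp only [hW]
    ring
  have hstein : ((n : ℝ) + 2) * weighted f n (fun x => (cos x * f x) * f' x) =
      weighted f n (fun x => sin x * f x ^ 2) := by
    have h2 := succ_mul_weighted_deriv hf hf' (g := fun x => cos x * f x)
      (g' := fun x => -sin x * f x + cos x * f' x)
      (fun x => (hasDerivAt_cos x).mul (hf x)) (by fun_prop) (by simp) (by simp) hn
    have h3 : weighted f n (fun x => (-sin x * f x + cos x * f' x) * f x) =
        -1 * weighted f n (fun x => sin x * f x ^ 2) +
          weighted f n (fun x => (cos x * f x) * f' x) := by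
      rw [← weighted_const_mul, ← weighted_add hfc n (by fun_prop) (by fun_prop)]
      exact weighted_congr n fun x _ => by ring
    rw [h3] at h2
    linarith
  have hcs := sq_weighted_mul_le hfc n (g := sin) (h := fun x => f x * W x)
    continuous_sin.continuousOn (by fun_prop)
  have hone : weighted f n (fun x => sin x ^ 2 * 1) = weighted f n (fun x => sin x ^ 2) := by
    simp
  rw [hone]
  set X := weighted f n (fun x => (cos x * f x) * f' x) with hX
  set Y := weighted f n (fun x => sin x * (f x * W x)) with hY
  set V := weighted f n (fun x => sin x * f x ^ 2) with hV
  set S := weighted f n (fun x => sin x ^ 2) with hS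
  set U := weighted f n (fun x => (f x * W x) ^ 2) with hU
  have hn0 : (0 : ℝ) ≤ n := Nat.cast_nonneg n
  have hX2 : ((n : ℝ) + 1) * X ^ 2 ≤ V ^ 2 * (1 / ((n : ℝ) + 1)) := by
    rw [mul_one_div, le_div_iff₀ (by positivity), ← hstein, mul_pow]
    nlinarith [mul_nonneg hn0 (sq_nonneg X), sq_nonneg X]
  rw [hsplit, div_pow, ← mul_div_assoc, div_le_iff₀ (by positivity)]
  have e : (2 * (((n : ℝ) + 1) * S / Z * (U / Z)) +
      2 * r ^ 2 * ((V / Z) ^ 2 * (1 / ((n : ℝ) + 1)))) * Z ^ 2 =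
      2 * (((n : ℝ) + 1) * (S * U)) + 2 * r ^ 2 * (V ^ 2 * (1 / ((n : ℝ) + 1))) := by
    field_simp
  rw [e]
  have h7 : ((n : ℝ) + 1) * (r * X + Y) ^ 2 ≤
      2 * r ^ 2 * (((n : ℝ) + 1) * X ^ 2) + 2 * (((n : ℝ) + 1) * Y ^ 2) := by
    have : 0 ≤ ((n : ℝ) + 1) * (r * X - Y) ^ 2 := by positivity
    nlinarith
  have h8 : ((n : ℝ) + 1) * Y ^ 2 ≤ ((n : ℝ) + 1) * (S * U) :=
    mul_le_mul_of_nonneg_left hcs (by positivity)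
  have h9 : 2 * r ^ 2 * (((n : ℝ) + 1) * X ^ 2) ≤
      2 * r ^ 2 * (V ^ 2 * (1 / ((n : ℝ) + 1))) :=
    mul_le_mul_of_nonneg_left hX2 (by positivity)
  linarith

/-- The limit of the logarithmic second derivative: if the tilting direction is
`m * f + D` with `D` vanishing at the peak, then the fluctuation term converges to
`-D' ^ 2 / (f'' f)`. -/
lemma HasPeak.tendsto_fluctuation (hp : HasPeak f)
    (hf : ∀ x, HasDerivAt f (f' x) x) (hf' : Continuous f') (h0 : f' 0 = 0) {f'' : ℝ}
    (hf'' : HasDerivAt f' f'' 0) (hne : f'' ≠ 0) (hl : l ≤ atTop)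
    (hn : ∀ᶠ n in l, ∀ x, f x ^ n = |f x| ^ n) {D : ℝ → ℝ} (hD : Continuous D) (hD0 : D 0 = 0)
    {D' : ℝ} (hD' : HasDerivAt D D' 0) :
    Tendsto (fun n : ℕ =>
      ((n : ℝ) + 1) * (weighted f n (fun x => D x ^ 2) / weighted f n fun x => f x ^ 2) -
      ((n : ℝ) + 2) * (weighted f n (fun x => f x * D x) / weighted f n fun x => f x ^ 2) ^ 2) l
      (𝓝 (-(D' ^ 2 / (f'' * f 0)))) := by
  obtain ⟨R, hR, hR0, hRe⟩ := exists_eq_sin_mul hD hD0 hD'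
  have hfc := hp.continuous
  have hf0 := hp.pos
  have hA := hp.tendsto_succ_mul_weighted_sin_sq hf hf' h0 hf'' hne hl hn
    (h := fun x => R x ^ 2) (by fun_prop)
  have hB := hp.tendsto_succ_mul_sq_weighted hf hf' h0 hf'' hne hl hn hR
  have hC := (hp.tendsto_weighted (h := fun x => f x ^ 2) (by fun_prop)).mono_left hl
  have hinv : Tendsto (fun n : ℕ => 1 / ((n : ℝ) + 1)) l (𝓝 0) :=
    tendsto_one_div_add_atTop_nhds_zero_nat.mono_left hl
  have hf02 : f 0 ^ 2 ≠ 0 := by positivity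
  have key := (hA.div hC hf02).sub
    ((hB.div (hC.pow 2) (pow_ne_zero 2 hf02)).mul (hinv.const_add 1))
  have e : -(R 0 ^ 2 * f 0 / f'') / f 0 ^ 2 - 0 / (f 0 ^ 2) ^ 2 * (1 + 0) =
      -(D' ^ 2 / (f'' * f 0)) := by
    rw [hR0]
    field_simp
    ring
  rw [e] at key
  refine key.congr' ?_
  filter_upwards [hC.eventually_ne hf02] with n hn0
  have h1 : weighted f n (fun x => D x ^ 2) = weighted f n (fun x => sin x ^ 2 * R x ^ 2) :=
    weighted_congr n fun x hx => by rw [hRe x hx]; ring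
  have h2 : weighted f n (fun x => f x * D x) = weighted f n (fun x => f x * (sin x * R x)) :=
    weighted_congr n fun x hx => by rw [hRe x hx]
  rw [h1, h2]
  have h3 := (weighted_one_pos hp n).ne'
  have h4 : weighted f n (fun x => f x ^ 2) ≠ 0 := by
    intro h
    rw [h, zero_div] at hn0
    exact hn0 rfl
  have h5 : (n : ℝ) + 1 ≠ 0 := by positivity
  simp only [Pi.div_apply]
  field_simp
  ring

end SecondOrder

/-- The exponential growth rate of the total weight is the logarithm of the peak. -/
lemma HasPeak.tendsto_log_weighted (hp : HasPeak f) :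
    Tendsto (fun n : ℕ => 1 / (n : ℝ) * log (weighted f n fun _ => 1)) atTop
      (𝓝 (log (f 0))) := by
  have h1 := hp.tendsto_weighted (h := fun x => |f x|) hp.continuous.abs.continuousOn
  rw [abs_of_pos hp.pos] at h1
  have h2 := (h1.log hp.pos.ne').cesaro
  have h3 : Tendsto (fun n : ℕ => 1 / (n : ℝ) * log (weighted f 0 fun _ => 1)) atTop (𝓝 0) := by
    simpa using tendsto_one_div_atTop_nhds_zero_nat.mul_const (log (weighted f 0 fun _ => 1))
  have h4 := h2.add h3
  rw [add_zero] at h4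
  refine h4.congr fun n => ?_
  have h5 : ∀ k, log (weighted f k (fun x => |f x|) / weighted f k fun _ => 1) =
      log (weighted f (k + 1) fun _ => 1) - log (weighted f k fun _ => 1) := by
    intro k
    have h6 : weighted f k (fun x => |f x|) = weighted f (k + 1) fun _ => 1 := by
      simp only [weighted, pow_succ, mul_one]
    rw [h6, log_div (weighted_one_pos hp _).ne' (weighted_one_pos hp _).ne']
  simp only [h5]
  rw [Finset.sum_range_sub (fun k => log (weighted f k fun _ => 1)), one_div]
  ring

end Laplace

/-! ### The mean-field equation -/

section MeanField

open Real Set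

lemma hasDerivAt_artanh {x : ℝ} (hx : x ∈ Ioo (-1 : ℝ) 1) :
    HasDerivAt artanh (1 / (1 - x ^ 2)) x := by
  have h1 : 0 < 1 + x := by linarith [hx.1]
  have h2 : 0 < 1 - x := by linarith [hx.2]
  have h3 : HasDerivAt (fun x => 1 / 2 * (log (1 + x) - log (1 - x))) (1 / (1 - x ^ 2)) x := by
    have h4 := ((hasDerivAt_id x).const_add 1).log h1.ne'
    have h5 := ((hasDerivAt_id x).const_sub 1).log h2.ne'
    refine ((h4.sub h5).const_mul (1 / 2)).congr_deriv ?_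
    have : 1 - x ^ 2 ≠ 0 := by nlinarith
    simp only [id]
    field_simp
    ring
  refine h3.congr_of_eventuallyEq ?_
  filter_upwards [isOpen_Ioo.mem_nhds hx] with y hy
  rw [artanh_eq_half_log ⟨hy.1.le, hy.2.le⟩, log_div (by linarith [hy.1]) (by linarith [hy.2])]

lemma hasDerivAt_tanh (x : ℝ) : HasDerivAt tanh (1 - tanh x ^ 2) x := by
  have h := (hasDerivAt_sinh x).div (hasDerivAt_cosh x) (cosh_pos x).ne'
  have e : tanh = fun x => sinh x / cosh x := funext tanh_eq_sinh_div_cosh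
  rw [e]
  refine h.congr_deriv ?_
  have := (cosh_pos x).ne'
  field_simp

lemma tanh_strictMono : StrictMono tanh := by
  refine strictMono_of_hasDerivAt_pos (f' := fun x => 1 - tanh x ^ 2) hasDerivAt_tanh fun x => ?_
  have := tanh_sq_lt_one x
  linarith

/-- The external field `B` at which the mean-field equation
`t = T * tanh (B + r * artanh t)` has the solution `t`. -/
noncomputable def fieldOf (r T t : ℝ) : ℝ := artanh (t / T) - r * artanh t

/-- The numerator of the derivative of `fieldOf r T`. At a stationary point of the circle integrand
its sign is opposite to that of the second derivative, so it is positive at a nondegenerate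
maximum. -/
def stiffness (r T t : ℝ) : ℝ := T - r * T ^ 2 + (r - T) * t ^ 2

variable {r T B t : ℝ}

lemma fieldOf_zero (r T : ℝ) : fieldOf r T 0 = 0 := by simp [fieldOf]

lemma hasDerivAt_fieldOf (hT : 0 < T) (hT1 : T < 1) (ht : t ∈ Ioo (-T) T) :
    HasDerivAt (fieldOf r T) (stiffness r T t / ((T ^ 2 - t ^ 2) * (1 - t ^ 2))) t := by
  have h1 : t / T ∈ Ioo (-1 : ℝ) 1 := by
    rw [mem_Ioo, lt_div_iff₀ hT, div_lt_iff₀ hT]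
    constructor <;> linarith [ht.1, ht.2]
  have h2 := (hasDerivAt_artanh h1).comp t ((hasDerivAt_id t).div_const T)
  have h3 := (hasDerivAt_artanh (x := t) ⟨by linarith [ht.1], by linarith [ht.2]⟩).const_mul r
  refine (h2.sub h3).congr_deriv ?_
  have h4 : 0 < T ^ 2 - t ^ 2 := by nlinarith [ht.1, ht.2]
  have h5 : 0 < 1 - t ^ 2 := by nlinarith [ht.1, ht.2]
  have h6 : 1 - (t / T) ^ 2 = (T ^ 2 - t ^ 2) / T ^ 2 := by field_simp
  simp only [h6, stiffness]
  field_simp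
  ring

lemma continuousOn_fieldOf (hT : 0 < T) (hT1 : T < 1) :
    ContinuousOn (fieldOf r T) (Ico 0 T) := fun t ht =>
  (hasDerivAt_fieldOf hT hT1 ⟨by linarith [ht.1], ht.2⟩).continuousAt.continuousWithinAt

lemma stiffness_lt_stiffness (hr : T < r) {s : ℝ} (ht : 0 ≤ t) (hts : t < s) :
    stiffness r T t < stiffness r T s := by
  have h : t ^ 2 < s ^ 2 := by nlinarith
  simp only [stiffness]
  nlinarith [mul_lt_mul_of_pos_left h (sub_pos.2 hr)]

lemma strictMonoOn_fieldOf (hT : 0 < T) (hT1 : T < 1) (hr : T < r) (ht : 0 ≤ t)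
    (hN : 0 ≤ stiffness r T t) : StrictMonoOn (fieldOf r T) (Ico t T) := by
  refine strictMonoOn_of_deriv_pos (convex_Ico _ _)
    ((continuousOn_fieldOf hT hT1).mono (Ico_subset_Ico_left ht)) fun s hs => ?_
  rw [interior_Ico] at hs
  have hs0 : 0 < s := ht.trans_lt hs.1
  rw [(hasDerivAt_fieldOf hT hT1 ⟨by linarith, hs.2⟩).deriv]
  have h1 := stiffness_lt_stiffness hr ht hs.1
  have h4 : 0 < T ^ 2 - s ^ 2 := by nlinarith [hs.2]
  have h5 : 0 < 1 - s ^ 2 := by nlinarith [hs.2]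
  have h6 : 0 < stiffness r T s := by linarith
  positivity

/-- While the stiffness is negative the field decreases from `0`, so a stationary point in a
nonnegative field has positive stiffness. -/
lemma stiffness_pos (hT : 0 < T) (hT1 : T < 1) (hr : T < r) (ht : 0 < t) (htT : t < T)
    (hH : 0 ≤ fieldOf r T t) : 0 < stiffness r T t := by
  by_contra! hN
  have h : StrictAntiOn (fieldOf r T) (Icc 0 t) := by
    refine strictAntiOn_of_deriv_neg (convex_Icc _ _)
      ((continuousOn_fieldOf hT hT1).mono (Icc_subset_Ico_right htT)) fun s hs => ?_
    rw [interior_Icc] at hs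
    have hsT : s < T := hs.2.trans htT
    rw [(hasDerivAt_fieldOf hT hT1 ⟨by linarith [hs.1], hsT⟩).deriv]
    have h1 := stiffness_lt_stiffness hr hs.1.le hs.2
    have h4 : 0 < T ^ 2 - s ^ 2 := by nlinarith [hs.1]
    have h5 : 0 < 1 - s ^ 2 := by nlinarith [hs.1]
    exact div_neg_of_neg_of_pos (by linarith) (by positivity)
  have := h (left_mem_Icc.2 ht.le) (right_mem_Icc.2 ht.le) ht
  rw [fieldOf_zero] at this
  linarith

/-- The physical solution of the mean-field equation: among the solutions `t ∈ [0, T)`, the one on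
the stable branch, where the field increases with `t`. -/
structure IsRoot (r T B t : ℝ) : Prop where
  nonneg : 0 ≤ t
  lt : t < T
  eq : fieldOf r T t = B
  stable : 0 ≤ stiffness r T t

lemma IsRoot.unique (hT : 0 < T) (hT1 : T < 1) (hr : T < r) {s : ℝ} (ht : IsRoot r T B t)
    (hs : IsRoot r T B s) : t = s := by
  rcases lt_trichotomy t s with h | h | h
  · have := strictMonoOn_fieldOf hT hT1 hr ht.nonneg ht.stable ⟨le_rfl, ht.lt⟩ ⟨h.le, hs.lt⟩ h
    rw [ht.eq, hs.eq] at this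
    exact absurd this (lt_irrefl _)
  · exact h
  · have := strictMonoOn_fieldOf hT hT1 hr hs.nonneg hs.stable ⟨le_rfl, hs.lt⟩ ⟨h.le, ht.lt⟩ h
    rw [ht.eq, hs.eq] at this
    exact absurd this (lt_irrefl _)

lemma exists_lt_fieldOf (hT : 0 < T) (hT1 : T < 1) (hr : 0 < r) (B : ℝ) :
    ∃ t, 0 < t ∧ t < T ∧ B < fieldOf r T t := by
  set y := |B| + r * artanh T + 1 with hy
  have h0 : 0 ≤ artanh T := artanh_nonneg hT.le
  have hy0 : 0 < y := by positivity
  have h1 : 0 < tanh y := by rw [← tanh_zero]; exact tanh_strictMono hy0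
  have h2 := tanh_lt_one y
  have h3 : T * tanh y < T := by nlinarith
  refine ⟨T * tanh y, by positivity, h3, ?_⟩
  have h4 : artanh (T * tanh y) ≤ artanh T :=
    artanh_le_artanh (by nlinarith) hT1 h3.le
  rw [fieldOf, mul_div_cancel_left₀ _ hT.ne', artanh_tanh, hy]
  nlinarith [le_abs_self B, mul_le_mul_of_nonneg_left h4 hr.le]

lemma exists_isRoot (hT : 0 < T) (hT1 : T < 1) (hr : 1 ≤ r) (hB : 0 ≤ B) :
    ∃ t, IsRoot r T B t := by
  have hrT : T < r := by linarith
  -- the left end of the stable branch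
  obtain ⟨t₁, ht0, htT, hN, hH⟩ : ∃ t₁, 0 ≤ t₁ ∧ t₁ < T ∧ 0 ≤ stiffness r T t₁ ∧
      fieldOf r T t₁ ≤ 0 := by
    rcases le_or_gt 0 (stiffness r T 0) with h | h
    · exact ⟨0, le_rfl, hT, h, (fieldOf_zero r T).le⟩
    · have h' : 0 < r * T ^ 2 - T := by
        simp only [stiffness] at h
        linarith
      have hk : 0 < r - T := by linarith
      set s := √((r * T ^ 2 - T) / (r - T)) with hs
      have hs2 : s ^ 2 = (r * T ^ 2 - T) / (r - T) := sq_sqrt (by positivity)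
      have hs0 : 0 < s := sqrt_pos.2 (by positivity)
      have hN : stiffness r T s = 0 := by
        simp only [stiffness, hs2]
        field_simp
        ring
      have hsT : s < T := by
        refine lt_of_pow_lt_pow_left₀ 2 hT.le ?_
        rw [hs2, div_lt_iff₀ hk]
        nlinarith [mul_pos hT (sub_pos.2 hT1)]
      refine ⟨s, hs0.le, hsT, hN.ge, ?_⟩
      by_contra! hpos
      exact (stiffness_pos hT hT1 hrT hs0 hsT hpos.le).ne' hN
  obtain ⟨u, hu0, huT, hu⟩ := exists_lt_fieldOf (r := r) hT hT1 (by linarith) B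
  have htu : t₁ ≤ u := by
    by_contra! hlt
    have h1 := strictMonoOn_fieldOf hT hT1 hrT hu0.le
      (stiffness_pos hT hT1 hrT hu0 huT (by linarith)).le ⟨le_rfl, huT⟩ ⟨hlt.le, htT⟩ hlt
    linarith
  obtain ⟨t, ht, hte⟩ := intermediate_value_Icc htu
    ((continuousOn_fieldOf (r := r) hT hT1).mono
      (fun x hx => ⟨ht0.trans hx.1, hx.2.trans_lt huT⟩)) ⟨hH.trans hB, hu.le⟩
  refine ⟨t, ht0.trans ht.1, ht.2.trans_lt huT, hte, ?_⟩
  rcases ht.1.eq_or_lt with h | h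
  · rw [← h]
    exact hN
  · exact (hN.trans_lt (stiffness_lt_stiffness hrT ht0 h)).le

open Classical in
/-- The physical solution `t` of `t = T * tanh (B + r * artanh t)`. -/
noncomputable def root (r T B : ℝ) : ℝ := if h : ∃ t, IsRoot r T B t then h.choose else 0

lemma isRoot_root (hT : 0 < T) (hT1 : T < 1) (hr : 1 ≤ r) (hB : 0 ≤ B) :
    IsRoot r T B (root r T B) := by
  have h := exists_isRoot hT hT1 hr hB
  rw [root, dif_pos h]
  exact h.choose_spec

lemma IsRoot.eq_root (hT : 0 < T) (hT1 : T < 1) (hr : 1 ≤ r) (hB : 0 ≤ B)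
    (h : IsRoot r T B t) : t = root r T B :=
  h.unique hT hT1 (by linarith) (isRoot_root hT hT1 hr hB)

lemma root_pos (hT : 0 < T) (hT1 : T < 1) (hr : 1 ≤ r) (hB : 0 < B) : 0 < root r T B := by
  have h := isRoot_root hT hT1 hr hB.le
  refine h.nonneg.lt_of_ne fun h0 => ?_
  have := h.eq
  rw [← h0, fieldOf_zero] at this
  exact hB.ne this

lemma root_zero_eq_zero (hT : 0 < T) (hT1 : T < 1) (hr : 1 ≤ r) (hrT : r * T ≤ 1) :
    root r T 0 = 0 := by
  refine (IsRoot.eq_root hT hT1 hr le_rfl ⟨le_rfl, hT, fieldOf_zero r T, ?_⟩).symm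
  simp only [stiffness]
  nlinarith

lemma root_zero_pos (hT : 0 < T) (hT1 : T < 1) (hr : 1 ≤ r) (hrT : 1 < r * T) :
    0 < root r T 0 := by
  have h := isRoot_root hT hT1 hr (le_refl (0 : ℝ))
  refine h.nonneg.lt_of_ne fun h0 => ?_
  have := h.stable
  rw [← h0, stiffness] at this
  nlinarith

/-- The stiffness is positive at the physical solution, except at the critical point. -/
lemma stiffness_root_pos (hT : 0 < T) (hT1 : T < 1) (hr : 1 ≤ r) (hB : 0 ≤ B)
    (h : 0 < B ∨ r * T ≠ 1) : 0 < stiffness r T (root r T B) := by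
  have hroot := isRoot_root hT hT1 hr hB
  rcases hroot.nonneg.eq_or_lt with h0 | h0
  · rcases h with h | h
    · exact absurd h0 (root_pos hT hT1 hr h).ne
    · refine hroot.stable.lt_of_ne fun h1 => h ?_
      rw [← h0, stiffness] at h1
      have : T * (1 - r * T) = 0 := by linarith
      rcases mul_eq_zero.1 this with h2 | h2
      · exact absurd h2 hT.ne'
      · linarith
  · exact stiffness_pos hT hT1 (by linarith) h0 hroot.lt (by rw [hroot.eq]; exact hB)

lemma root_lt_root_field (hT : 0 < T) (hT1 : T < 1) (hr : 1 ≤ r) (hB : 0 ≤ B) {B' : ℝ}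
    (hBB : B < B') : root r T B < root r T B' := by
  have h := isRoot_root hT hT1 hr hB
  have h' := isRoot_root hT hT1 hr (hB.trans hBB.le)
  by_contra! hle
  have := (strictMonoOn_fieldOf hT hT1 (by linarith) h'.nonneg h'.stable).monotoneOn
    ⟨le_rfl, h'.lt⟩ ⟨hle, h.lt⟩ hle
  rw [h.eq, h'.eq] at this
  linarith

lemma tendsto_root_zero_field (hT : 0 < T) (hT1 : T < 1) (hr : 1 ≤ r) :
    Tendsto (root r T) (𝓝[>] 0) (𝓝 (root r T 0)) := by
  have h0 := isRoot_root hT hT1 hr (le_refl (0 : ℝ))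
  rw [tendsto_order]
  constructor
  · intro a ha
    filter_upwards [self_mem_nhdsWithin] with B hB
    exact ha.trans (root_lt_root_field hT hT1 hr le_rfl hB)
  · intro a ha
    set a' := min a ((root r T 0 + T) / 2) with ha'
    have h1 : root r T 0 < a' := lt_min ha (by linarith [h0.lt])
    have h2 : a' < T := (min_le_right _ _).trans_lt (by linarith [h0.lt])
    have hpos : 0 < fieldOf r T a' := by
      rw [← h0.eq]
      exact strictMonoOn_fieldOf hT hT1 (by linarith) h0.nonneg h0.stable ⟨le_rfl, h0.lt⟩
        ⟨h1.le, h2⟩ h1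
    filter_upwards [Ioo_mem_nhdsGT hpos] with B hB
    have hroot := isRoot_root hT hT1 hr hB.1.le
    refine lt_of_lt_of_le ?_ (min_le_left a ((root r T 0 + T) / 2))
    by_contra! hle
    have h3 := (strictMonoOn_fieldOf hT hT1 (by linarith) h0.nonneg h0.stable).monotoneOn
      ⟨h1.le, h2⟩ ⟨h1.le.trans hle, hroot.lt⟩ hle
    rw [hroot.eq] at h3
    linarith [hB.2]

/-- For fixed field, the coupling `T` at which `t` solves the mean-field equation. -/
noncomputable def couplingOf (r B t : ℝ) : ℝ := t / tanh (B + r * artanh t)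

lemma isRoot_couplingOf (hr : 1 ≤ r) (hB : 0 < B) (ht : 0 < t)
    (hc0 : 0 < couplingOf r B t) (hc1 : couplingOf r B t < 1) :
    IsRoot r (couplingOf r B t) B t := by
  have h0 : 0 ≤ artanh t := artanh_nonneg ht.le
  have h1 : 0 < tanh (B + r * artanh t) := by
    rw [← tanh_zero]
    exact tanh_strictMono (by positivity)
  have h2 := tanh_lt_one (B + r * artanh t)
  have hlt : t < couplingOf r B t := by
    rw [couplingOf, lt_div_iff₀ h1]
    nlinarith
  have heq : fieldOf r (couplingOf r B t) t = B := by
    rw [fieldOf, couplingOf, div_div_cancel₀ ht.ne', artanh_tanh]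
    ring
  refine ⟨ht.le, hlt, heq, (stiffness_pos hc0 hc1 (by linarith) ht hlt ?_).le⟩
  rw [heq]
  exact hB.le

lemma tanh_of_isRoot (hT : 0 < T) (h : IsRoot r T B t) :
    tanh (B + r * artanh t) = t / T := by
  have h1 : B + r * artanh t = artanh (t / T) := by
    rw [← h.eq, fieldOf]
    ring
  rw [h1, tanh_artanh]
  constructor
  · have := div_nonneg h.nonneg hT.le
    linarith
  · rw [div_lt_one hT]
    exact h.lt

lemma couplingOf_root (hT : 0 < T) (hT1 : T < 1) (hr : 1 ≤ r) (hB : 0 < B) :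
    couplingOf r B (root r T B) = T := by
  rw [couplingOf, tanh_of_isRoot hT (isRoot_root hT hT1 hr hB.le),
    div_div_cancel₀ (root_pos hT hT1 hr hB).ne']

lemma hasDerivAt_couplingOf_root (hT : 0 < T) (hT1 : T < 1) (hr : 1 ≤ r) (hB : 0 < B) :
    HasDerivAt (couplingOf r B)
      (stiffness r T (root r T B) / (root r T B * (1 - root r T B ^ 2))) (root r T B) := by
  have h := isRoot_root hT hT1 hr hB.le
  have ht := root_pos hT hT1 hr hB
  set t := root r T B
  have h1 := hasDerivAt_artanh (x := t) ⟨by linarith, by linarith [h.lt]⟩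
  have h2 := (hasDerivAt_tanh (B + r * artanh t)).comp t ((h1.const_mul r).const_add B)
  have h3 := (hasDerivAt_id t).div h2 (by
    rw [Function.comp_apply, tanh_of_isRoot hT h]
    positivity)
  refine h3.congr_deriv ?_
  have h5 : 0 < 1 - t ^ 2 := by nlinarith [h.lt]
  simp only [id, Function.comp_apply, tanh_of_isRoot hT h, stiffness]
  field_simp
  ring

lemma root_le_root_coupling (hr : 1 ≤ r) (hB : 0 < B) {T' : ℝ} (hT : 0 < T) (hTT : T ≤ T')
    (hT1 : T' < 1) : root r T B ≤ root r T' B := by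
  have h := isRoot_root hT (hTT.trans_lt hT1) hr hB.le
  have h' := isRoot_root (hT.trans_le hTT) hT1 hr hB.le
  have hT' := hT.trans_le hTT
  by_contra! hlt
  have h1 := strictMonoOn_fieldOf hT' hT1 (by linarith) h'.nonneg h'.stable
    ⟨le_rfl, h'.lt⟩ ⟨hlt.le, h.lt.trans_le hTT⟩ hlt
  have h2 : fieldOf r T' (root r T B) ≤ fieldOf r T (root r T B) := by
    have h3 : root r T B / T' ≤ root r T B / T := div_le_div_of_nonneg_left h.nonneg hT hTT
    have h4 := artanh_le_artanh (x := root r T B / T') (y := root r T B / T)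
      (by linarith [div_nonneg h.nonneg hT'.le]) (by rw [div_lt_one hT]; exact h.lt) h3
    simp only [fieldOf]
    linarith
  rw [h'.eq] at h1
  rw [h.eq] at h2
  linarith

lemma continuousAt_root_coupling (hT : 0 < T) (hT1 : T < 1) (hr : 1 ≤ r) (hB : 0 < B) :
    ContinuousAt (fun T => root r T B) T := by
  refine continuousAt_of_monotoneOn_of_image_mem_nhds (s := Ioo 0 1)
    (fun x hx y hy hxy => root_le_root_coupling hr hB hx.1 hxy hy.2) (Ioo_mem_nhds hT hT1) ?_
  have hc := (hasDerivAt_couplingOf_root hT hT1 hr hB).continuousAt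
  have h1 : ∀ᶠ t in 𝓝 (root r T B), couplingOf r B t ∈ Ioo (0 : ℝ) 1 := by
    refine hc.eventually_mem (Ioo_mem_nhds ?_ ?_) <;> rwa [couplingOf_root hT hT1 hr hB]
  filter_upwards [h1, lt_mem_nhds (root_pos hT hT1 hr hB)] with t ht ht0
  exact ⟨couplingOf r B t, ht,
    ((isRoot_couplingOf hr hB ht0 ht.1 ht.2).eq_root ht.1 ht.2 hr hB.le).symm⟩

lemma hasDerivAt_root_coupling (hT : 0 < T) (hT1 : T < 1) (hr : 1 ≤ r) (hB : 0 < B) :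
    HasDerivAt (fun T => root r T B)
      (root r T B * (1 - root r T B ^ 2) / stiffness r T (root r T B)) T := by
  have h := isRoot_root hT hT1 hr hB.le
  have ht := root_pos hT hT1 hr hB
  have hN := stiffness_root_pos hT hT1 hr hB.le (.inl hB)
  have h5 : 0 < 1 - root r T B ^ 2 := by nlinarith [h.lt]
  have := HasDerivAt.of_local_left_inverse (f := couplingOf r B)
    (continuousAt_root_coupling hT hT1 hr hB) (hasDerivAt_couplingOf_root hT hT1 hr hB)
    (by positivity) (by
      filter_upwards [Ioo_mem_nhds hT hT1] with T' hT'
      exact couplingOf_root hT'.1 hT'.2 hr hB)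
  rwa [inv_div] at this

end MeanField

/-! ### The maximum of the circle integrand -/

section Circle

open Real Set

/-- The combination `A₁ p ^ d + A₂ q ^ d` of the `d`-th powers of the linear forms
`p = a cos θ + b sin θ` and `q = a cos θ - b sin θ`. -/
noncomputable def powerPair (d : ℕ) (a b A₁ A₂ θ : ℝ) : ℝ :=
  A₁ * circleForm a b θ ^ d + A₂ * circleForm a (-b) θ ^ d

/-- The derivative of `powerPair (k + 1) a b A₁ A₂`. -/
noncomputable def powerPairDeriv (k : ℕ) (a b A₁ A₂ θ : ℝ) : ℝ :=
  ((k : ℝ) + 1) * (A₁ * circleForm a b θ ^ k * circleForm b (-a) θ +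
    A₂ * circleForm a (-b) θ ^ k * circleForm (-b) (-a) θ)

variable {k : ℕ} {a b A₁ A₂ B : ℝ}

lemma continuous_powerPair (d : ℕ) (a b A₁ A₂ : ℝ) : Continuous (powerPair d a b A₁ A₂) := by
  unfold powerPair circleForm
  fun_prop

lemma continuous_powerPairDeriv (k : ℕ) (a b A₁ A₂ : ℝ) :
    Continuous (powerPairDeriv k a b A₁ A₂) := by
  unfold powerPairDeriv circleForm
  fun_prop

lemma hasDerivAt_powerPair (k : ℕ) (a b A₁ A₂ θ : ℝ) :
    HasDerivAt (powerPair (k + 1) a b A₁ A₂) (powerPairDeriv k a b A₁ A₂ θ) θ := by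
  have h1 := ((hasDerivAt_circleForm a b θ).fun_pow (k + 1)).const_mul A₁
  have h2 := ((hasDerivAt_circleForm a (-b) θ).fun_pow (k + 1)).const_mul A₂
  refine (h1.add h2).congr_deriv ?_
  simp only [powerPairDeriv, Nat.add_sub_cancel]
  push_cast
  ring

lemma hasDerivAt_powerPairDeriv (j : ℕ) (a b A₁ A₂ θ : ℝ) :
    HasDerivAt (powerPairDeriv (j + 1) a b A₁ A₂)
      (((j : ℝ) + 2) * (A₁ * circleForm a b θ ^ j *
          (((j : ℝ) + 1) * circleForm b (-a) θ ^ 2 - circleForm a b θ ^ 2) +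
        A₂ * circleForm a (-b) θ ^ j *
          (((j : ℝ) + 1) * circleForm (-b) (-a) θ ^ 2 - circleForm a (-b) θ ^ 2))) θ := by
  have h1 := (((hasDerivAt_circleForm a b θ).fun_pow (j + 1)).const_mul A₁).mul
    (hasDerivAt_circleForm b (-a) θ)
  have h2 := (((hasDerivAt_circleForm a (-b) θ).fun_pow (j + 1)).const_mul A₂).mul
    (hasDerivAt_circleForm (-b) (-a) θ)
  refine ((h1.add h2).const_mul (((j + 1 : ℕ) : ℝ) + 1)).congr_deriv ?_
  simp only [Nat.add_sub_cancel, circleForm]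
  push_cast
  ring

lemma powerPair_add_pi (d : ℕ) (a b A₁ A₂ θ : ℝ) :
    powerPair d a b A₁ A₂ (θ + π) = (-1) ^ d * powerPair d a b A₁ A₂ θ := by
  simp only [powerPair, circleForm_add_pi, neg_pow (circleForm _ _ _)]
  ring

lemma abs_powerPair_add_pi (d : ℕ) (a b A₁ A₂ θ : ℝ) :
    |powerPair d a b A₁ A₂ (θ + π)| = |powerPair d a b A₁ A₂ θ| := by
  rw [powerPair_add_pi, abs_mul, abs_pow, abs_neg, abs_one, one_pow, one_mul]

lemma exists_max_powerPair (d : ℕ) (a b A₁ A₂ : ℝ) :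
    ∃ θ₀, ∀ θ, |powerPair d a b A₁ A₂ θ| ≤ |powerPair d a b A₁ A₂ θ₀| := by
  obtain ⟨θ₀, -, h⟩ := (isCompact_Icc (a := (0 : ℝ)) (b := π)).exists_isMaxOn
    (nonempty_Icc.2 pi_pos.le) (continuous_powerPair d a b A₁ A₂).abs.continuousOn
  refine ⟨θ₀, fun θ => ?_⟩
  have hper : Function.Periodic (fun θ => |powerPair d a b A₁ A₂ θ|) π :=
    abs_powerPair_add_pi d a b A₁ A₂
  obtain ⟨y, hy, hye⟩ := hper.exists_mem_Ico₀ pi_pos θ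
  rw [hye]
  exact h ⟨hy.1, hy.2.le⟩

lemma exists_cos_sin_eq_abs (θ : ℝ) : ∃ θ', cos θ' = |cos θ| ∧ sin θ' = |sin θ| := by
  rcases abs_choice (cos θ) with hc | hc <;> rcases abs_choice (sin θ) with hs | hs <;>
    rw [hc, hs]
  · exact ⟨θ, rfl, rfl⟩
  · exact ⟨-θ, by simp, by simp⟩
  · exact ⟨π - θ, by simp, by simp⟩
  · exact ⟨θ + π, by simp, by simp⟩

/-- At a maximum of `|A₁ p ^ d + A₂ q ^ d|` the two forms have equal signs and `|p| ≥ |q|`: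
otherwise exchanging `|cos θ|` and `|sin θ|`, or flipping a sign, increases the value. -/
lemma max_powerPair_region {d : ℕ} (hd : d ≠ 0) (hb : 0 < b) (hab : b < a) (hA₂ : 0 < A₂)
    (hA : A₂ < A₁) {θ₀ : ℝ}
    (hmax : ∀ θ, |powerPair d a b A₁ A₂ θ| ≤ |powerPair d a b A₁ A₂ θ₀|) :
    b * |sin θ₀| ≤ a * |cos θ₀| ∧ 0 ≤ cos θ₀ * sin θ₀ := by
  obtain ⟨θ', hc', hs'⟩ := exists_cos_sin_eq_abs θ₀
  set c := |cos θ₀| with hc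
  set s := |sin θ₀| with hs
  have hc0 : 0 ≤ c := abs_nonneg _
  have hs0 : 0 ≤ s := abs_nonneg _
  have ha : 0 < a := hb.trans hab
  have hA₁ : 0 < A₁ := hA₂.trans hA
  have hle : |powerPair d a b A₁ A₂ θ₀| ≤
      A₁ * |circleForm a b θ₀| ^ d + A₂ * |circleForm a (-b) θ₀| ^ d := by
    refine (abs_add_le _ _).trans_eq ?_
    rw [abs_mul, abs_mul, abs_pow, abs_pow, abs_of_pos hA₁, abs_of_pos hA₂]
  -- the absolute values of the two forms are `a * c + b * s` and `|a * c - b * s|`, in the order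
  -- given by the sign of `cos θ₀ * sin θ₀`
  have hcase : (|circleForm a b θ₀| = a * c + b * s ∧
        |circleForm a (-b) θ₀| = |a * c - b * s| ∧ 0 ≤ cos θ₀ * sin θ₀) ∨
      (|circleForm a b θ₀| = |a * c - b * s| ∧
        |circleForm a (-b) θ₀| = a * c + b * s ∧ 0 < c ∧ 0 < s) := by
    have hP : 0 ≤ a * c + b * s := by positivity
    simp only [circleForm]
    rcases le_or_gt 0 (cos θ₀) with h1 | h1 <;> rcases le_or_gt 0 (sin θ₀) with h2 | h2
    · left
      rw [hc, hs, abs_of_nonneg h1, abs_of_nonneg h2] at *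
      exact ⟨abs_of_nonneg hP, by ring_nf, by positivity⟩
    · rcases h1.eq_or_lt with h3 | h3
      · left
        rw [hc, hs, ← h3, abs_of_neg h2]
        refine ⟨?_, ?_, by simp⟩
        · rw [abs_of_nonpos (by nlinarith)]; simp
        · simp
      · right
        rw [hc, hs, abs_of_pos h3, abs_of_neg h2] at *
        exact ⟨by ring_nf, by rw [abs_of_nonneg (by linarith)]; ring, h3, by linarith⟩
    · rcases h2.eq_or_lt with h3 | h3
      · left
        rw [hc, hs, ← h3, abs_of_neg h1]
        refine ⟨?_, ?_, by simp⟩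
        · rw [abs_of_nonpos (by nlinarith)]; simp
        · simp [abs_of_neg h1]
      · right
        rw [hc, hs, abs_of_neg h1, abs_of_pos h3] at *
        refine ⟨?_, ?_, by linarith, h3⟩
        · rw [← abs_neg]; ring_nf
        · rw [← abs_neg, abs_of_nonneg (by linarith)]; ring
    · left
      rw [hc, hs, abs_of_neg h1, abs_of_neg h2] at *
      refine ⟨?_, ?_, by nlinarith⟩
      · rw [← abs_neg, abs_of_nonneg (by linarith)]; ring
      · rw [← abs_neg]; ring_nf
  set P := a * c + b * s with hP
  set Q := |a * c - b * s| with hQ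
  have hQ0 : 0 ≤ Q := abs_nonneg _
  have hQP : Q ≤ P := abs_le.2 ⟨by nlinarith, by nlinarith⟩
  have hpow : Q ^ d ≤ P ^ d := pow_le_pow_left₀ hQ0 hQP d
  have hle' : |powerPair d a b A₁ A₂ θ₀| ≤ A₁ * P ^ d + A₂ * Q ^ d := by
    refine hle.trans ?_
    rcases hcase with ⟨h1, h2, -⟩ | ⟨h1, h2, -⟩
    · rw [h1, h2]
    · rw [h1, h2]
      nlinarith
  have hreg : b * s ≤ a * c := by
    by_contra! hlt
    have hsc : c < s := by nlinarith
    have h1 : P < a * s + b * c := by nlinarith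
    have h2 : Q < a * s - b * c := abs_lt.2 ⟨by nlinarith, by nlinarith⟩
    have h3 := hmax (π / 2 - θ')
    have h4 : powerPair d a b A₁ A₂ (π / 2 - θ') =
        A₁ * (a * s + b * c) ^ d + A₂ * (a * s - b * c) ^ d := by
      simp only [powerPair, circleForm, cos_pi_div_two_sub, sin_pi_div_two_sub, hc', hs']
      ring
    have h5 : P ^ d < (a * s + b * c) ^ d := pow_lt_pow_left₀ h1 (hQ0.trans hQP) hd
    have h6 : Q ^ d < (a * s - b * c) ^ d := pow_lt_pow_left₀ h2 hQ0 hd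
    rw [h4] at h3
    have h7 := (le_abs_self _).trans (h3.trans hle')
    nlinarith
  refine ⟨hreg, ?_⟩
  rcases hcase with ⟨-, -, h⟩ | ⟨h1, h2, h3, h4⟩
  · exact h
  · exfalso
    have hlt : Q < P := abs_lt.2 ⟨by nlinarith, by nlinarith [mul_pos hb h4]⟩
    have h5 : Q ^ d < P ^ d := pow_lt_pow_left₀ hlt hQ0 hd
    have h6 : powerPair d a b A₁ A₂ θ' = A₁ * P ^ d + A₂ * Q ^ d := by
      rw [hQ, abs_of_nonneg (by linarith)]
      simp only [powerPair, circleForm, hc', hs', hP]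
      ring
    have h7 := (le_abs_self _).trans ((hmax θ').trans hle)
    rw [h6, h1, h2] at h7
    nlinarith

lemma deriv_eq_zero_of_max_abs {F : ℝ → ℝ} {F' θ₀ : ℝ} (hF : HasDerivAt F F' θ₀)
    (hmax : ∀ᶠ θ in 𝓝 θ₀, |F θ| ≤ |F θ₀|) (h0 : F θ₀ ≠ 0) : F' = 0 := by
  have h1 : IsLocalMax (fun θ => F θ ^ 2) θ₀ := by
    filter_upwards [hmax] with θ hθ
    exact sq_le_sq.2 hθ
  have h2 := h1.hasDerivAt_eq_zero (hF.fun_pow 2)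
  simp only [Nat.add_one_sub_one, pow_one, Nat.cast_ofNat, mul_eq_zero, OfNat.ofNat_ne_zero,
    false_or, h0] at h2
  exact h2

lemma HasPeak.deriv_eq_zero {f : ℝ → ℝ} (hp : HasPeak f) {f' : ℝ} (hf : HasDerivAt f f' 0) :
    f' = 0 := by
  refine deriv_eq_zero_of_max_abs hf ?_ hp.pos.ne'
  filter_upwards [halfCircle_mem_nhds] with x hx
  by_cases hx0 : x = 0
  · rw [hx0]
  · rw [abs_of_pos hp.pos]
    exact (hp.lt x hx hx0).le

/-- A stationary point `b sin θ = t a cos θ` of `|e ^ B p ^ (k + 1) + e ^ (-B) q ^ (k + 1)|` in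
the region found in `max_powerPair_region` solves the mean-field equation. -/
lemma isRoot_of_stationary (hk : 1 ≤ k) (hb : 0 < b) (hab : b < a) (hB : 0 < B) {θ t : ℝ}
    (hc : 0 < cos θ) (ht0 : 0 ≤ t) (ht1 : t ≤ 1) (ht : b * sin θ = t * (a * cos θ))
    (h0 : powerPairDeriv k a b (exp B) (exp (-B)) θ = 0) :
    IsRoot k ((b / a) ^ 2) B t := by
  have ha : 0 < a := hb.trans hab
  set T := (b / a) ^ 2 with hT
  have hT0 : 0 < T := by positivity
  have hba : b / a < 1 := (div_lt_one ha).2 hab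
  have hT1 : T < 1 := by
    have : 0 < b / a := by positivity
    rw [hT]
    nlinarith
  have hs : sin θ = t * (a * cos θ) / b := by rw [eq_div_iff hb.ne', mul_comm, ht]
  have hp : circleForm a b θ = a * cos θ * (1 + t) := by
    simp only [circleForm]; linear_combination ht
  have hq : circleForm a (-b) θ = a * cos θ * (1 - t) := by
    simp only [circleForm]; linear_combination -ht
  have hp' : circleForm b (-a) θ = a ^ 2 * cos θ / b * (T - t) := by
    simp only [circleForm, hs, hT]; field_simp; ring
  have hq' : circleForm (-b) (-a) θ = -(a ^ 2 * cos θ / b * (T + t)) := by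
    simp only [circleForm, hs, hT]; field_simp; ring
  have key : exp B * (1 + t) ^ k * (T - t) = exp (-B) * (1 - t) ^ k * (T + t) := by
    rw [powerPairDeriv, hp, hq, hp', hq', mul_pow (a * cos θ) (1 + t),
      mul_pow (a * cos θ) (1 - t)] at h0
    have h1 : (((k : ℝ) + 1) * (a * cos θ) ^ k * (a ^ 2 * cos θ / b)) *
        (exp B * (1 + t) ^ k * (T - t) - exp (-B) * (1 - t) ^ k * (T + t)) = 0 := by
      linear_combination h0
    rcases mul_eq_zero.1 h1 with h2 | h2
    · have : 0 < ((k : ℝ) + 1) * (a * cos θ) ^ k * (a ^ 2 * cos θ / b) := by positivity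
      exact absurd h2 this.ne'
    · linarith
  have hTt : 0 ≤ T - t := by
    by_contra! hneg
    have h1 : 0 ≤ exp (-B) * (1 - t) ^ k * (T + t) := by
      have : 0 ≤ (1 - t) ^ k := pow_nonneg (by linarith) k
      positivity
    have h2 : 0 < exp B * (1 + t) ^ k := by positivity
    nlinarith
  have ht1' : 0 < 1 - t := by linarith
  have hTt' : 0 < T - t := by
    refine hTt.lt_of_ne fun h => ?_
    rw [← h, mul_zero] at key
    have : 0 < exp (-B) * (1 - t) ^ k * (T + t) := by positivity
    linarith
  have heq : fieldOf k T t = B := by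
    have h1 := congrArg log key
    rw [log_mul (by positivity) hTt'.ne', log_mul (by positivity) (by positivity), log_exp,
      log_pow, log_mul (by positivity) (by positivity), log_mul (by positivity) (by positivity),
      log_exp, log_pow] at h1
    have h2 : t / T < 1 := by rw [div_lt_one hT0]; linarith
    have h3 : 0 ≤ t / T := by positivity
    have h4 : (1 + t / T) / (1 - t / T) = (T + t) / (T - t) := by
      have : 1 - t / T ≠ 0 := by linarith
      field_simp
    rw [fieldOf, artanh_eq_half_log ⟨by linarith, h2.le⟩, artanh_eq_half_log ⟨by linarith, ht1⟩,
      h4, log_div (by positivity) hTt'.ne', log_div (by positivity) ht1'.ne']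
    linarith
  have htpos : 0 < t := by
    refine ht0.lt_of_ne fun h => ?_
    rw [← h, fieldOf_zero] at heq
    exact hB.ne heq
  refine ⟨ht0, by linarith, heq, (stiffness_pos hT0 hT1 ?_ htpos (by linarith) ?_).le⟩
  · have : (1 : ℝ) ≤ k := by exact_mod_cast hk
    linarith
  · rw [heq]
    exact hB.le

lemma sq_div_mem_Ioo (hb : 0 < b) (hab : b < a) : 0 < (b / a) ^ 2 ∧ (b / a) ^ 2 < 1 := by
  have ha : 0 < a := hb.trans hab
  have hba : b / a < 1 := (div_lt_one ha).2 hab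
  have : 0 < b / a := by positivity
  exact ⟨by positivity, by nlinarith⟩

/-- Every maximum of `|e ^ B p ^ (k + 1) + e ^ (-B) q ^ (k + 1)|` on the circle lies on the line
given by the physical solution of the mean-field equation. -/
lemma max_powerPair_eq_root (hk : 1 ≤ k) (hb : 0 < b) (hab : b < a) (hB : 0 < B) {θ₀ : ℝ}
    (hmax : ∀ θ, |powerPair (k + 1) a b (exp B) (exp (-B)) θ| ≤
      |powerPair (k + 1) a b (exp B) (exp (-B)) θ₀|) :
    b * sin θ₀ = root k ((b / a) ^ 2) B * (a * cos θ₀) := by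
  have ha : 0 < a := hb.trans hab
  obtain ⟨hT0, hT1⟩ := sq_div_mem_Ioo hb hab
  have hexp : exp (-B) < exp B := exp_lt_exp.2 (by linarith)
  obtain ⟨hreg, hsign⟩ :=
    max_powerPair_region (Nat.succ_ne_zero k) hb hab (exp_pos _) hexp hmax
  have hcs := sin_sq_add_cos_sq θ₀
  wlog hc : 0 ≤ cos θ₀ generalizing θ₀
  · have h := this (θ₀ := θ₀ + π) (fun θ => by rw [abs_powerPair_add_pi]; exact hmax θ)
      (by simpa using hreg) (by simpa using hsign) (by simp)
      (by rw [cos_add_pi]; linarith)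
    rw [sin_add_pi, cos_add_pi] at h
    linarith
  have hc' : 0 < cos θ₀ := by
    refine hc.lt_of_ne fun h => ?_
    rw [← h] at hreg hcs
    simp only [abs_zero, mul_zero] at hreg
    have h1 : |sin θ₀| ≤ 0 := by nlinarith [abs_nonneg (sin θ₀)]
    have h2 : sin θ₀ = 0 := abs_eq_zero.1 (le_antisymm h1 (abs_nonneg _))
    rw [h2] at hcs
    norm_num at hcs
  have hs : 0 ≤ sin θ₀ := nonneg_of_mul_nonneg_right hsign hc'
  rw [abs_of_nonneg hs, abs_of_pos hc'] at hreg
  set t := b * sin θ₀ / (a * cos θ₀) with ht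
  have ht0 : 0 ≤ t := by positivity
  have ht1 : t ≤ 1 := by rw [ht, div_le_one (by positivity)]; exact hreg
  have hte : b * sin θ₀ = t * (a * cos θ₀) := by rw [ht]; field_simp
  have hF : powerPair (k + 1) a b (exp B) (exp (-B)) θ₀ ≠ 0 := by
    have hp : 0 < circleForm a b θ₀ := by
      simp only [circleForm]; positivity
    have hq : 0 ≤ circleForm a (-b) θ₀ := by
      simp only [circleForm]; linarith
    have : 0 < powerPair (k + 1) a b (exp B) (exp (-B)) θ₀ := by
      simp only [powerPair]; positivity
    exact this.ne'
  have h0 := deriv_eq_zero_of_max_abs (hasDerivAt_powerPair k a b (exp B) (exp (-B)) θ₀)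
    (.of_forall hmax) hF
  have hroot := isRoot_of_stationary hk hb hab hB hc' ht0 ht1 hte h0
  rw [hte, hroot.eq_root hT0 hT1 (by exact_mod_cast hk) hB.le]

lemma hasPeak_powerPair (hk : 1 ≤ k) (hb : 0 < b) (hab : b < a) (hB : 0 < B) {θs : ℝ}
    (hc : 0 < cos θs) (hs : b * sin θs = root k ((b / a) ^ 2) B * (a * cos θs)) :
    HasPeak fun x => powerPair (k + 1) a b (exp B) (exp (-B)) (θs + x) := by
  have ha : 0 < a := hb.trans hab
  obtain ⟨hT0, hT1⟩ := sq_div_mem_Ioo hb hab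
  have hr := isRoot_root hT0 hT1 (r := k) (by exact_mod_cast hk) hB.le
  set t := root k ((b / a) ^ 2) B
  have hpos : 0 < powerPair (k + 1) a b (exp B) (exp (-B)) θs := by
    have hp : 0 < circleForm a b θs := by
      have := hr.nonneg
      simp only [circleForm, hs]
      positivity
    have hq : 0 < circleForm a (-b) θs := by
      have e : circleForm a (-b) θs = a * cos θs * (1 - t) := by
        simp only [circleForm]; linear_combination -hs
      have : 0 < 1 - t := by linarith [hr.lt]
      rw [e]
      positivity
    simp only [powerPair]
    positivity
  have hline : ∀ {θ₀}, (∀ θ, |powerPair (k + 1) a b (exp B) (exp (-B)) θ| ≤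
      |powerPair (k + 1) a b (exp B) (exp (-B)) θ₀|) → sin (θ₀ - θs) = 0 := by
    intro θ₀ hmax
    have h1 := max_powerPair_eq_root hk hb hab hB hmax
    have h2 : b * sin (θ₀ - θs) = 0 := by
      rw [sin_sub]
      linear_combination cos θs * h1 - cos θ₀ * hs
    exact (mul_eq_zero.1 h2).resolve_left hb.ne'
  obtain ⟨θ₀, hmax⟩ := exists_max_powerPair (k + 1) a b (exp B) (exp (-B))
  have heq : |powerPair (k + 1) a b (exp B) (exp (-B)) θ₀| =
      |powerPair (k + 1) a b (exp B) (exp (-B)) θs| := by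
    have h1 := hline hmax
    have h2 : cos (θ₀ - θs) ^ 2 = 1 := by
      have := sin_sq_add_cos_sq (θ₀ - θs)
      rw [h1] at this
      linarith
    have h3 : cos θ₀ = cos (θ₀ - θs) * cos θs := by
      have := cos_add (θ₀ - θs) θs
      rw [h1, sub_add_cancel] at this
      linarith
    have h4 : sin θ₀ = cos (θ₀ - θs) * sin θs := by
      have := sin_add (θ₀ - θs) θs
      rw [h1, sub_add_cancel] at this
      linarith
    have h5 : powerPair (k + 1) a b (exp B) (exp (-B)) θ₀ =
        cos (θ₀ - θs) ^ (k + 1) * powerPair (k + 1) a b (exp B) (exp (-B)) θs := by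
      have e1 : ∀ v, circleForm a v θ₀ = cos (θ₀ - θs) * circleForm a v θs := by
        intro v
        simp only [circleForm, h3, h4]
        ring
      simp only [powerPair, e1, mul_pow]
      ring
    have h6 : |cos (θ₀ - θs)| = 1 :=
      (pow_eq_one_iff_of_nonneg (abs_nonneg _) two_ne_zero).1 (by rw [sq_abs]; exact h2)
    rw [h5, abs_mul, abs_pow, h6, one_pow, one_mul]
  refine ⟨(continuous_powerPair _ _ _ _ _).comp (by fun_prop), by simpa using hpos, ?_⟩
  intro x hx hx0
  simp only [add_zero]
  by_contra! hge
  have hmax' : ∀ θ, |powerPair (k + 1) a b (exp B) (exp (-B)) θ| ≤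
      |powerPair (k + 1) a b (exp B) (exp (-B)) (θs + x)| := by
    intro θ
    refine (hmax θ).trans ?_
    rw [heq, abs_of_pos hpos]
    exact hge
  have h1 := hline hmax'
  rw [add_sub_cancel_left,
    sin_eq_zero_iff_of_lt_of_lt (by linarith [hx.1, pi_pos]) (by linarith [hx.2, pi_pos])] at h1
  exact hx0 h1

end Circle

/-! ### The field derivatives at finite volume -/

section FiniteVolume

open MeasureTheory Real Set

lemma hasDerivAt_integral_param {φ φ' : ℝ → ℝ → ℝ} (hφ : Continuous fun z : ℝ × ℝ => φ z.1 z.2)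
    (hφ' : Continuous fun z : ℝ × ℝ => φ' z.1 z.2)
    (h : ∀ B θ, HasDerivAt (fun B => φ B θ) (φ' B θ) B) (u v B₀ : ℝ) :
    HasDerivAt (fun B => ∫ θ in u..v, φ B θ) (∫ θ in u..v, φ' B₀ θ) B₀ := by
  obtain ⟨C, hC⟩ := ((isCompact_Icc (a := B₀ - 1) (b := B₀ + 1)).prod
    (isCompact_uIcc (a := u) (b := v))).exists_bound_of_continuousOn hφ'.continuousOn
  have hc : ∀ B, Continuous (φ B) := fun B => hφ.comp (by fun_prop : Continuous fun θ => (B, θ))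
  have hc' : ∀ B, Continuous (φ' B) := fun B => hφ'.comp (by fun_prop : Continuous fun θ => (B, θ))
  refine (intervalIntegral.hasDerivAt_integral_of_dominated_loc_of_deriv_le
    (s := Icc (B₀ - 1) (B₀ + 1)) (bound := fun _ => C)
    (Icc_mem_nhds (by linarith) (by linarith)) (.of_forall fun B => ?_) ?_ ?_ ?_ ?_ ?_).2
  · exact (hc B).aestronglyMeasurable
  · exact (hc B₀).intervalIntegrable _ _
  · exact (hc' B₀).aestronglyMeasurable
  · exact .of_forall fun θ hθ B hB => hC (B, θ) ⟨hB, uIoc_subset_uIcc hθ⟩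
  · exact intervalIntegrable_const
  · exact .of_forall fun θ _ B _ => h B θ

variable {d n : ℕ} {a b β B : ℝ}

lemma powerPair_pow_eq_abs {A₁ A₂ : ℝ} (hA₁ : 0 ≤ A₁) (hA₂ : 0 ≤ A₂) (hn : Even (d * n))
    (θ : ℝ) : powerPair d a b A₁ A₂ θ ^ n = |powerPair d a b A₁ A₂ θ| ^ n := by
  rcases Nat.even_mul.1 hn with h | h
  · rw [abs_of_nonneg]
    have h1 := h.pow_nonneg (circleForm a b θ)
    have h2 := h.pow_nonneg (circleForm a (-b) θ)
    exact add_nonneg (mul_nonneg hA₁ h1) (mul_nonneg hA₂ h2)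
  · exact (h.pow_abs _).symm

lemma circleF_eq_powerPair (d : ℕ) (β B θ : ℝ) :
    circleF d β B θ = powerPair d √(cosh β) √(sinh β) (exp B) (exp (-B)) θ := rfl

lemma integral_circleF_pow_pos (hβ : 0 ≤ β) (B : ℝ) (hn : Even (d * n)) (τ : ℝ) :
    0 < ∫ θ in τ..τ + π, circleF d β B θ ^ n := by
  have hc := integral_cos_pow_pos (n := n) (d := d) hn
  have h1 := expectation_partitionFunction hβ B hn τ
  rw [expectation_partitionFunction hβ B hn (-(π / 2)), div_left_inj' hc.ne'] at h1
  rw [← h1]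
  have hcont : Continuous fun θ => circleF d β B θ ^ n :=
    (continuous_powerPair d √(cosh β) √(sinh β) (exp B) (exp (-B))).pow n
  refine intervalIntegral.integral_pos (by linarith [pi_pos]) hcont.continuousOn ?_ ?_
  · intro θ _
    rw [circleF_eq_powerPair, powerPair_pow_eq_abs (exp_pos _).le (exp_pos _).le hn]
    positivity
  · refine ⟨0, ⟨by linarith [pi_pos], by linarith [pi_pos]⟩, ?_⟩
    have : 0 < √(cosh β) := sqrt_pos.2 (cosh_pos β)
    simp only [circleF, circleForm, cos_zero, sin_zero, mul_one, mul_zero, add_zero]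
    positivity

/-- The derivative of `circleF d β B` in the field, which is also its antiderivative. -/
noncomputable def circleG (d : ℕ) (β B θ : ℝ) : ℝ :=
  powerPair d √(cosh β) √(sinh β) (exp B) (-exp (-B)) θ

lemma hasDerivAt_circleF_field (d : ℕ) (β B θ : ℝ) :
    HasDerivAt (fun B => circleF d β B θ) (circleG d β B θ) B := by
  have h1 := (Real.hasDerivAt_exp B).mul_const (circleForm √(cosh β) √(sinh β) θ ^ d)
  have h2 := ((hasDerivAt_neg B).exp).mul_const (circleForm √(cosh β) (-√(sinh β)) θ ^ d)
  refine (h1.add h2).congr_deriv ?_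
  simp only [circleG, powerPair]
  ring

lemma hasDerivAt_circleG_field (d : ℕ) (β B θ : ℝ) :
    HasDerivAt (fun B => circleG d β B θ) (circleF d β B θ) B := by
  have h1 := (Real.hasDerivAt_exp B).mul_const (circleForm √(cosh β) √(sinh β) θ ^ d)
  have h2 := ((hasDerivAt_neg B).exp.neg).mul_const (circleForm √(cosh β) (-√(sinh β)) θ ^ d)
  refine (h1.add h2).congr_deriv ?_
  simp only [circleF]
  ring

lemma continuous_circleF (d : ℕ) (β : ℝ) :
    Continuous fun z : ℝ × ℝ => circleF d β z.1 z.2 := by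
  unfold circleF circleForm
  fun_prop

lemma continuous_circleG (d : ℕ) (β : ℝ) :
    Continuous fun z : ℝ × ℝ => circleG d β z.1 z.2 := by
  unfold circleG powerPair circleForm
  fun_prop

lemma pressureN_eq (hβ : 0 ≤ β) (B : ℝ) (hn : Even (d * n)) (τ : ℝ) :
    pressureN d n β B = 1 / (n : ℝ) * (log (∫ θ in τ..τ + π, circleF d β B θ ^ n) -
      log (∫ θ in (-(π / 2))..(π / 2), cos θ ^ (d * n))) := by
  rw [pressureN, expectation_partitionFunction hβ B hn τ,
    log_div (integral_circleF_pow_pos hβ B hn τ).ne' (integral_cos_pow_pos hn).ne']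

lemma magnetizationN_eq (hβ : 0 ≤ β) {m : ℕ} (hn : Even (d * (m + 2))) (τ B : ℝ) :
    magnetizationN d (m + 2) β B =
      (∫ θ in τ..τ + π, circleF d β B θ ^ (m + 1) * circleG d β B θ) /
        ∫ θ in τ..τ + π, circleF d β B θ ^ (m + 2) := by
  have hF := continuous_circleF d β
  have hG := continuous_circleG d β
  have h1 := hasDerivAt_integral_param (φ := fun B θ => circleF d β B θ ^ (m + 2))
    (φ' := fun B θ => ((m : ℝ) + 2) * (circleF d β B θ ^ (m + 1) * circleG d β B θ))
    (by fun_prop) (by fun_prop) (fun B θ => by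
      refine ((hasDerivAt_circleF_field d β B θ).fun_pow (m + 2)).congr_deriv ?_
      simp only [Nat.add_one_sub_one]
      push_cast
      ring) τ (τ + π) B
  have hpos := integral_circleF_pow_pos hβ B hn τ
  have h2 := ((h1.log hpos.ne').sub_const
    (log (∫ θ in (-(π / 2))..(π / 2), cos θ ^ (d * (m + 2))))).const_mul
      (1 / (((m + 2 : ℕ) : ℝ)))
  have h3 : (fun B' => pressureN d (m + 2) β B') = fun B =>
      1 / (((m + 2 : ℕ) : ℝ)) * (log (∫ θ in τ..τ + π, circleF d β B θ ^ (m + 2)) -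
      log (∫ θ in (-(π / 2))..(π / 2), cos θ ^ (d * (m + 2)))) :=
    funext fun B => pressureN_eq hβ B hn τ
  rw [magnetizationN, h3, h2.deriv, intervalIntegral.integral_const_mul]
  have : (m : ℝ) + 2 ≠ 0 := by positivity
  push_cast
  field_simp

lemma susceptibilityN_eq (hβ : 0 ≤ β) {m : ℕ} (hn : Even (d * (m + 2))) (τ B : ℝ) :
    susceptibilityN d (m + 2) β B =
      1 + ((m : ℝ) + 1) * ((∫ θ in τ..τ + π, circleF d β B θ ^ m * circleG d β B θ ^ 2) /
        ∫ θ in τ..τ + π, circleF d β B θ ^ (m + 2)) -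
      ((m : ℝ) + 2) * ((∫ θ in τ..τ + π, circleF d β B θ ^ (m + 1) * circleG d β B θ) /
        ∫ θ in τ..τ + π, circleF d β B θ ^ (m + 2)) ^ 2 := by
  have hF := continuous_circleF d β
  have hG := continuous_circleG d β
  have hF' : Continuous (circleF d β B) := hF.comp (by fun_prop : Continuous fun θ => (B, θ))
  have hG' : Continuous (circleG d β B) := hG.comp (by fun_prop : Continuous fun θ => (B, θ))
  have h1 := hasDerivAt_integral_param (φ := fun B θ => circleF d β B θ ^ (m + 2))
    (φ' := fun B θ => ((m : ℝ) + 2) * (circleF d β B θ ^ (m + 1) * circleG d β B θ))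
    (by fun_prop) (by fun_prop) (fun B θ => by
      refine ((hasDerivAt_circleF_field d β B θ).fun_pow (m + 2)).congr_deriv ?_
      simp only [Nat.add_one_sub_one]
      push_cast
      ring) τ (τ + π) B
  have h2 := hasDerivAt_integral_param
    (φ := fun B θ => circleF d β B θ ^ (m + 1) * circleG d β B θ)
    (φ' := fun B θ => ((m : ℝ) + 1) * (circleF d β B θ ^ m * circleG d β B θ ^ 2) +
      circleF d β B θ ^ (m + 2))
    (by fun_prop) (by fun_prop) (fun B θ => by
      refine (((hasDerivAt_circleF_field d β B θ).fun_pow (m + 1)).mul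
        (hasDerivAt_circleG_field d β B θ)).congr_deriv ?_
      simp only [Nat.add_sub_cancel]
      push_cast
      ring) τ (τ + π) B
  have hpos := integral_circleF_pow_pos hβ B hn τ
  have h3 : (fun B' => magnetizationN d (m + 2) β B') = fun B =>
      (∫ θ in τ..τ + π, circleF d β B θ ^ (m + 1) * circleG d β B θ) /
        ∫ θ in τ..τ + π, circleF d β B θ ^ (m + 2) :=
    funext fun B => magnetizationN_eq hβ hn τ B
  rw [susceptibilityN, h3, (h2.fun_div h1 hpos.ne').deriv, intervalIntegral.integral_add,
    intervalIntegral.integral_const_mul, intervalIntegral.integral_const_mul]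
  · field_simp
    ring
  · exact Continuous.intervalIntegrable (by fun_prop) _ _
  · exact Continuous.intervalIntegrable (by fun_prop) _ _

instance neBot_sizes (d : ℕ) : (sizes d).NeBot := by
  rw [sizes, inf_principal_neBot_iff]
  intro U hU
  obtain ⟨N, hN⟩ := mem_atTop_sets.1 hU
  exact ⟨2 * N, hN _ (by omega), (even_two_mul N).mul_left d⟩

lemma sizes_le_atTop (d : ℕ) : sizes d ≤ atTop := inf_le_left

lemma eventually_even_sizes (d : ℕ) : ∀ᶠ n in sizes d, Even (d * n) :=
  eventually_inf_principal.2 (.of_forall fun _ h => h)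

lemma tendsto_sizes_of_add_two {u : ℕ → ℝ} {l : Filter ℝ}
    (h : Tendsto (fun m => u (m + 2)) (sizes d) l) : Tendsto u (sizes d) l := by
  have h1 : Tendsto (fun n => n - 2) (sizes d) (sizes d) := by
    refine tendsto_inf.2 ⟨(tendsto_sub_atTop_nat 2).mono_left inf_le_left, ?_⟩
    rw [tendsto_principal]
    filter_upwards [eventually_even_sizes d] with n hn
    rw [Nat.mul_sub]
    exact hn.tsub (even_two.mul_left d)
  refine (h.comp h1).congr' ?_
  filter_upwards [sizes_le_atTop d (eventually_ge_atTop 2)] with n hn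
  simp only [Function.comp_apply, Nat.sub_add_cancel hn]

end FiniteVolume

/-! ### The thermodynamic limits -/

section Thermodynamic

open Real Set

variable {j : ℕ} {a b β B : ℝ}

/-- The annealed magnetization as a function of the solution `t` of the mean-field equation. -/
noncomputable def rootMagnetization (T t : ℝ) : ℝ := t * (1 + T) / (T + t ^ 2)

/-- The annealed susceptibility as a function of the solution `t` of the mean-field equation. -/
noncomputable def rootSusceptibility (r T t : ℝ) : ℝ :=
  (1 + T) * (T - t ^ 2) * (T ^ 2 - t ^ 2) * (1 - t ^ 2) / ((T + t ^ 2) ^ 2 * stiffness r T t)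

/-- The value `f₀` and the second derivative `f₂` of the circle integrand at its peak, the value
`g₀` of its field derivative, and the slope `D` there of the field derivative minus `m` times the
integrand. In degree `r + 1 = j + 2`, the numbers `u` and `v` stand for `e ^ B p ^ j` and
`e ^ (-B) q ^ j`, and `hcrit` says that the first derivative vanishes. -/
lemma peak_algebra {r T t m X Y u v f₀ g₀ D f₂ : ℝ} (hT : 0 < T) (hT1 : T < 1) (ht : 0 ≤ t)
    (htT : t < T) (hr : 0 < r + 1) (hN : 0 < stiffness r T t) (hX : 0 < X)
    (hY : Y ^ 2 = X ^ 2 / T) (hu : 0 < u)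
    (hcrit : u * (1 + t) * (T - t) = v * (1 - t) * (T + t))
    (hf₀ : f₀ = u * (X * (1 + t)) ^ 2 + v * (X * (1 - t)) ^ 2)
    (hg₀ : g₀ = u * (X * (1 + t)) ^ 2 - v * (X * (1 - t)) ^ 2)
    (hm : m = rootMagnetization T t)
    (hD : D = (r + 1) * (u * (X * (1 + t)) * (Y * (T - t)) -
      v * (X * (1 - t)) * -(Y * (T + t))))
    (hf₂ : f₂ = (r + 1) * (u * (r * (Y * (T - t)) ^ 2 - (X * (1 + t)) ^ 2) +
      v * (r * (-(Y * (T + t))) ^ 2 - (X * (1 - t)) ^ 2))) :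
    g₀ = m * f₀ ∧ f₂ ≠ 0 ∧ 1 - m ^ 2 - D ^ 2 / (f₂ * f₀) = rootSusceptibility r T t := by
  have h1 : 0 < 1 - t := by linarith
  have h2 : 0 < T + t := by linarith
  have h3 : 0 < T + t ^ 2 := by positivity
  have h4 : 0 < 1 - t ^ 2 := by nlinarith
  obtain ⟨c, hc⟩ : ∃ c, c = u / ((1 - t) * (T + t)) := ⟨_, rfl⟩
  have hc0 : 0 < c := by rw [hc]; positivity
  have hu' : u = c * (1 - t) * (T + t) := by rw [hc]; field_simp
  have hv' : v = c * (1 + t) * (T - t) := by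
    have : (1 - t) * (T + t) ≠ 0 := by positivity
    apply mul_left_cancel₀ this
    rw [hu'] at hcrit
    linear_combination -hcrit
  have hf : f₀ = 2 * c * X ^ 2 * (1 - t ^ 2) * (T + t ^ 2) := by rw [hf₀, hu', hv']; ring
  have hg : g₀ = 2 * c * X ^ 2 * (1 - t ^ 2) * (t * (1 + T)) := by rw [hg₀, hu', hv']; ring
  have hD2 : D ^ 2 = (2 * (r + 1) * c * (1 - t ^ 2) * (T ^ 2 - t ^ 2)) ^ 2 * X ^ 2 *
      (X ^ 2 / T) := by
    rw [← hY, hD, hu', hv']; ring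
  have hf2 : f₂ = -(2 * (r + 1) * c * (T + t ^ 2) * (X ^ 2 / T) * stiffness r T t) := by
    have e : f₂ = 2 * (r + 1) * c * (T + t ^ 2) *
        (r * Y ^ 2 * (T ^ 2 - t ^ 2) - X ^ 2 * (1 - t ^ 2)) := by
      rw [hf₂, hu', hv']; ring
    rw [e, hY, stiffness]
    field_simp
    ring
  have hf2ne : f₂ ≠ 0 := by
    have : 0 < 2 * (r + 1) * c * (T + t ^ 2) * (X ^ 2 / T) * stiffness r T t := by positivity
    rw [hf2]
    linarith
  refine ⟨?_, hf2ne, ?_⟩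
  · rw [hg, hf, hm, rootMagnetization]
    field_simp
  · have e : D ^ 2 / (f₂ * f₀) =
        -((r + 1) * (1 - t ^ 2) * (T ^ 2 - t ^ 2) ^ 2 /
          ((T + t ^ 2) ^ 2 * stiffness r T t)) := by
      rw [hD2, hf2, hf]
      field_simp
    rw [e, hm, rootMagnetization, rootSusceptibility]
    have hN' := hN.ne'
    have hs : stiffness r T t = T - r * T ^ 2 + (r - T) * t ^ 2 := rfl
    field_simp
    rw [hs]
    ring

lemma exists_peak_angle (ha : 0 < a) (hb : 0 < b) (t : ℝ) :
    ∃ θ, 0 < cos θ ∧ b * sin θ = t * (a * cos θ) := by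
  refine ⟨arctan (t * a / b), cos_arctan_pos _, ?_⟩
  have h1 := tan_mul_cos (cos_arctan_pos (t * a / b)).ne'
  rw [tan_arctan] at h1
  rw [← h1]
  field_simp

lemma sq_sqrt_sinh_div_sqrt_cosh (hβ : 0 < β) : (√(sinh β) / √(cosh β)) ^ 2 = tanh β := by
  rw [div_pow, sq_sqrt (sinh_pos_iff.2 hβ).le, sq_sqrt (cosh_pos β).le, tanh_eq_sinh_div_cosh]

lemma sqrt_sinh_lt_sqrt_cosh (hβ : 0 < β) : √(sinh β) < √(cosh β) :=
  sqrt_lt_sqrt (sinh_pos_iff.2 hβ).le (sinh_lt_cosh β)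

/-- The annealed pressure as a function of the solution `t` of the mean-field equation. -/
noncomputable def rootPressure (d : ℕ) (β B t : ℝ) : ℝ :=
  (d : ℝ) / 2 * log (cosh β * tanh β / (tanh β + t ^ 2)) +
    log (exp B * (1 + t) ^ d + exp (-B) * (1 - t) ^ d)

lemma tanh_pos (hβ : 0 < β) : 0 < tanh β := by
  rw [← tanh_zero]
  exact tanh_strictMono hβ

/-- The thermodynamic limits at positive inverse temperature and field, in terms of the solution of the
mean-field equation. -/
theorem tendsto_of_pos (j : ℕ) (hβ : 0 < β) (hB : 0 < B) :
    Tendsto (fun n => pressureN (j + 2) n β B) (sizes (j + 2))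
      (𝓝 (rootPressure (j + 2) β B (root ((j + 1 : ℕ) : ℝ) (tanh β) B))) ∧
    Tendsto (fun n => magnetizationN (j + 2) n β B) (sizes (j + 2))
      (𝓝 (rootMagnetization (tanh β) (root ((j + 1 : ℕ) : ℝ) (tanh β) B))) ∧
    Tendsto (fun n => susceptibilityN (j + 2) n β B) (sizes (j + 2))
      (𝓝 (rootSusceptibility ((j + 1 : ℕ) : ℝ) (tanh β)
        (root ((j + 1 : ℕ) : ℝ) (tanh β) B))) := by
  have hk : 1 ≤ j + 1 := by omega
  have hb : 0 < √(sinh β) := sqrt_pos.2 (sinh_pos_iff.2 hβ)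
  have hab := sqrt_sinh_lt_sqrt_cosh hβ
  have ha : 0 < √(cosh β) := hb.trans hab
  have hTe := sq_sqrt_sinh_div_sqrt_cosh hβ
  have hT0 : 0 < tanh β := tanh_pos hβ
  have hT1 := tanh_lt_one β
  have hr1 : (1 : ℝ) ≤ ((j + 1 : ℕ) : ℝ) := by exact_mod_cast hk
  have hroot := isRoot_root hT0 hT1 hr1 hB.le
  have hN := stiffness_root_pos hT0 hT1 hr1 hB.le (.inl hB)
  set T := tanh β with hT
  set t := root ((j + 1 : ℕ) : ℝ) T B with ht
  obtain ⟨θs, hc, hs⟩ := exists_peak_angle ha hb t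
  have hpeak := hasPeak_powerPair hk hb hab hB hc (by rw [hTe]; exact hs)
  set a := √(cosh β) with ha_def
  set b := √(sinh β) with hb_def
  set f : ℝ → ℝ := fun x => powerPair (j + 1 + 1) a b (exp B) (exp (-B)) (θs + x) with hf_def
  set g : ℝ → ℝ := fun x => powerPair (j + 1 + 1) a b (exp B) (-exp (-B)) (θs + x) with hg_def
  have hfd : ∀ x, HasDerivAt f (powerPairDeriv (j + 1) a b (exp B) (exp (-B)) (θs + x)) x :=
    fun x => (hasDerivAt_powerPair (j + 1) a b (exp B) (exp (-B)) (θs + x)).comp_const_add θs x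
  have hgd : ∀ x, HasDerivAt g (powerPairDeriv (j + 1) a b (exp B) (-exp (-B)) (θs + x)) x :=
    fun x => (hasDerivAt_powerPair (j + 1) a b (exp B) (-exp (-B)) (θs + x)).comp_const_add θs x
  have hfd' := (hasDerivAt_powerPairDeriv j a b (exp B) (exp (-B)) (θs + 0)).comp_const_add θs 0
  have hf'c : Continuous fun x => powerPairDeriv (j + 1) a b (exp B) (exp (-B)) (θs + x) :=
    (continuous_powerPairDeriv _ _ _ _ _).comp (by fun_prop)
  have hfc : Continuous f := hpeak.continuous
  have hgc : Continuous g := (continuous_powerPair _ _ _ _ _).comp (by fun_prop)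
  have hf0 := hpeak.deriv_eq_zero (hfd 0)
  -- the values of the linear forms and of their derivatives at the peak
  have hTba : T = b ^ 2 / a ^ 2 := by rw [← hTe, div_pow]
  have hsin : sin θs = t * (a * cos θs) / b := by rw [eq_div_iff hb.ne', mul_comm, hs]
  set X := a * cos θs with hX_def
  set Y := a ^ 2 * cos θs / b with hY_def
  have hX : 0 < X := by positivity
  have hYX : Y ^ 2 = X ^ 2 / T := by
    rw [hY_def, hX_def, hTba]; field_simp
  have hp : circleForm a b θs = X * (1 + t) := by
    simp only [circleForm]; linear_combination hs
  have hq : circleForm a (-b) θs = X * (1 - t) := by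
    simp only [circleForm]; linear_combination -hs
  have hp' : circleForm b (-a) θs = Y * (T - t) := by
    simp only [circleForm, hsin, hTba, hY_def, hX_def]; field_simp; ring
  have hq' : circleForm (-b) (-a) θs = -(Y * (T + t)) := by
    simp only [circleForm, hsin, hTba, hY_def, hX_def]; field_simp; ring
  have hY : 0 < Y := by positivity
  have htnn := hroot.nonneg
  have htT := hroot.lt
  have hone : 0 < 1 - t := by linarith
  set u := exp B * (X * (1 + t)) ^ j with hu_def
  set v := exp (-B) * (X * (1 - t)) ^ j with hv_def
  have hu : 0 < u := by positivity
  have hf0e : f 0 = u * (X * (1 + t)) ^ 2 + v * (X * (1 - t)) ^ 2 := by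
    simp only [hf_def, add_zero, powerPair, hp, hq, hu_def, hv_def]; ring
  have hg0e : g 0 = u * (X * (1 + t)) ^ 2 - v * (X * (1 - t)) ^ 2 := by
    simp only [hg_def, add_zero, powerPair, hp, hq, hu_def, hv_def]; ring
  have hcrit : u * (1 + t) * (T - t) = v * (1 - t) * (T + t) := by
    simp only [add_zero, powerPairDeriv, hp, hq, hp', hq'] at hf0
    have h1 : (((j + 1 : ℕ) : ℝ) + 1) * X * Y *
        (u * (1 + t) * (T - t) - v * (1 - t) * (T + t)) = 0 := by
      rw [hu_def, hv_def]
      linear_combination hf0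
    have h2 : (((j + 1 : ℕ) : ℝ) + 1) * X * Y ≠ 0 := by positivity
    linarith [(mul_eq_zero.1 h1).resolve_left h2]
  set m := rootMagnetization T t with hm
  set D : ℝ → ℝ := fun x => g x - m * f x with hD_def
  have hDd := (hgd 0).sub ((hfd 0).const_mul m)
  obtain ⟨hgm, hf2, hχ⟩ := peak_algebra (r := ((j + 1 : ℕ) : ℝ)) hT0 hT1 htnn htT
    (by linarith) hN hX hYX hu hcrit hf0e hg0e hm rfl rfl
  have hDd' : HasDerivAt D ((((j + 1 : ℕ) : ℝ) + 1) * (u * (X * (1 + t)) * (Y * (T - t)) -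
      v * (X * (1 - t)) * -(Y * (T + t)))) 0 := by
    refine hDd.congr_deriv ?_
    rw [hf0]
    simp only [add_zero, powerPairDeriv, hp, hq, hp', hq', hu_def, hv_def]
    ring
  have hfd2 : HasDerivAt (fun x => powerPairDeriv (j + 1) a b (exp B) (exp (-B)) (θs + x))
      ((((j + 1 : ℕ) : ℝ) + 1) * (u * (((j + 1 : ℕ) : ℝ) * (Y * (T - t)) ^ 2 -
        (X * (1 + t)) ^ 2) + v * (((j + 1 : ℕ) : ℝ) * (-(Y * (T + t))) ^ 2 -
        (X * (1 - t)) ^ 2))) 0 := by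
    refine hfd'.congr_deriv ?_
    simp only [add_zero, hp, hq, hp', hq', hu_def, hv_def]
    push_cast
    ring
  have hD0 : D 0 = 0 := by simp only [hD_def, hgm]; ring
  have hDc : Continuous D := by fun_prop
  have hpow : ∀ᶠ n in sizes (j + 2), ∀ x, f x ^ n = |f x| ^ n := by
    filter_upwards [eventually_even_sizes (j + 2)] with n hn x
    exact powerPair_pow_eq_abs (exp_pos _).le (exp_pos _).le hn _
  have hfluct := hpeak.tendsto_fluctuation hfd hf'c hf0 hfd2 hf2 (sizes_le_atTop _) hpow hDc hD0
    hDd'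
  have hle := sizes_le_atTop (j + 2)
  have hff := (hpeak.tendsto_weighted (h := fun x => f x ^ 2) (by fun_prop)).mono_left hle
  have hfD := (hpeak.tendsto_weighted (h := fun x => f x * D x) (by fun_prop)).mono_left hle
  have hff0 : f 0 ^ 2 ≠ 0 := by have := hpeak.pos; positivity
  have hy : Tendsto (fun n => weighted f n (fun x => f x * D x) /
      weighted f n (fun x => f x ^ 2)) (sizes (j + 2)) (𝓝 0) := by
    have h1 := hfD.div hff hff0
    rw [hD0, mul_zero, zero_div] at h1
    refine h1.congr fun n => ?_
    simp only [Pi.div_apply]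
    rw [div_div_div_cancel_right₀ (weighted_one_pos hpeak n).ne']
  -- translation of the integrals to the peak
  have hshift : ∀ h : ℝ → ℝ, ∫ θ in (θs - π / 2)..(θs - π / 2 + π), h θ =
      ∫ x in (-(π / 2))..(π / 2), h (θs + x) := by
    intro h
    rw [intervalIntegral.integral_comp_add_left]
    congr 1
    ring
  have hI0 : ∀ n, (∀ x, f x ^ n = |f x| ^ n) →
      ∫ θ in (θs - π / 2)..(θs - π / 2 + π), circleF (j + 2) β B θ ^ n =
        weighted f n fun _ => 1 := by
    intro n hn
    rw [hshift, weighted_eq_intervalIntegral]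
    refine intervalIntegral.integral_congr fun x _ => ?_
    rw [mul_one, ← hn x]
    rfl
  have hI : ∀ n, (∀ x, f x ^ n = |f x| ^ n) →
      ∫ θ in (θs - π / 2)..(θs - π / 2 + π), circleF (j + 2) β B θ ^ (n + 2) =
        weighted f n fun x => f x ^ 2 := by
    intro n hn
    rw [hshift, weighted_eq_intervalIntegral]
    refine intervalIntegral.integral_congr fun x _ => ?_
    rw [← hn x, ← pow_add]
    rfl
  have hJ : ∀ n, (∀ x, f x ^ n = |f x| ^ n) →
      ∫ θ in (θs - π / 2)..(θs - π / 2 + π),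
        circleF (j + 2) β B θ ^ (n + 1) * circleG (j + 2) β B θ =
        weighted f n (fun x => f x * D x) + m * weighted f n fun x => f x ^ 2 := by
    intro n hn
    rw [hshift, ← weighted_const_mul, ← weighted_add hfc n (by fun_prop) (by fun_prop),
      weighted_eq_intervalIntegral]
    refine intervalIntegral.integral_congr fun x _ => ?_
    have e : f x ^ (n + 1) * g x = |f x| ^ n * (f x * D x + m * f x ^ 2) := by
      rw [← hn x, hD_def]
      ring
    exact e
  have hK : ∀ n, (∀ x, f x ^ n = |f x| ^ n) →
      ∫ θ in (θs - π / 2)..(θs - π / 2 + π),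
        circleF (j + 2) β B θ ^ n * circleG (j + 2) β B θ ^ 2 =
        weighted f n (fun x => D x ^ 2) + 2 * m * weighted f n (fun x => f x * D x) +
          m ^ 2 * weighted f n fun x => f x ^ 2 := by
    intro n hn
    rw [hshift, ← weighted_const_mul, ← weighted_const_mul,
      ← weighted_add hfc n (by fun_prop) (by fun_prop),
      ← weighted_add hfc n (by fun_prop) (by fun_prop), weighted_eq_intervalIntegral]
    refine intervalIntegral.integral_congr fun x _ => ?_
    have e : f x ^ n * g x ^ 2 =
        |f x| ^ n * (D x ^ 2 + 2 * m * (f x * D x) + m ^ 2 * f x ^ 2) := by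
      rw [← hn x, hD_def]
      ring
    exact e
  refine ⟨?_, ?_, ?_⟩
  · -- the normalisation grows subexponentially, by the same concentration argument
    have hcos : HasPeak fun x => cos x ^ (j + 2) := by
      refine ⟨by fun_prop, by simp, fun x hx hx0 => ?_⟩
      rw [cos_zero, one_pow, abs_pow]
      refine pow_lt_one₀ (abs_nonneg _) ?_ (by omega)
      rw [abs_of_nonneg (cos_nonneg_of_mem_Icc hx), ← cos_zero, ← cos_abs x]
      exact cos_lt_cos_of_nonneg_of_le_pi le_rfl
        ((abs_le.2 ⟨hx.1, hx.2⟩).trans (by linarith [pi_pos])) (abs_pos.2 hx0)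
    have h1 := (hpeak.tendsto_log_weighted.sub hcos.tendsto_log_weighted).mono_left hle
    have e : log (f 0) - log (cos 0 ^ (j + 2)) = rootPressure (j + 2) β B t := by
      have hC2 : X ^ 2 = cosh β * T / (T + t ^ 2) := by
        have hid : cos θs ^ 2 * (T + t ^ 2) = T := by
          have h3 := sin_sq_add_cos_sq θs
          rw [hsin, hX_def] at h3
          have h4 : (t * (a * cos θs) / b) ^ 2 = t ^ 2 * cos θs ^ 2 / T := by
            rw [hTba]; field_simp
          rw [h4] at h3
          field_simp at h3
          linarith
        have h5 : 0 < T + t ^ 2 := by positivity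
        rw [hX_def, mul_pow, ha_def, sq_sqrt (cosh_pos β).le]
        field_simp
        linear_combination hid
      have hfact : f 0 = X ^ (j + 2) * (exp B * (1 + t) ^ (j + 2) +
          exp (-B) * (1 - t) ^ (j + 2)) := by
        rw [hf0e, hu_def, hv_def, mul_pow X (1 + t) j, mul_pow X (1 - t) j]; ring
      rw [hfact, cos_zero, one_pow, log_one, sub_zero, log_mul (by positivity) (by positivity),
        rootPressure, ← hT, ← hC2, log_pow, log_pow]
      push_cast
      ring
    rw [e] at h1
    refine h1.congr' ?_
    filter_upwards [hpow, eventually_even_sizes (j + 2)] with n hn hne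
    rw [pressureN_eq hβ.le B hne (θs - π / 2), hI0 n hn]
    have e2 : weighted (fun x => cos x ^ (j + 2)) n (fun _ => 1) =
        ∫ θ in (-(π / 2))..(π / 2), cos θ ^ ((j + 2) * n) := by
      rw [weighted_eq_intervalIntegral]
      refine intervalIntegral.integral_congr fun x _ => ?_
      rw [mul_one, abs_pow, ← pow_mul, hne.pow_abs]
    rw [e2]
    ring
  · refine tendsto_sizes_of_add_two ?_
    have h1 := hy.const_add m
    rw [add_zero] at h1
    refine h1.congr' ?_
    filter_upwards [hpow, eventually_even_sizes (j + 2)] with n hn hne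
    rw [magnetizationN_eq hβ.le (by rw [Nat.mul_add]; exact hne.add (even_two.mul_left _))
      (θs - π / 2), hI n hn, hJ n hn]
    have h2 : weighted f n (fun x => f x ^ 2) ≠ 0 := by
      rw [← hI n hn]
      exact (integral_circleF_pow_pos hβ.le B
        (by rw [Nat.mul_add]; exact hne.add (even_two.mul_left _)) _).ne'
    field_simp
    ring
  · refine tendsto_sizes_of_add_two ?_
    have h1 := (hfluct.sub (hy.const_mul (2 * m))).const_add (1 - m ^ 2)
    rw [mul_zero, sub_zero, ← sub_eq_add_neg, hχ] at h1
    refine h1.congr' ?_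
    filter_upwards [hpow, eventually_even_sizes (j + 2)] with n hn hne
    rw [susceptibilityN_eq hβ.le (by rw [Nat.mul_add]; exact hne.add (even_two.mul_left _))
      (θs - π / 2), hI n hn, hJ n hn, hK n hn]
    have h2 : weighted f n (fun x => f x ^ 2) ≠ 0 := by
      rw [← hI n hn]
      exact (integral_circleF_pow_pos hβ.le B
        (by rw [Nat.mul_add]; exact hne.add (even_two.mul_left _)) _).ne'
    field_simp
    ring

/-- At infinite temperature the spins are independent. -/
lemma expectation_partitionFunction_zero {d n : ℕ} (hn : Even (d * n)) (B : ℝ) :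
    expectation n d (fun G => partitionFunction G 0 B) = (2 * cosh B) ^ n := by
  rw [expectation_partitionFunction le_rfl B hn (-(π / 2)), show -(π / 2) + π = π / 2 by ring]
  have h1 : ∀ θ, circleF d 0 B θ ^ n = (2 * cosh B) ^ n * cos θ ^ (d * n) := by
    intro θ
    rw [circleF, cosh_eq B, pow_mul, ← mul_pow]
    simp only [circleForm, cosh_zero, sinh_zero, sqrt_one, sqrt_zero]
    ring
  simp only [h1]
  rw [intervalIntegral.integral_const_mul, mul_div_assoc, div_self (integral_cos_pow_pos hn).ne',
    mul_one]

theorem tendsto_of_zero (d : ℕ) (B : ℝ) :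
    Tendsto (fun n => pressureN d n 0 B) (sizes d) (𝓝 (log (2 * cosh B))) ∧
    Tendsto (fun n => magnetizationN d n 0 B) (sizes d) (𝓝 (tanh B)) ∧
    Tendsto (fun n => susceptibilityN d n 0 B) (sizes d) (𝓝 (1 - tanh B ^ 2)) := by
  have hev := (eventually_even_sizes d).and (sizes_le_atTop d (eventually_gt_atTop 0))
  have hp : ∀ n, Even (d * n) → 0 < n →
      (fun B => pressureN d n 0 B) = fun B => log (2 * cosh B) := by
    intro n hn hn0
    funext B
    have : (n : ℝ) ≠ 0 := by positivity
    rw [pressureN, expectation_partitionFunction_zero hn, log_pow]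
    field_simp
  have hm : ∀ n, Even (d * n) → 0 < n → (fun B => magnetizationN d n 0 B) = tanh := by
    intro n hn hn0
    funext B
    have hc := cosh_pos B
    rw [magnetizationN, hp n hn hn0, (((hasDerivAt_cosh B).const_mul 2).log (by positivity)).deriv,
      tanh_eq_sinh_div_cosh]
    field_simp
  refine ⟨?_, ?_, ?_⟩ <;> refine tendsto_const_nhds.congr' ?_ <;>
    filter_upwards [hev] with n hn
  · exact (congrFun (hp n hn.1 hn.2) B).symm
  · exact (congrFun (hm n hn.1 hn.2) B).symm
  · rw [susceptibilityN, hm n hn.1 hn.2, (hasDerivAt_tanh B).deriv]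

end Thermodynamic

/-! ### The limiting functions and their zero-field limits -/

section LimitingFunctions

open Real Set

variable {r T t β B : ℝ} {j : ℕ}

/-- The mean-field equation in exponential form. -/
lemma IsRoot.exp_eq {k : ℕ} (hT : 0 < T) (hT1 : T < 1) (h : IsRoot k T B t) :
    exp B * (1 + t) ^ k * (T - t) = exp (-B) * (1 - t) ^ k * (T + t) := by
  have h0 := h.nonneg
  have h1 := h.lt
  have h2 : 0 < T - t := by linarith
  have h3 : 0 < 1 - t := by linarith
  have h4 : t / T < 1 := by rw [div_lt_one hT]; exact h1
  have h5 : 0 ≤ t / T := by positivity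
  have h6 : (1 + t / T) / (1 - t / T) = (T + t) / (T - t) := by
    have : 1 - t / T ≠ 0 := by linarith
    field_simp
  have h7 := h.eq
  rw [fieldOf, artanh_eq_half_log ⟨by linarith, h4.le⟩, artanh_eq_half_log ⟨by linarith, by linarith⟩,
    h6, log_div (by positivity) h2.ne', log_div (by positivity) h3.ne'] at h7
  refine log_injOn_pos (mem_Ioi.2 (by positivity)) (mem_Ioi.2 (by positivity)) ?_
  rw [log_mul (by positivity) h2.ne', log_mul (by positivity) (by positivity), log_exp,
    log_pow, log_mul (by positivity) (by positivity), log_mul (by positivity) (by positivity),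
    log_exp, log_pow]
  linarith

/-- The derivative of the annealed pressure in the inverse temperature, as a function of the
solution `t` of the mean-field equation. -/
noncomputable def rootEnergy (d : ℕ) (T t : ℝ) : ℝ :=
  (d : ℝ) / 2 * ((t ^ 2 + T ^ 3) / (T * (T + t ^ 2)))

/-- The second derivative of the annealed pressure in the inverse temperature, as a function of
the solution `t` of the mean-field equation. -/
noncomputable def rootSpecificHeat (d : ℕ) (r T t : ℝ) : ℝ :=
  (1 - T ^ 2) * ((d : ℝ) / 2 * ((T ^ 4 + 2 * T ^ 3 * t ^ 2 - 2 * T * t ^ 2 - t ^ 4) /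
    (T ^ 2 * (T + t ^ 2) ^ 2)) +
    (d : ℝ) * (1 - T ^ 2) * (1 - t ^ 2) / (T + t ^ 2) ^ 2 * (t ^ 2 / stiffness r T t))

lemma hasDerivAt_root_tanh (hr : 1 ≤ r) (hβ : 0 < β) (hB : 0 < B) :
    HasDerivAt (fun β => root r (tanh β) B)
      (root r (tanh β) B * (1 - root r (tanh β) B ^ 2) /
        stiffness r (tanh β) (root r (tanh β) B) * (1 - tanh β ^ 2)) β :=
  (hasDerivAt_root_coupling (tanh_pos hβ) (tanh_lt_one β) hr hB).comp β (hasDerivAt_tanh β)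

/-- The pressure is stationary in `t` at the solution of the mean-field equation, so only the
explicit dependence on the inverse temperature contributes to its derivative. -/
lemma hasDerivAt_rootPressure (k : ℕ) (hk : 1 ≤ k) (hβ : 0 < β) (hB : 0 < B) :
    HasDerivAt (fun β => rootPressure (k + 1) β B (root k (tanh β) B))
      (rootEnergy (k + 1) (tanh β) (root k (tanh β) B)) β := by
  have hr : (1 : ℝ) ≤ k := by exact_mod_cast hk
  have hT0 := tanh_pos hβ
  have hT1 := tanh_lt_one β
  have hroot := isRoot_root hT0 hT1 hr hB.le
  have ht := hasDerivAt_root_tanh hr hβ hB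
  have hTd := hasDerivAt_tanh β
  have hN := stiffness_root_pos hT0 hT1 hr hB.le (.inl hB)
  have hcosh := cosh_pos β
  have hsinh : sinh β = tanh β * cosh β := by
    rw [tanh_eq_sinh_div_cosh]
    field_simp
  have hcd := hasDerivAt_cosh β
  rw [hsinh] at hcd
  set t' := root k (tanh β) B * (1 - root k (tanh β) B ^ 2) /
        stiffness k (tanh β) (root k (tanh β) B) * (1 - tanh β ^ 2) with ht'
  have hexp := hroot.exp_eq hT0 hT1
  have htnn := hroot.nonneg
  have htT := hroot.lt
  have hden : 0 < tanh β + root k (tanh β) B ^ 2 := by positivity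
  have h1t : 0 < 1 - root k (tanh β) B := by linarith
  have h1 := (((hcd.mul hTd).div (hTd.add (ht.fun_pow 2)) hden.ne').log
    (by simp only [Pi.div_apply, Pi.mul_apply, Pi.add_apply]; positivity)).const_mul
      (((k + 1 : ℕ) : ℝ) / 2)
  have h2 := ((((ht.const_add 1).fun_pow (k + 1)).const_mul (exp B)).add
    (((ht.const_sub 1).fun_pow (k + 1)).const_mul (exp (-B)))).log
      (by simp only [Pi.add_apply]; positivity)
  refine (h1.add h2).congr_deriv ?_
  simp only [Pi.div_apply, Pi.mul_apply, Pi.add_apply, Nat.add_sub_cancel, rootEnergy]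
  set T := tanh β with hT
  set t := root k T B with htdef
  have hT2 : 0 < T - t := by linarith
  set x := exp B * (1 + t) ^ k with hx
  set y := exp (-B) * (1 - t) ^ k with hy
  have hx0 : 0 < x := by positivity
  have hy0 : 0 < y := by positivity
  have e1 : exp B * (1 + t) ^ (k + 1) + exp (-B) * (1 - t) ^ (k + 1) =
      x * (1 + t) + y * (1 - t) := by rw [hx, hy]; ring
  have e2 : exp B * (((k + 1 : ℕ) : ℝ) * (1 + t) ^ k * t') +
      exp (-B) * (((k + 1 : ℕ) : ℝ) * (1 - t) ^ k * -t') =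
      ((k + 1 : ℕ) : ℝ) * t' * (x - y) := by rw [hx, hy]; ring
  have e3 : (x - y) / (x * (1 + t) + y * (1 - t)) = t / (T + t ^ 2) := by
    rw [div_eq_div_iff (by positivity) hden.ne']
    linear_combination hexp
  rw [e1, e2, mul_div_assoc (_ * t') (x - y), e3]
  field_simp
  ring

lemma hasDerivAt_rootEnergy (k : ℕ) (hk : 1 ≤ k) (hβ : 0 < β) (hB : 0 < B) :
    HasDerivAt (fun β => rootEnergy (k + 1) (tanh β) (root k (tanh β) B))
      (rootSpecificHeat (k + 1) k (tanh β) (root k (tanh β) B)) β := by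
  have hr : (1 : ℝ) ≤ k := by exact_mod_cast hk
  have hT0 := tanh_pos hβ
  have hT1 := tanh_lt_one β
  have hroot := isRoot_root hT0 hT1 hr hB.le
  have ht := hasDerivAt_root_tanh hr hβ hB
  have hTd := hasDerivAt_tanh β
  have hN := (stiffness_root_pos hT0 hT1 hr hB.le (.inl hB)).ne'
  have htnn := hroot.nonneg
  have hden : 0 < tanh β + root k (tanh β) B ^ 2 := by positivity
  have h1 := (((ht.fun_pow 2).add (hTd.fun_pow 3)).div (hTd.mul (hTd.add (ht.fun_pow 2)))
    (by simp only [Pi.mul_apply, Pi.add_apply]; positivity)).const_mul (((k + 1 : ℕ) : ℝ) / 2)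
  refine h1.congr_deriv ?_
  simp only [Pi.mul_apply, Pi.add_apply, rootSpecificHeat]
  generalize stiffness k (tanh β) (root k (tanh β) B) = N at hN ⊢
  generalize tanh β = T at *
  generalize root k T B = t at *
  push_cast
  field_simp
  ring

lemma pressure_eq (j : ℕ) (hβ : 0 < β) (hB : 0 < B) :
    pressure (j + 2) β B = rootPressure (j + 2) β B (root ((j + 1 : ℕ) : ℝ) (tanh β) B) :=
  (tendsto_of_pos j hβ hB).1.limUnder_eq

lemma magnetization_eq (j : ℕ) (hβ : 0 < β) (hB : 0 < B) :
    magnetization (j + 2) β B =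
      rootMagnetization (tanh β) (root ((j + 1 : ℕ) : ℝ) (tanh β) B) :=
  (tendsto_of_pos j hβ hB).2.1.limUnder_eq

lemma susceptibility_eq (j : ℕ) (hβ : 0 < β) (hB : 0 < B) :
    susceptibility (j + 2) β B = rootSusceptibility ((j + 1 : ℕ) : ℝ) (tanh β)
      (root ((j + 1 : ℕ) : ℝ) (tanh β) B) :=
  (tendsto_of_pos j hβ hB).2.2.limUnder_eq

lemma hasDerivAt_pressure (j : ℕ) (hβ : 0 < β) (hB : 0 < B) :
    HasDerivAt (fun b => pressure (j + 2) b B)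
      (rootEnergy (j + 2) (tanh β) (root ((j + 1 : ℕ) : ℝ) (tanh β) B)) β := by
  refine (hasDerivAt_rootPressure (j + 1) (by omega) hβ hB).congr_of_eventuallyEq ?_
  filter_upwards [lt_mem_nhds hβ] with b hb
  exact pressure_eq j hb hB

lemma hasDerivAt_deriv_pressure (j : ℕ) (hβ : 0 < β) (hB : 0 < B) :
    HasDerivAt (deriv fun b => pressure (j + 2) b B)
      (rootSpecificHeat (j + 2) ((j + 1 : ℕ) : ℝ) (tanh β)
        (root ((j + 1 : ℕ) : ℝ) (tanh β) B)) β := by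
  refine (hasDerivAt_rootEnergy (j + 1) (by omega) hβ hB).congr_of_eventuallyEq ?_
  filter_upwards [lt_mem_nhds hβ] with b hb
  exact (hasDerivAt_pressure j hb hB).deriv

lemma specificHeat_eq (j : ℕ) (hβ : 0 < β) (hB : 0 < B) :
    specificHeat (j + 2) β B = rootSpecificHeat (j + 2) ((j + 1 : ℕ) : ℝ) (tanh β)
      (root ((j + 1 : ℕ) : ℝ) (tanh β) B) :=
  (hasDerivAt_deriv_pressure j hβ hB).deriv

section ZeroField

variable (j)

lemma tendsto_magnetization_zero_field (hβ : 0 < β) :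
    Tendsto (fun B => magnetization (j + 2) β B) (𝓝[>] 0)
      (𝓝 (rootMagnetization (tanh β) (root ((j + 1 : ℕ) : ℝ) (tanh β) 0))) := by
  have hr : (1 : ℝ) ≤ ((j + 1 : ℕ) : ℝ) := by exact_mod_cast Nat.succ_pos j
  have hT0 := tanh_pos hβ
  have h := tendsto_root_zero_field hT0 (tanh_lt_one β) hr
  have hc : ContinuousAt (rootMagnetization (tanh β)) (root ((j + 1 : ℕ) : ℝ) (tanh β) 0) := by
    unfold rootMagnetization
    exact ContinuousAt.div (by fun_prop) (by fun_prop) (by positivity)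
  refine (hc.tendsto.comp h).congr' ?_
  filter_upwards [self_mem_nhdsWithin] with B hB
  exact (magnetization_eq j hβ hB).symm

lemma tendsto_susceptibility_zero_field (hβ : 0 < β)
    (hne : ((j + 1 : ℕ) : ℝ) * tanh β ≠ 1) :
    Tendsto (fun B => susceptibility (j + 2) β B) (𝓝[>] 0)
      (𝓝 (rootSusceptibility ((j + 1 : ℕ) : ℝ) (tanh β)
        (root ((j + 1 : ℕ) : ℝ) (tanh β) 0))) := by
  have hr : (1 : ℝ) ≤ ((j + 1 : ℕ) : ℝ) := by exact_mod_cast Nat.succ_pos j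
  have hT0 := tanh_pos hβ
  have h := tendsto_root_zero_field hT0 (tanh_lt_one β) hr
  have hN := stiffness_root_pos hT0 (tanh_lt_one β) hr le_rfl (.inr hne)
  have hc : ContinuousAt (rootSusceptibility ((j + 1 : ℕ) : ℝ) (tanh β))
      (root ((j + 1 : ℕ) : ℝ) (tanh β) 0) := by
    unfold rootSusceptibility
    refine ContinuousAt.div (by fun_prop) ?_ (by positivity)
    unfold stiffness
    fun_prop
  refine (hc.tendsto.comp h).congr' ?_
  filter_upwards [self_mem_nhdsWithin] with B hB
  exact (susceptibility_eq j hβ hB).symm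

lemma tendsto_specificHeat_zero_field (hβ : 0 < β)
    (hne : ((j + 1 : ℕ) : ℝ) * tanh β ≠ 1) :
    Tendsto (fun B => specificHeat (j + 2) β B) (𝓝[>] 0)
      (𝓝 (rootSpecificHeat (j + 2) ((j + 1 : ℕ) : ℝ) (tanh β)
        (root ((j + 1 : ℕ) : ℝ) (tanh β) 0))) := by
  have hr : (1 : ℝ) ≤ ((j + 1 : ℕ) : ℝ) := by exact_mod_cast Nat.succ_pos j
  have hT0 := tanh_pos hβ
  have h := tendsto_root_zero_field hT0 (tanh_lt_one β) hr
  have hN := stiffness_root_pos hT0 (tanh_lt_one β) hr le_rfl (.inr hne)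
  have hc : ContinuousAt (rootSpecificHeat (j + 2) ((j + 1 : ℕ) : ℝ) (tanh β))
      (root ((j + 1 : ℕ) : ℝ) (tanh β) 0) := by
    have hs : ContinuousAt (stiffness ((j + 1 : ℕ) : ℝ) (tanh β))
        (root ((j + 1 : ℕ) : ℝ) (tanh β) 0) := by
      unfold stiffness
      fun_prop
    unfold rootSpecificHeat
    refine continuousAt_const.mul ((continuousAt_const.mul (ContinuousAt.div (by fun_prop)
      (by fun_prop) (by positivity))).add ((ContinuousAt.div (by fun_prop) (by fun_prop)
      (by positivity)).mul (ContinuousAt.div (by fun_prop) hs hN.ne')))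
  refine (hc.tendsto.comp h).congr' ?_
  filter_upwards [self_mem_nhdsWithin] with B hB
  exact (specificHeat_eq j hβ hB).symm

lemma spontMagnetization_eq (hβ : 0 < β) : spontMagnetization (j + 2) β =
    rootMagnetization (tanh β) (root ((j + 1 : ℕ) : ℝ) (tanh β) 0) :=
  (tendsto_magnetization_zero_field j hβ).limUnder_eq

lemma zeroFieldSusceptibility_eq (hβ : 0 < β) (hne : ((j + 1 : ℕ) : ℝ) * tanh β ≠ 1) :
    zeroFieldSusceptibility (j + 2) β = rootSusceptibility ((j + 1 : ℕ) : ℝ) (tanh β)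
      (root ((j + 1 : ℕ) : ℝ) (tanh β) 0) :=
  (tendsto_susceptibility_zero_field j hβ hne).limUnder_eq

lemma zeroFieldSpecificHeat_eq (hβ : 0 < β) (hne : ((j + 1 : ℕ) : ℝ) * tanh β ≠ 1) :
    zeroFieldSpecificHeat (j + 2) β = rootSpecificHeat (j + 2) ((j + 1 : ℕ) : ℝ) (tanh β)
      (root ((j + 1 : ℕ) : ℝ) (tanh β) 0) :=
  (tendsto_specificHeat_zero_field j hβ hne).limUnder_eq

lemma tendsto_magnetization_zero_field_of_zero (d : ℕ) :
    Tendsto (fun B => magnetization d 0 B) (𝓝[>] 0) (𝓝 0) := by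
  have h : (fun B => magnetization d 0 B) = tanh :=
    funext fun B => (tendsto_of_zero d B).2.1.limUnder_eq
  have h0 := (hasDerivAt_tanh 0).continuousAt.tendsto
  rw [tanh_zero] at h0
  rw [h]
  exact h0.mono_left nhdsWithin_le_nhds

variable {j}

lemma one_lt_mul_tanh_iff (hj : 1 ≤ j) :
    1 < ((j + 1 : ℕ) : ℝ) * tanh β ↔ artanh (1 / ((j + 1 : ℕ) : ℝ)) < β := by
  have hr : (1 : ℝ) < ((j + 1 : ℕ) : ℝ) := by exact_mod_cast Nat.lt_succ_of_le hj
  have hmem : 1 / ((j + 1 : ℕ) : ℝ) ∈ Ioo (-1 : ℝ) 1 := by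
    have h0 : 0 < 1 / ((j + 1 : ℕ) : ℝ) := by positivity
    refine ⟨by linarith, ?_⟩
    rw [div_lt_one (by linarith)]
    exact hr
  rw [← tanh_strictMono.lt_iff_lt (a := artanh _), tanh_artanh hmem, div_lt_iff₀ (by linarith), mul_comm]

lemma orderedPhase_eq (hj : 1 ≤ j) :
    orderedPhase (j + 2) = Ioi (artanh (1 / ((j + 1 : ℕ) : ℝ))) := by
  have hr : (1 : ℝ) < ((j + 1 : ℕ) : ℝ) := by exact_mod_cast Nat.lt_succ_of_le hj
  have hpos : 0 < artanh (1 / ((j + 1 : ℕ) : ℝ)) := by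
    refine artanh_pos ⟨by positivity, ?_⟩
    rw [div_lt_one (by linarith)]
    exact hr
  ext β
  rw [mem_Ioi, ← one_lt_mul_tanh_iff hj]
  constructor
  · rintro ⟨hβ, hM⟩
    by_contra! hle
    rw [spontMagnetization_eq j hβ, root_zero_eq_zero (tanh_pos hβ) (tanh_lt_one β) hr.le hle]
      at hM
    simp [rootMagnetization] at hM
  · intro h
    have hβ : 0 < β := hpos.trans ((one_lt_mul_tanh_iff hj).1 h)
    have hT := tanh_pos hβ
    have h0 := root_zero_pos hT (tanh_lt_one β) hr.le h
    refine ⟨hβ, ?_⟩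
    rw [spontMagnetization_eq j hβ, rootMagnetization]
    positivity

lemma criticalBeta_eq (hj : 1 ≤ j) :
    criticalBeta (j + 2) = artanh (1 / ((j + 1 : ℕ) : ℝ)) := by
  rw [criticalBeta, orderedPhase_eq hj, csInf_Ioi]

lemma tanh_criticalBeta (hj : 1 ≤ j) :
    tanh (criticalBeta (j + 2)) = 1 / ((j + 1 : ℕ) : ℝ) := by
  have hr : (1 : ℝ) < ((j + 1 : ℕ) : ℝ) := by exact_mod_cast Nat.lt_succ_of_le hj
  rw [criticalBeta_eq hj, tanh_artanh]
  have h0 : 0 < 1 / ((j + 1 : ℕ) : ℝ) := by positivity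
  refine ⟨by linarith, ?_⟩
  rw [div_lt_one (by linarith)]
  exact hr

lemma criticalBeta_pos (hj : 1 ≤ j) : 0 < criticalBeta (j + 2) := by
  rw [← tanh_strictMono.lt_iff_lt, tanh_criticalBeta hj, tanh_zero]
  positivity

end ZeroField

end LimitingFunctions

/-! ### Critical behaviour of the solution of the mean-field equation -/

section CriticalBehaviour

open Real Set

/-- If `f / x ^ a₀` has a positive limit as `x → 0⁺`, then `a₀` is the unique exponent with
`f ≍ x ^ a`. -/
lemma asymp_rpow_iff {l : Filter ℝ} [l.NeBot] {f x : ℝ → ℝ} {a₀ L : ℝ}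
    (hx : Tendsto x l (𝓝[>] 0)) (hL : 0 < L)
    (hf : Tendsto (fun y => f y / x y ^ a₀) l (𝓝 L)) (a : ℝ) :
    Asymp l f (fun y => x y ^ a) ↔ a = a₀ := by
  have hx0 : Tendsto x l (𝓝 0) := hx.mono_right nhdsWithin_le_nhds
  have hpos : ∀ᶠ y in l, 0 < x y := hx.eventually self_mem_nhdsWithin
  constructor
  · rintro ⟨c, C, hc, h⟩
    have hsplit : ∀ᶠ y in l, f y / x y ^ a = f y / x y ^ a₀ * x y ^ (a₀ - a) := by
      filter_upwards [hpos] with y hy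
      rw [rpow_sub hy]
      have h1 := (rpow_pos_of_pos hy a₀).ne'
      have h2 := (rpow_pos_of_pos hy a).ne'
      field_simp
    rcases lt_trichotomy a a₀ with hlt | heq | hgt
    · exfalso
      have h1 : Tendsto (fun y => x y ^ (a₀ - a)) l (𝓝 0) := by
        have h2 := (continuousAt_rpow_const 0 (a₀ - a) (Or.inr (by linarith))).tendsto.comp hx0
        rwa [zero_rpow (by linarith)] at h2
      have h3 := hf.mul h1
      rw [mul_zero] at h3
      obtain ⟨y, ⟨h4, -⟩, h5, h6⟩ := (h.and (hsplit.and (h3.eventually_lt_const hc))).exists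
      rw [h5] at h4
      linarith
    · exact heq
    · exfalso
      have h1 : Tendsto (fun y => x y ^ (a - a₀)) l (𝓝 0) := by
        have h2 := (continuousAt_rpow_const 0 (a - a₀) (Or.inr (by linarith))).tendsto.comp hx0
        rwa [zero_rpow (by linarith)] at h2
      -- `f / x ^ a ≤ C` makes `f / x ^ a₀` at most `C * x ^ (a - a₀)`, which tends to `0`
      have h3 := h1.const_mul C
      rw [mul_zero] at h3
      have h4 : L ≤ 0 := by
        refine le_of_tendsto_of_tendsto hf h3 ?_
        filter_upwards [h, hpos, hsplit] with y hy hy0 hs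
        rw [hs] at hy
        have e : f y / x y ^ a₀ = f y / x y ^ a₀ * x y ^ (a₀ - a) * x y ^ (a - a₀) := by
          rw [mul_assoc, ← rpow_add hy0]
          simp
        rw [e]
        exact mul_le_mul_of_nonneg_right hy.2 (rpow_nonneg hy0.le _)
      linarith
  · rintro rfl
    refine ⟨L / 2, 2 * L, by linarith, ?_⟩
    filter_upwards [hf.eventually (Icc_mem_nhds (show L / 2 < L by linarith)
      (show L < 2 * L by linarith))] with y hy
    exact hy

variable {r T t B : ℝ}

/-- The weight in the derivative of `fieldOf r T`: that derivative is
`stiffness r T t * fieldWeight T t`. -/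
noncomputable def fieldWeight (T t : ℝ) : ℝ := 1 / ((T ^ 2 - t ^ 2) * (1 - t ^ 2))

lemma fieldWeight_pos (hT1 : T < 1) (ht : 0 ≤ t) (htT : t < T) : 0 < fieldWeight T t := by
  have h4 : 0 < T ^ 2 - t ^ 2 := by nlinarith
  have h5 : 0 < 1 - t ^ 2 := by nlinarith
  unfold fieldWeight
  positivity

lemma fieldWeight_mono (hT1 : T < 1) {s : ℝ} (hs : 0 ≤ s) (hst : s ≤ t) (htT : t < T) :
    fieldWeight T s ≤ fieldWeight T t := by
  have h4 : 0 < T ^ 2 - t ^ 2 := by nlinarith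
  have h5 : 0 < 1 - t ^ 2 := by nlinarith
  have h6 : s ^ 2 ≤ t ^ 2 := by nlinarith
  unfold fieldWeight
  refine one_div_le_one_div_of_le (by positivity) ?_
  exact mul_le_mul (by linarith) (by linarith) h5.le (by linarith)

lemma cubic_le_fieldOf (hT : 0 < T) (hT1 : T < 1) (ht : 0 ≤ t) (htT : t < T) {A C : ℝ}
    (h : ∀ s, 0 < s → s < t → 3 * A * s ^ 2 + C ≤ stiffness r T s * fieldWeight T s) :
    A * t ^ 3 + C * t ≤ fieldOf r T t := by
  have hmono : MonotoneOn (fun s => fieldOf r T s - (A * s ^ 3 + C * s)) (Icc 0 t) := by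
    refine monotoneOn_of_hasDerivWithinAt_nonneg (convex_Icc _ _)
      (f' := fun s => stiffness r T s * fieldWeight T s - (3 * A * s ^ 2 + C))
      (((continuousOn_fieldOf hT hT1).mono (Icc_subset_Ico_right htT)).sub (by fun_prop)) ?_ ?_
    · intro s hs
      rw [interior_Icc] at hs
      have h1 := hasDerivAt_fieldOf (r := r) hT hT1 (t := s)
        ⟨by linarith [hs.1], by linarith [hs.2]⟩
      have h2 := (((hasDerivAt_id s).fun_pow 3).const_mul A).add ((hasDerivAt_id s).const_mul C)
      refine ((h1.sub h2).congr_deriv ?_).hasDerivWithinAt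
      simp only [fieldWeight, id]
      push_cast
      ring
    · intro s hs
      rw [interior_Icc] at hs
      linarith [h s hs.1 hs.2]
  have := hmono (left_mem_Icc.2 ht) (right_mem_Icc.2 ht) ht
  simp only [fieldOf_zero] at this
  linarith

lemma fieldOf_le_cubic (hT : 0 < T) (hT1 : T < 1) (ht : 0 ≤ t) (htT : t < T) {A C : ℝ}
    (h : ∀ s, 0 < s → s < t → stiffness r T s * fieldWeight T s ≤ 3 * A * s ^ 2 + C) :
    fieldOf r T t ≤ A * t ^ 3 + C * t := by
  have hmono : MonotoneOn (fun s => (A * s ^ 3 + C * s) - fieldOf r T s) (Icc 0 t) := by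
    refine monotoneOn_of_hasDerivWithinAt_nonneg (convex_Icc _ _)
      (f' := fun s => (3 * A * s ^ 2 + C) - stiffness r T s * fieldWeight T s)
      (ContinuousOn.sub (by fun_prop)
        ((continuousOn_fieldOf hT hT1).mono (Icc_subset_Ico_right htT))) ?_ ?_
    · intro s hs
      rw [interior_Icc] at hs
      have h1 := hasDerivAt_fieldOf (r := r) hT hT1 (t := s)
        ⟨by linarith [hs.1], by linarith [hs.2]⟩
      have h2 := (((hasDerivAt_id s).fun_pow 3).const_mul A).add ((hasDerivAt_id s).const_mul C)
      refine ((h2.sub h1).congr_deriv ?_).hasDerivWithinAt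
      simp only [fieldWeight, id]
      push_cast
      ring
    · intro s hs
      rw [interior_Icc] at hs
      linarith [h s hs.1 hs.2]
  have := hmono (left_mem_Icc.2 ht) (right_mem_Icc.2 ht) ht
  simp only [fieldOf_zero] at this
  linarith

/-- The distance `T (r T - 1)` of the coupling from the critical one; it is `-stiffness r T 0`. -/
def excess (r T : ℝ) : ℝ := T * (r * T - 1)

lemma stiffness_eq (r T t : ℝ) : stiffness r T t = (r - T) * t ^ 2 - excess r T := by
  simp only [stiffness, excess]
  ring

lemma excess_pos (hT : 0 < T) (hrT : 1 < r * T) : 0 < excess r T :=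
  mul_pos hT (by linarith)

/-- The upper bound on the spontaneous solution: the stiffness and the weight both increase, so
the unweighted integral of the stiffness up to the solution is nonpositive. -/
lemma sq_root_zero_le (hT : 0 < T) (hT1 : T < 1) (hr : 1 ≤ r) (hrT : 1 < r * T) :
    root r T 0 ^ 2 ≤ 3 * excess r T / (r - T) := by
  have hroot := isRoot_root hT hT1 hr (le_refl (0 : ℝ))
  have ht := root_zero_pos hT hT1 hr hrT
  set t := root r T 0
  have hk : 0 < r - T := by linarith
  have he := excess_pos hT hrT
  -- the zero of the stiffness
  set s₁ := √(excess r T / (r - T)) with hs₁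
  have hs₁0 : 0 ≤ s₁ := sqrt_nonneg _
  have hs₁2 : s₁ ^ 2 = excess r T / (r - T) := sq_sqrt (by positivity)
  have hst : ∀ s, stiffness r T s = (r - T) * (s ^ 2 - s₁ ^ 2) := by
    intro s
    rw [stiffness_eq, hs₁2]
    field_simp
  have hs₁t : s₁ ≤ t := by
    have h1 := hroot.stable
    rw [hst] at h1
    have h2 := nonneg_of_mul_nonneg_right h1 hk
    exact (sq_le_sq₀ hs₁0 hroot.nonneg).1 (by linarith)
  set w := fieldWeight T s₁
  have hw : 0 < w := fieldWeight_pos hT1 hs₁0 (hs₁t.trans_lt hroot.lt)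
  have h := cubic_le_fieldOf (r := r) (A := w * (r - T) / 3) (C := -(w * excess r T)) hT hT1
    hroot.nonneg hroot.lt (fun s hs0 hst' => by
      have e : 3 * (w * (r - T) / 3) * s ^ 2 + -(w * excess r T) = stiffness r T s * w := by
        rw [stiffness_eq]; ring
      rw [e]
      rcases le_total s s₁ with h1 | h1
      · have h2 := fieldWeight_mono hT1 hs0.le h1 (hs₁t.trans_lt hroot.lt)
        have h3 : stiffness r T s ≤ 0 := by
          rw [hst]
          have : s ^ 2 ≤ s₁ ^ 2 := by nlinarith
          nlinarith
        nlinarith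
      · have h2 := fieldWeight_mono hT1 hs₁0 h1 (hst'.trans hroot.lt)
        have h3 : 0 ≤ stiffness r T s := by
          rw [hst]
          have : s₁ ^ 2 ≤ s ^ 2 := by nlinarith
          nlinarith
        nlinarith)
  rw [hroot.eq] at h
  have h4 : (w * t) * ((r - T) * t ^ 2 - 3 * excess r T) ≤ 0 := by linarith
  have h5 : (r - T) * t ^ 2 - 3 * excess r T ≤ 0 := by
    by_contra! hpos
    have : 0 < (w * t) * ((r - T) * t ^ 2 - 3 * excess r T) := by positivity
    linarith
  rw [le_div_iff₀ hk]
  linarith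

lemma le_sq_root_zero (hT : 0 < T) (hT1 : T < 1) (hr : 1 ≤ r) (hrT : 1 < r * T) :
    3 * excess r T / (r - T) * ((T ^ 2 - root r T 0 ^ 2) * (1 - root r T 0 ^ 2) / T ^ 2) ≤
      root r T 0 ^ 2 := by
  have hroot := isRoot_root hT hT1 hr (le_refl (0 : ℝ))
  have ht := root_zero_pos hT hT1 hr hrT
  set t := root r T 0
  have hk : 0 < r - T := by linarith
  have he := excess_pos hT hrT
  have htT := hroot.lt
  have hw : fieldWeight T t = 1 / ((T ^ 2 - t ^ 2) * (1 - t ^ 2)) := rfl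
  have hw0 : fieldWeight T 0 = 1 / T ^ 2 := by simp [fieldWeight]
  have h4 : 0 < T ^ 2 - t ^ 2 := by nlinarith
  have h5 : 0 < 1 - t ^ 2 := by nlinarith
  have h := fieldOf_le_cubic (r := r) (A := fieldWeight T t * (r - T) / 3)
    (C := -(fieldWeight T 0 * excess r T)) hT hT1 hroot.nonneg hroot.lt (fun s hs0 hst => by
      have h1 := fieldWeight_mono hT1 hs0.le hst.le hroot.lt
      have h2 := fieldWeight_mono hT1 le_rfl hs0.le (hst.trans hroot.lt)
      rw [stiffness_eq]
      have h3 : 0 ≤ (r - T) * s ^ 2 := by positivity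
      nlinarith)
  rw [hroot.eq, hw, hw0] at h
  have h6 : 0 ≤ t * (1 / ((T ^ 2 - t ^ 2) * (1 - t ^ 2)) * (r - T) / 3 * t ^ 2 -
      1 / T ^ 2 * excess r T) := by linarith
  have h7 := nonneg_of_mul_nonneg_right h6 ht
  have h8 : 1 / T ^ 2 * excess r T ≤
      1 / ((T ^ 2 - t ^ 2) * (1 - t ^ 2)) * (r - T) / 3 * t ^ 2 := by linarith
  have h9 : 0 < (T ^ 2 - t ^ 2) * (1 - t ^ 2) * 3 / (r - T) := by positivity
  have h10 := mul_le_mul_of_nonneg_left h8 h9.le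
  calc _ = (T ^ 2 - t ^ 2) * (1 - t ^ 2) * 3 / (r - T) * (1 / T ^ 2 * excess r T) := by ring
    _ ≤ _ := h10
    _ = t ^ 2 := by field_simp

section Limits

variable (hr : 1 < r)

include hr

lemma tendsto_excess (l : Filter ℝ) (hl : l ≤ 𝓝 (1 / r)) :
    Tendsto (excess r) l (𝓝 0) := by
  have h : ContinuousAt (excess r) (1 / r) := by unfold excess; fun_prop
  have h1 := h.tendsto.mono_left hl
  have e : excess r (1 / r) = 0 := by
    have : r ≠ 0 := by linarith
    rw [excess, mul_one_div_cancel this]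
    simp
  rwa [e] at h1

lemma eventually_supercritical :
    ∀ᶠ T in 𝓝[>] (1 / r), 0 < T ∧ T < 1 ∧ 1 < r * T := by
  have h0 : 0 < 1 / r := by positivity
  have h1 : 1 / r < 1 := by rw [div_lt_one (by linarith)]; exact hr
  filter_upwards [Ioo_mem_nhdsGT h1] with T hT
  refine ⟨h0.trans hT.1, hT.2, ?_⟩
  have := hT.1
  rw [div_lt_iff₀ (by linarith)] at this
  linarith

lemma tendsto_sq_root_zero :
    Tendsto (fun T => root r T 0 ^ 2) (𝓝[>] (1 / r)) (𝓝 0) := by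
  have h1 : 1 / r < 1 := by rw [div_lt_one (by linarith)]; exact hr
  have hid : Tendsto (fun T : ℝ => T) (𝓝[>] (1 / r)) (𝓝 (1 / r)) := nhdsWithin_le_nhds
  have h2 := ((tendsto_excess hr _ nhdsWithin_le_nhds).const_mul 3).div (hid.const_sub r)
    (by linarith : r - 1 / r ≠ 0)
  rw [mul_zero, zero_div] at h2
  refine squeeze_zero' (.of_forall fun T => sq_nonneg _) ?_ h2
  filter_upwards [eventually_supercritical hr] with T hT
  exact sq_root_zero_le hT.1 hT.2.1 hr.le hT.2.2

/-- The square-root singularity of the spontaneous solution. -/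
lemma tendsto_sq_root_zero_div_excess :
    Tendsto (fun T => root r T 0 ^ 2 / excess r T) (𝓝[>] (1 / r)) (𝓝 (3 / (r - 1 / r))) := by
  have h1 : 1 / r < 1 := by rw [div_lt_one (by linarith)]; exact hr
  have h0 : 0 < 1 / r := by positivity
  have hid : Tendsto (fun T : ℝ => T) (𝓝[>] (1 / r)) (𝓝 (1 / r)) := nhdsWithin_le_nhds
  have hs := tendsto_sq_root_zero hr
  have hup : Tendsto (fun T => 3 / (r - T)) (𝓝[>] (1 / r)) (𝓝 (3 / (r - 1 / r))) :=
    tendsto_const_nhds.div (hid.const_sub r) (by linarith)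
  have hlow := hup.mul ((((hid.pow 2).sub hs).mul (hs.const_sub 1)).div (hid.pow 2) (by positivity))
  have e : 3 / (r - 1 / r) * (((1 / r) ^ 2 - 0) * (1 - 0) / (1 / r) ^ 2) = 3 / (r - 1 / r) := by
    have : r ≠ 0 := by linarith
    simp [this]
  rw [e] at hlow
  refine tendsto_of_tendsto_of_tendsto_of_le_of_le' hlow hup ?_ ?_
  · filter_upwards [eventually_supercritical hr] with T hT
    have he := excess_pos hT.1 hT.2.2
    have h := le_sq_root_zero hT.1 hT.2.1 hr.le hT.2.2
    rw [le_div_iff₀ he]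
    refine le_trans (le_of_eq ?_) h
    simp only [Pi.div_apply]
    ring
  · filter_upwards [eventually_supercritical hr] with T hT
    have he := excess_pos hT.1 hT.2.2
    have h := sq_root_zero_le hT.1 hT.2.1 hr.le hT.2.2
    rw [div_le_iff₀ he]
    refine h.trans (le_of_eq ?_)
    ring

lemma tendsto_stiffness_div_excess :
    Tendsto (fun T => stiffness r T (root r T 0) / excess r T) (𝓝[>] (1 / r)) (𝓝 2) := by
  have h1 : 1 / r < 1 := by rw [div_lt_one (by linarith)]; exact hr
  have hid : Tendsto (fun T : ℝ => T) (𝓝[>] (1 / r)) (𝓝 (1 / r)) := nhdsWithin_le_nhds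
  have h2 := ((hid.const_sub r).mul (tendsto_sq_root_zero_div_excess hr)).sub_const 1
  have e : (r - 1 / r) * (3 / (r - 1 / r)) - 1 = 2 := by
    rw [mul_div_cancel₀ _ (by linarith : r - 1 / r ≠ 0)]
    norm_num
  rw [e] at h2
  refine h2.congr' ?_
  filter_upwards [eventually_supercritical hr] with T hT
  have he := (excess_pos hT.1 hT.2.2).ne'
  rw [stiffness_eq]
  field_simp

lemma tendsto_sq_rootMagnetization_div_excess :
    ∃ L, 0 < L ∧ Tendsto (fun T => rootMagnetization T (root r T 0) ^ 2 / excess r T)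
      (𝓝[>] (1 / r)) (𝓝 L) := by
  have h1 : 1 / r < 1 := by rw [div_lt_one (by linarith)]; exact hr
  have h0 : 0 < 1 / r := by positivity
  have hid : Tendsto (fun T : ℝ => T) (𝓝[>] (1 / r)) (𝓝 (1 / r)) := nhdsWithin_le_nhds
  have h2 := (tendsto_sq_root_zero_div_excess hr).mul
    (((hid.const_add 1).div (hid.add (tendsto_sq_root_zero hr)) (by linarith)).pow 2)
  refine ⟨_, ?_, h2.congr fun T => ?_⟩
  · have h3 : 0 < r - 1 / r := by linarith
    positivity
  · simp only [Pi.div_apply, rootMagnetization]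
    ring

lemma tendsto_rootSusceptibility_mul_excess :
    ∃ L, 0 < L ∧ Tendsto (fun T => rootSusceptibility r T (root r T 0) * excess r T)
      (𝓝[>] (1 / r)) (𝓝 L) := by
  have h1 : 1 / r < 1 := by rw [div_lt_one (by linarith)]; exact hr
  have h0 : 0 < 1 / r := by positivity
  have hid : Tendsto (fun T : ℝ => T) (𝓝[>] (1 / r)) (𝓝 (1 / r)) := nhdsWithin_le_nhds
  have hs := tendsto_sq_root_zero hr
  have h2 := (((((hid.const_add 1).mul (hid.sub hs)).mul ((hid.pow 2).sub hs)).mul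
    (hs.const_sub 1)).div ((hid.add hs).pow 2) (by positivity)).div
      (tendsto_stiffness_div_excess hr) two_ne_zero
  refine ⟨_, ?_, h2.congr fun T => ?_⟩
  · simp only [sub_zero, add_zero, mul_one]
    positivity
  · simp only [Pi.div_apply, rootSusceptibility]
    field_simp

lemma tendsto_rootSpecificHeat_above {d : ℕ} (hd : 0 < d) :
    ∃ L, 0 < L ∧ Tendsto (fun T => rootSpecificHeat d r T (root r T 0))
      (𝓝[>] (1 / r)) (𝓝 L) := by
  have h1 : 1 / r < 1 := by rw [div_lt_one (by linarith)]; exact hr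
  have h0 : 0 < 1 / r := by positivity
  have hid : Tendsto (fun T : ℝ => T) (𝓝[>] (1 / r)) (𝓝 (1 / r)) := nhdsWithin_le_nhds
  have hs := tendsto_sq_root_zero hr
  have hden := (hid.add hs).pow 2
  have ha := (((((hid.pow 4).add (((hid.pow 3).const_mul 2).mul hs)).sub
    ((hid.const_mul 2).mul hs)).sub (hs.pow 2)).div ((hid.pow 2).mul hden)
      (by positivity)).const_mul ((d : ℝ) / 2)
  have hb := ((((hid.pow 2).const_sub 1).const_mul (d : ℝ)).mul (hs.const_sub 1)).div hden
    (by positivity)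
  have hc := (tendsto_sq_root_zero_div_excess hr).div (tendsto_stiffness_div_excess hr) two_ne_zero
  have h2 := ((hid.pow 2).const_sub 1).mul (ha.add (hb.mul hc))
  refine ⟨_, ?_, h2.congr' ?_⟩
  · have h3 : 0 < r - 1 / r := by linarith
    have h4 : 0 < 1 - (1 / r) ^ 2 := by nlinarith
    have h5 : (0 : ℝ) < d := by exact_mod_cast hd
    simp only [sub_zero, add_zero, mul_one, mul_zero, ne_eq, OfNat.ofNat_ne_zero,
      not_false_eq_true, zero_pow]
    positivity
  · filter_upwards [eventually_supercritical hr] with T hT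
    have he := (excess_pos hT.1 hT.2.2).ne'
    simp only [Pi.div_apply, rootSpecificHeat]
    rw [div_div_div_cancel_right₀ he]
    ring

lemma eventually_subcritical :
    ∀ᶠ T in 𝓝[<] (1 / r), 0 < T ∧ T < 1 ∧ r * T < 1 := by
  have h0 : 0 < 1 / r := by positivity
  have h1 : 1 / r < 1 := by rw [div_lt_one (by linarith)]; exact hr
  filter_upwards [Ioo_mem_nhdsLT h0] with T hT
  refine ⟨hT.1, hT.2.trans h1, ?_⟩
  have := hT.2
  rw [lt_div_iff₀ (by linarith)] at this
  linarith

lemma tendsto_rootSusceptibility_mul_neg_excess :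
    ∃ L, 0 < L ∧ Tendsto (fun T => rootSusceptibility r T (root r T 0) * -excess r T)
      (𝓝[<] (1 / r)) (𝓝 L) := by
  have h0 : 0 < 1 / r := by positivity
  have hid : Tendsto (fun T : ℝ => T) (𝓝[<] (1 / r)) (𝓝 (1 / r)) := nhdsWithin_le_nhds
  refine ⟨_, ?_, ((hid.const_add 1).mul hid).congr' ?_⟩
  · positivity
  · filter_upwards [eventually_subcritical hr] with T hT
    have he : -excess r T ≠ 0 := by
      have h1 := mul_pos hT.1 (by linarith [hT.2.2] : 0 < 1 - r * T)
      simp only [excess]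
      nlinarith
    have hT0 := hT.1.ne'
    rw [root_zero_eq_zero hT.1 hT.2.1 hr.le hT.2.2.le, rootSusceptibility, stiffness_eq]
    generalize excess r T = e at he ⊢
    have he' : e ≠ 0 := by simpa using he
    field_simp
    ring_nf
    field_simp

lemma tendsto_rootSpecificHeat_below {d : ℕ} (hd : 0 < d) :
    ∃ L, 0 < L ∧ Tendsto (fun T => rootSpecificHeat d r T (root r T 0))
      (𝓝[<] (1 / r)) (𝓝 L) := by
  have h0 : 0 < 1 / r := by positivity
  have h1 : 1 / r < 1 := by rw [div_lt_one (by linarith)]; exact hr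
  have hid : Tendsto (fun T : ℝ => T) (𝓝[<] (1 / r)) (𝓝 (1 / r)) := nhdsWithin_le_nhds
  refine ⟨_, ?_, (((hid.pow 2).const_sub 1).mul_const ((d : ℝ) / 2)).congr' ?_⟩
  · have h4 : 0 < 1 - (1 / r) ^ 2 := by nlinarith
    have h5 : (0 : ℝ) < d := by exact_mod_cast hd
    positivity
  · filter_upwards [eventually_subcritical hr] with T hT
    have hT0 := hT.1.ne'
    rw [root_zero_eq_zero hT.1 hT.2.1 hr.le hT.2.2.le, rootSpecificHeat]
    simp only [ne_eq, OfNat.ofNat_ne_zero, not_false_eq_true, zero_pow, zero_div, mul_zero,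
      add_zero, sub_zero]
    field_simp

/-- On the critical isotherm the field is cubic in the solution of the mean-field equation. -/
lemma tendsto_cube_rootMagnetization_div :
    ∃ L, 0 < L ∧ Tendsto (fun B => rootMagnetization (1 / r) (root r (1 / r) B) ^ 3 / B)
      (𝓝[>] 0) (𝓝 L) := by
  have h0 : 0 < 1 / r := by positivity
  have h1 : 1 / r < 1 := by rw [div_lt_one (by linarith)]; exact hr
  have hrc : r * (1 / r) = 1 := mul_one_div_cancel (by linarith)
  have ht := tendsto_root_zero_field h0 h1 hr.le
  rw [root_zero_eq_zero h0 h1 hr.le hrc.le] at ht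
  have hexc : excess r (1 / r) = 0 := by rw [excess, hrc]; simp
  set c := 1 / r with hc
  have hk : 0 < r - c := by linarith
  have hw : Tendsto (fun B => fieldWeight c (root r c B)) (𝓝[>] 0) (𝓝 (fieldWeight c 0)) := by
    have h2 : ContinuousAt (fieldWeight c) 0 := by
      unfold fieldWeight
      exact ContinuousAt.div (by fun_prop) (by fun_prop) (by simp; positivity)
    exact h2.tendsto.comp ht
  have hw0 := fieldWeight_pos h1 le_rfl h0
  have hratio : Tendsto (fun B => B / root r c B ^ 3) (𝓝[>] 0)
      (𝓝 (fieldWeight c 0 * (r - c) / 3)) := by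
    refine tendsto_of_tendsto_of_tendsto_of_le_of_le' tendsto_const_nhds
      ((hw.mul_const (r - c)).div_const 3) ?_ ?_
    · filter_upwards [self_mem_nhdsWithin] with B hB
      have hroot := isRoot_root h0 h1 hr.le (le_of_lt hB)
      have hpos := root_pos h0 h1 hr.le hB
      have h := cubic_le_fieldOf (r := r) (A := fieldWeight c 0 * (r - c) / 3) (C := 0) h0 h1
        hroot.nonneg hroot.lt (fun s hs0 hst => by
          have h2 := fieldWeight_mono h1 le_rfl hs0.le (hst.trans hroot.lt)
          rw [stiffness_eq, hexc]
          have h3 : 0 ≤ (r - c) * s ^ 2 := by positivity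
          nlinarith)
      rw [hroot.eq] at h
      rw [le_div_iff₀ (by positivity)]
      linarith
    · filter_upwards [self_mem_nhdsWithin] with B hB
      have hroot := isRoot_root h0 h1 hr.le (le_of_lt hB)
      have hpos := root_pos h0 h1 hr.le hB
      have h := fieldOf_le_cubic (r := r) (A := fieldWeight c (root r c B) * (r - c) / 3) (C := 0)
        h0 h1 hroot.nonneg hroot.lt (fun s hs0 hst => by
          have h2 := fieldWeight_mono h1 hs0.le hst.le hroot.lt
          rw [stiffness_eq, hexc]
          have h3 : 0 ≤ (r - c) * s ^ 2 := by positivity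
          nlinarith)
      rw [hroot.eq] at h
      rw [div_le_iff₀ (by positivity)]
      linarith
  have h2 := (((tendsto_const_nhds (x := 1 + c)).div ((ht.pow 2).const_add c)
    (by simp; linarith)).pow 3).div hratio (by positivity)
  refine ⟨_, ?_, h2.congr fun B => ?_⟩
  · simp only [ne_eq, OfNat.ofNat_ne_zero, not_false_eq_true, zero_pow, add_zero]
    positivity
  · simp only [Pi.div_apply, rootMagnetization]
    field_simp

end Limits

/-- The excess vanishes linearly at the critical inverse temperature. -/
lemma tendsto_excess_tanh_div (hr : 1 < r) {βc : ℝ} (hβc : tanh βc = 1 / r) :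
    Tendsto (fun β => excess r (tanh β) / (β - βc)) (𝓝[≠] βc) (𝓝 (1 - (1 / r) ^ 2)) := by
  have hr0 : r ≠ 0 := by linarith
  have h1 := hasDerivAt_tanh βc
  have h2 := h1.mul ((h1.const_mul r).sub_const 1)
  have h3 := hasDerivAt_iff_tendsto_slope.1 h2
  rw [hβc] at h3
  have e : (1 - (1 / r) ^ 2) * (r * (1 / r) - 1) + 1 / r * (r * (1 - (1 / r) ^ 2)) =
      1 - (1 / r) ^ 2 := by
    field_simp
    ring
  rw [e] at h3
  refine h3.congr fun β => ?_
  rw [slope_def_field]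
  simp only [Pi.mul_apply, hβc, mul_one_div_cancel hr0, sub_self, mul_zero, sub_zero, excess]

end CriticalBehaviour

/-! ### The critical exponents -/

section Exponents

open Real Set

variable {j : ℕ}

lemma one_lt_cast_succ (hj : 1 ≤ j) : (1 : ℝ) < ((j + 1 : ℕ) : ℝ) := by
  exact_mod_cast Nat.lt_succ_of_le hj

lemma mul_tanh_ne_one (hj : 1 ≤ j) {β : ℝ} (hβ : β ≠ criticalBeta (j + 2)) :
    ((j + 1 : ℕ) : ℝ) * tanh β ≠ 1 := by
  intro h
  have hr : ((j + 1 : ℕ) : ℝ) ≠ 0 := by positivity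
  refine hβ (tanh_strictMono.injective ?_)
  rw [tanh_criticalBeta hj]
  field_simp
  linarith

lemma tendsto_tanh_above (hj : 1 ≤ j) :
    Tendsto tanh (𝓝[>] criticalBeta (j + 2)) (𝓝[>] (1 / ((j + 1 : ℕ) : ℝ))) := by
  rw [← tanh_criticalBeta hj]
  refine tendsto_nhdsWithin_iff.2
    ⟨(hasDerivAt_tanh _).continuousAt.tendsto.mono_left nhdsWithin_le_nhds, ?_⟩
  filter_upwards [self_mem_nhdsWithin] with β hβ
  exact tanh_strictMono hβ

lemma tendsto_tanh_below (hj : 1 ≤ j) :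
    Tendsto tanh (𝓝[<] criticalBeta (j + 2)) (𝓝[<] (1 / ((j + 1 : ℕ) : ℝ))) := by
  rw [← tanh_criticalBeta hj]
  refine tendsto_nhdsWithin_iff.2
    ⟨(hasDerivAt_tanh _).continuousAt.tendsto.mono_left nhdsWithin_le_nhds, ?_⟩
  filter_upwards [self_mem_nhdsWithin] with β hβ
  exact tanh_strictMono hβ

lemma tendsto_sub_above (c : ℝ) : Tendsto (fun β => β - c) (𝓝[>] c) (𝓝[>] 0) := by
  refine tendsto_nhdsWithin_iff.2 ⟨?_, ?_⟩
  · have h : Tendsto (fun β : ℝ => β) (𝓝[>] c) (𝓝 c) := nhdsWithin_le_nhds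
    simpa using h.sub_const c
  · filter_upwards [self_mem_nhdsWithin] with β hβ
    exact sub_pos.2 (mem_Ioi.1 hβ)

lemma tendsto_sub_below (c : ℝ) : Tendsto (fun β => c - β) (𝓝[<] c) (𝓝[>] 0) := by
  refine tendsto_nhdsWithin_iff.2 ⟨?_, ?_⟩
  · have h : Tendsto (fun β : ℝ => β) (𝓝[<] c) (𝓝 c) := nhdsWithin_le_nhds
    simpa using h.const_sub c
  · filter_upwards [self_mem_nhdsWithin] with β hβ
    exact sub_pos.2 (mem_Iio.1 hβ)

lemma one_sub_sq_inv_pos (hj : 1 ≤ j) : 0 < 1 - (1 / ((j + 1 : ℕ) : ℝ)) ^ 2 := by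
  have hr := one_lt_cast_succ hj
  have h1 : 1 / ((j + 1 : ℕ) : ℝ) < 1 := by rw [div_lt_one (by linarith)]; exact hr
  have h0 : 0 < 1 / ((j + 1 : ℕ) : ℝ) := by positivity
  nlinarith

lemma tendsto_spontMagnetization (hj : 1 ≤ j) : ∃ L, 0 < L ∧
    Tendsto (fun β => spontMagnetization (j + 2) β / (β - criticalBeta (j + 2)) ^ (1 / 2 : ℝ))
      (𝓝[>] criticalBeta (j + 2)) (𝓝 L) := by
  have hr := one_lt_cast_succ hj
  obtain ⟨L, hL, h⟩ := tendsto_sq_rootMagnetization_div_excess hr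
  have h1 := (h.comp (tendsto_tanh_above hj)).mul
    ((tendsto_excess_tanh_div hr (tanh_criticalBeta hj)).mono_left
      (nhdsWithin_mono _ fun _ h => ne_of_gt h))
  have hpos := mul_pos hL (one_sub_sq_inv_pos hj)
  refine ⟨_, sqrt_pos.2 hpos, h1.sqrt.congr' ?_⟩
  filter_upwards [self_mem_nhdsWithin,
    (tendsto_tanh_above hj).eventually (eventually_supercritical hr)] with β hβ hT
  have hβ0 : 0 < β := (criticalBeta_pos hj).trans hβ
  have hsub : 0 < β - criticalBeta (j + 2) := sub_pos.2 hβ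
  have he := (excess_pos hT.1 hT.2.2).ne'
  have hroot := root_zero_pos hT.1 hT.2.1 hr.le hT.2.2
  have hM : 0 ≤ rootMagnetization (tanh β) (root ((j + 1 : ℕ) : ℝ) (tanh β) 0) := by
    have := hT.1
    unfold rootMagnetization
    positivity
  rw [Function.comp_apply, div_mul_div_cancel₀ he, sqrt_div (sq_nonneg _), sqrt_sq hM,
    spontMagnetization_eq j hβ0, sqrt_eq_rpow]

lemma tendsto_magnetization_critical (hj : 1 ≤ j) : ∃ L, 0 < L ∧
    Tendsto (fun B => magnetization (j + 2) (criticalBeta (j + 2)) B / B ^ (1 / 3 : ℝ))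
      (𝓝[>] 0) (𝓝 L) := by
  have hr := one_lt_cast_succ hj
  obtain ⟨L, hL, h⟩ := tendsto_cube_rootMagnetization_div hr
  have h1 := h.rpow_const (p := (1 / 3 : ℝ)) (Or.inl hL.ne')
  refine ⟨_, rpow_pos_of_pos hL _, h1.congr' ?_⟩
  filter_upwards [self_mem_nhdsWithin] with B hB
  have hB0 : 0 < B := hB
  have hT := tanh_pos (criticalBeta_pos hj)
  have hroot := root_pos hT (tanh_lt_one _) hr.le hB0
  rw [magnetization_eq j (criticalBeta_pos hj) hB0]
  rw [tanh_criticalBeta hj] at hroot ⊢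
  have hM : 0 ≤ rootMagnetization (1 / ((j + 1 : ℕ) : ℝ))
      (root ((j + 1 : ℕ) : ℝ) (1 / ((j + 1 : ℕ) : ℝ)) B) := by
    unfold rootMagnetization
    positivity
  rw [div_rpow (by positivity) hB0.le, ← rpow_natCast, ← rpow_mul hM]
  norm_num

lemma tendsto_zeroFieldSusceptibility_above (hj : 1 ≤ j) : ∃ L, 0 < L ∧
    Tendsto (fun β => zeroFieldSusceptibility (j + 2) β /
      (β - criticalBeta (j + 2)) ^ (-1 : ℝ)) (𝓝[>] criticalBeta (j + 2)) (𝓝 L) := by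
  have hr := one_lt_cast_succ hj
  obtain ⟨L, hL, h⟩ := tendsto_rootSusceptibility_mul_excess hr
  have hc := one_sub_sq_inv_pos hj
  have h1 := (h.comp (tendsto_tanh_above hj)).div
    ((tendsto_excess_tanh_div hr (tanh_criticalBeta hj)).mono_left
      (nhdsWithin_mono _ fun _ h => ne_of_gt h)) hc.ne'
  refine ⟨_, div_pos hL hc, h1.congr' ?_⟩
  filter_upwards [self_mem_nhdsWithin,
    (tendsto_tanh_above hj).eventually (eventually_supercritical hr)] with β hβ hT
  have hβ0 : 0 < β := (criticalBeta_pos hj).trans hβ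
  have hsub : 0 < β - criticalBeta (j + 2) := sub_pos.2 hβ
  have he := (excess_pos hT.1 hT.2.2).ne'
  rw [zeroFieldSusceptibility_eq j hβ0 (mul_tanh_ne_one hj (ne_of_gt hβ)), rpow_neg_one]
  simp only [Pi.div_apply, Function.comp_apply]
  field_simp

lemma tendsto_zeroFieldSusceptibility_below (hj : 1 ≤ j) : ∃ L, 0 < L ∧
    Tendsto (fun β => zeroFieldSusceptibility (j + 2) β /
      (criticalBeta (j + 2) - β) ^ (-1 : ℝ)) (𝓝[<] criticalBeta (j + 2)) (𝓝 L) := by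
  have hr := one_lt_cast_succ hj
  obtain ⟨L, hL, h⟩ := tendsto_rootSusceptibility_mul_neg_excess hr
  have hc := one_sub_sq_inv_pos hj
  have h1 := (h.comp (tendsto_tanh_below hj)).div
    ((tendsto_excess_tanh_div hr (tanh_criticalBeta hj)).mono_left
      (nhdsWithin_mono _ fun _ h => ne_of_lt h)) hc.ne'
  refine ⟨_, div_pos hL hc, h1.congr' ?_⟩
  filter_upwards [self_mem_nhdsWithin, Ioo_mem_nhdsLT (criticalBeta_pos hj),
    (tendsto_tanh_below hj).eventually (eventually_subcritical hr)] with β hβ hβ0 hT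
  have hsub : 0 < criticalBeta (j + 2) - β := sub_pos.2 hβ
  have he : excess ((j + 1 : ℕ) : ℝ) (tanh β) ≠ 0 :=
    mul_ne_zero hT.1.ne' (by linarith [hT.2.2])
  rw [zeroFieldSusceptibility_eq j hβ0.1 (mul_tanh_ne_one hj (ne_of_lt hβ)), rpow_neg_one]
  have hsub' : β - criticalBeta (j + 2) = -(criticalBeta (j + 2) - β) := by ring
  simp only [Pi.div_apply, Function.comp_apply, hsub']
  field_simp

lemma tendsto_zeroFieldSpecificHeat_above (hj : 1 ≤ j) : ∃ L, 0 < L ∧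
    Tendsto (fun β => zeroFieldSpecificHeat (j + 2) β /
      (β - criticalBeta (j + 2)) ^ (0 : ℝ)) (𝓝[>] criticalBeta (j + 2)) (𝓝 L) := by
  obtain ⟨L, hL, h⟩ := tendsto_rootSpecificHeat_above (one_lt_cast_succ hj)
    (Nat.succ_pos (j + 1))
  refine ⟨L, hL, (h.comp (tendsto_tanh_above hj)).congr' ?_⟩
  filter_upwards [self_mem_nhdsWithin] with β hβ
  rw [zeroFieldSpecificHeat_eq j ((criticalBeta_pos hj).trans hβ)
    (mul_tanh_ne_one hj (ne_of_gt hβ)), rpow_zero, div_one]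
  rfl

lemma tendsto_zeroFieldSpecificHeat_below (hj : 1 ≤ j) : ∃ L, 0 < L ∧
    Tendsto (fun β => zeroFieldSpecificHeat (j + 2) β /
      (criticalBeta (j + 2) - β) ^ (0 : ℝ)) (𝓝[<] criticalBeta (j + 2)) (𝓝 L) := by
  obtain ⟨L, hL, h⟩ := tendsto_rootSpecificHeat_below (one_lt_cast_succ hj)
    (Nat.succ_pos (j + 1))
  refine ⟨L, hL, (h.comp (tendsto_tanh_below hj)).congr' ?_⟩
  filter_upwards [self_mem_nhdsWithin, Ioo_mem_nhdsLT (criticalBeta_pos hj)] with β hβ hβ0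
  rw [zeroFieldSpecificHeat_eq j hβ0.1 (mul_tanh_ne_one hj (ne_of_lt hβ)), rpow_zero, div_one]
  rfl

/-- Each defining relation of a critical exponent has a unique solution, because the
corresponding ratio has a positive limit for the mean-field exponent. -/
theorem areCriticalExponents_iff (hj : 1 ≤ j) (b δ γ γ' α α' : ℝ) :
    AreCriticalExponents (j + 2) b δ γ γ' α α' ↔
      b = 1 / 2 ∧ δ = 3 ∧ γ = 1 ∧ γ' = 1 ∧ α = 0 ∧ α' = 0 := by
  obtain ⟨_, hL₁, h₁⟩ := tendsto_spontMagnetization hj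
  obtain ⟨_, hL₂, h₂⟩ := tendsto_magnetization_critical hj
  obtain ⟨_, hL₃, h₃⟩ := tendsto_zeroFieldSusceptibility_below hj
  obtain ⟨_, hL₄, h₄⟩ := tendsto_zeroFieldSusceptibility_above hj
  obtain ⟨_, hL₅, h₅⟩ := tendsto_zeroFieldSpecificHeat_below hj
  obtain ⟨_, hL₆, h₆⟩ := tendsto_zeroFieldSpecificHeat_above hj
  have hx := tendsto_sub_above (criticalBeta (j + 2))
  have hy := tendsto_sub_below (criticalBeta (j + 2))
  have e₁ := asymp_rpow_iff hx hL₁ h₁ b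
  have e₂ := asymp_rpow_iff (x := fun B => B) tendsto_id hL₂ h₂ (1 / δ)
  have e₃ := asymp_rpow_iff hy hL₃ h₃ (-γ)
  have e₄ := asymp_rpow_iff hx hL₄ h₄ (-γ')
  have e₅ := asymp_rpow_iff hy hL₅ h₅ (-α)
  have e₆ := asymp_rpow_iff hx hL₆ h₆ (-α')
  have hδ : 1 / δ = 1 / 3 ↔ δ = 3 := by rw [one_div, one_div, inv_inj]
  constructor
  · intro h
    exact ⟨e₁.1 h.1, hδ.1 (e₂.1 h.2), neg_inj.1 (e₃.1 h.3), neg_inj.1 (e₄.1 h.4),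
      neg_eq_zero.1 (e₅.1 h.5), neg_eq_zero.1 (e₆.1 h.6)⟩
  · rintro ⟨hb, hd, hγ, hγ', hα, hα'⟩
    exact ⟨e₁.2 hb, e₂.2 (hδ.2 hd), e₃.2 (neg_inj.2 hγ), e₄.2 (neg_inj.2 hγ'),
      e₅.2 (neg_eq_zero.2 hα), e₆.2 (neg_eq_zero.2 hα')⟩

end Exponents

end AnnealedIsing

open AnnealedIsing in
theorem theorem1p2 (d : ℕ) (hd : 3 ≤ d) :
    -- the thermodynamic limits exist
    (∀ β B : ℝ, 0 ≤ β → 0 < B →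
      Tendsto (fun n => pressureN d n β B) (sizes d) (𝓝 (pressure d β B)) ∧
      Tendsto (fun n => magnetizationN d n β B) (sizes d) (𝓝 (magnetization d β B)) ∧
      Tendsto (fun n => susceptibilityN d n β B) (sizes d) (𝓝 (susceptibility d β B))) ∧
    -- the limiting pressure is twice differentiable in the inverse temperature
    (∀ β B : ℝ, 0 < β → 0 < B →
      DifferentiableAt ℝ (fun b => pressure d b B) β ∧
      DifferentiableAt ℝ (deriv fun b => pressure d b B) β) ∧
    -- the critical inverse temperature is a positive real number
    (orderedPhase d).Nonempty ∧ 0 < criticalBeta d ∧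
    -- the zero-field limits exist
    (∀ β : ℝ, 0 ≤ β →
      Tendsto (fun B => magnetization d β B) (𝓝[>] 0) (𝓝 (spontMagnetization d β))) ∧
    (∀ β : ℝ, 0 < β → β ≠ criticalBeta d →
      Tendsto (fun B => susceptibility d β B) (𝓝[>] 0) (𝓝 (zeroFieldSusceptibility d β)) ∧
      Tendsto (fun B => specificHeat d β B) (𝓝[>] 0) (𝓝 (zeroFieldSpecificHeat d β))) ∧
    -- the critical exponents exist, are unique, and take the mean-field values
    (∀ b δ γ γ' α α' : ℝ, AreCriticalExponents d b δ γ γ' α α' ↔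
      b = 1 / 2 ∧ δ = 3 ∧ γ = 1 ∧ γ' = 1 ∧ α = 0 ∧ α' = 0) := by
  obtain ⟨j, rfl⟩ : ∃ j, d = j + 2 := ⟨d - 2, by omega⟩
  have hj : 1 ≤ j := by omega
  refine ⟨fun β B hβ hB => ?_, fun β B hβ hB => ?_, ?_, criticalBeta_pos hj, fun β hβ => ?_,
    fun β hβ hne => ?_, fun b δ γ γ' α α' => areCriticalExponents_iff hj b δ γ γ' α α'⟩
  · rcases hβ.eq_or_lt with rfl | hβ
    · obtain ⟨h1, h2, h3⟩ := tendsto_of_zero (j + 2) B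
      exact ⟨tendsto_nhds_limUnder ⟨_, h1⟩, tendsto_nhds_limUnder ⟨_, h2⟩,
        tendsto_nhds_limUnder ⟨_, h3⟩⟩
    · obtain ⟨h1, h2, h3⟩ := tendsto_of_pos j hβ hB
      exact ⟨tendsto_nhds_limUnder ⟨_, h1⟩, tendsto_nhds_limUnder ⟨_, h2⟩,
        tendsto_nhds_limUnder ⟨_, h3⟩⟩
  · exact ⟨(hasDerivAt_pressure j hβ hB).differentiableAt,
      (hasDerivAt_deriv_pressure j hβ hB).differentiableAt⟩
  · rw [orderedPhase_eq hj]
    exact Set.nonempty_Ioi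
  · rcases hβ.eq_or_lt with rfl | hβ
    · exact tendsto_nhds_limUnder ⟨_, tendsto_magnetization_zero_field_of_zero (j + 2)⟩
    · exact tendsto_nhds_limUnder ⟨_, tendsto_magnetization_zero_field j hβ⟩
  · have h := mul_tanh_ne_one hj hne
    exact ⟨tendsto_nhds_limUnder ⟨_, tendsto_susceptibility_zero_field j hβ h⟩,
      tendsto_nhds_limUnder ⟨_, tendsto_specificHeat_zero_field j hβ h⟩⟩
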